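/- Let $q\in\mathbb C$, $0<|q|<1$, fix a square root $q^{1/2}$ of $q$ (and put $q^{N/2}=(q^{1/2})^N$), and let $(x;q)_n=\prod_{k=0}^{n-1}(1-xq^k)$, $(x_1,\dots,x_s;q)_n=\prod_i (x_i;q)_n$ and $\Omega(q)=\{q^{-k}:k=0,1,2,\dots\}$. Let $N\ge 1$ and $a,b,c,d\in\mathbb C$ with $c,d\neq0$, $abcd\notin\Omega(q)$, $$ab=q^{-N+1},\qquad a^2,b^2\notin\{q^{0},q^{-1},\dots,q^{-N+1}\}.$$ Let $p_n(x)=p_n(x;a,b,c,d;q)$ be the monic Askey–Wilson polynomials, $$p_n(x)=\frac{1}{(2a)^n(abcdq^{n-1};q)_n}\sum_{k=0}^n\frac{(q^{-n},abcdq^{n-1};q)_k}{(q;q)_k}\,q^k\,(abq^k,acq^k,adq^k;q)_{n-k}\prod_{i=0}^{k-1}(1-2axq^i+a^2q^{2i}).$$ Let $\gamma_n$ $(n\ge1)$ be the coefficients of their recurrence relation $xp_n=p_{n+1}+\beta_np_n+\gamma_np_{n-1}$, that is, $\gamma_n=A_{n-1}C_n/4$ with $$A_n=\frac{(1-abq^n)(1-acq^n)(1-adq^n)(1-abcdq^{n-1})}{a(1-abcdq^{2n-1})(1-abcdq^{2n})},\qquad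 C_n=\frac{a(1-q^n)(1-bcq^{n-1})(1-bdq^{n-1})(1-cdq^{n-1})}{(1-abcdq^{2n-2})(1-abcdq^{2n-1})}$$ (for $n=0$ the common factor $1-abcdq^{-1}$ in $A_0$ is cancelled), and assume that $\Lambda=\{n\ge 1:\gamma_n=0\}$ equals $\{N\}$. For polynomials $p\in\mathbb C[x]$ define the following. (1) The $q$-Racah functional $$\mathscr L_0(p)=\sum_{j=0}^{N-1}\frac{(q^{-N+1},ac,ad,a^2;q)_j}{(q,a^2q^N,ac^{-1}q,ad^{-1}q;q)_j}\,\frac{1-a^2q^{2j}}{(cdq^{-N})^j(1-a^2)}\;p\!\left(\frac{q^{-j}+a^2q^j}{2a}\right).$$ (2) The Askey–Wilson $q$-difference operator $\mathscr D_q$: with $x(z)=(z+z^{-1})/2$, $\mathscr D_qp$ is the polynomial such that $$(\mathscr D_q p)(x(z))=\frac{p(x(q^{1/2}z))-p(x(q^{-1/2}z))}{x(q^{1/2}z)-x(q^{-1/2}z)} .$$ (3) The Askey–Wilson functional with parameters $\alpha_1=aq^{N/2},\ \alpha_2=bq^{N/2},\ \alpha_3=cq^{N/2},\ \alpha_4=dq^{N/2}$,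 $$\mathscr L_N(p)=\int_\Gamma p(x(z))\,\frac1z\,w(x(z))\,dz,\qquad w(x)=\frac{h(x,1)h(x,-1)h(x,q^{1/2})h(x,-q^{1/2})}{h(x,\alpha_1)h(x,\alpha_2)h(x,\alpha_3)h(x,\alpha_4)},\qquad h(x,\alpha)=\prod_{k=0}^\infty(1-2\alpha xq^k+\alpha^2q^{2k}),$$ where $\Gamma$ is any contour separating the poles: a closed piecewise smooth curve in $\mathbb C\setminus\{0\}$ that passes through none of the points $\alpha_iq^k$, $\alpha_i^{-1}q^{-k}$ $(1\le i\le4,\ k\ge0)$, and has winding number $1$ about $0$ and about every $\alpha_iq^k$ and winding number $0$ about every $\alpha_i^{-1}q^{-k}$. (It is assumed that such a $\Gamma$ exists.) Put $$\langle f,g\rangle=\mathscr L_0(fg)+\mathscr L_N\big(\mathscr D_q^N f\cdot\mathscr D_q^N g\big).$$ Then each $p_n$ is monic of degree $n$, $\langle p_n,p_m\rangle=0$ for all $n\ne m$, and $\langle p_n,p_n\rangle\neq0$ for all $n\ge0$. Moreover, $(p_n)$ is uniquely determined, up to constants, by the orthogonality: if $(P_n)_{n\ge0}$ is a sequence of complex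 polynomials with $\deg P_n=n$ and $\langle P_n,P_m\rangle=0$ for all $n\neq m$, then for every $n$ there is a constant $\kappa_n\ne0$ with $P_n=\kappa_np_n$. -/

import Mathlib

open Polynomial

noncomputable section

namespace AskeyWilson

/-- The finite `q`-Pochhammer symbol `(x;q)_n = ∏_{0 ≤ k < n} (1 - x q^k)`. -/
def qPoch (q x : ℂ) (n : ℕ) : ℂ := ∏ k ∈ Finset.range n, (1 - x * q ^ k)

/-- The set `Ω(q) = {q^{-k} : k = 0, 1, 2, …}`. -/
def Omega (q : ℂ) : Set ℂ := {x | ∃ k : ℕ, x = (q ^ k)⁻¹}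

/-- The monic Askey-Wilson polynomial of degree `n`,
`(ab,ac,ad;q)_n / ((2a)^n (abcd q^{n-1};q)_n) · ₄φ₃(q^{-n}, abcd q^{n-1}, a e^{iθ}, a e^{-iθ};
ab, ac, ad; q, q)` with `x = cos θ`. The quotients `(ab;q)_n / (ab;q)_k` of the prefactor by the
lower parameters are written as `(ab q^k;q)_{n-k}`, so that the formula is also meaningful when
`ab ∈ Ω(q)`; and `(a e^{iθ}, a e^{-iθ};q)_k = ∏_{i<k} (1 - 2 a x q^i + a² q^{2i})`. -/
def monicPoly (q a b c d : ℂ) (n : ℕ) : ℂ[X] :=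
  C ((2 * a) ^ n * qPoch q (a * b * c * d * q ^ ((n : ℤ) - 1)) n)⁻¹ *
    ∑ k ∈ Finset.range (n + 1),
      C (qPoch q (q ^ (-(n : ℤ))) k * qPoch q (a * b * c * d * q ^ ((n : ℤ) - 1)) k / qPoch q q k
          * q ^ k * qPoch q (a * b * q ^ k) (n - k) * qPoch q (a * c * q ^ k) (n - k)
          * qPoch q (a * d * q ^ k) (n - k)) *
        ∏ i ∈ Finset.range k, (1 - C (2 * a * q ^ i) * X + C (a ^ 2 * q ^ (2 * i)))

/-- The coefficient `A_n` of the recurrence relation. For `n = 0` the common factor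
`1 - abcd q^{-1}` of numerator and denominator is cancelled. -/
def coeffA (q a b c d : ℂ) : ℕ → ℂ
  | 0 => (1 - a * b) * (1 - a * c) * (1 - a * d) / (a * (1 - a * b * c * d))
  | n + 1 =>
      (1 - a * b * q ^ (n + 1)) * (1 - a * c * q ^ (n + 1)) * (1 - a * d * q ^ (n + 1))
          * (1 - a * b * c * d * q ^ n)
        / (a * (1 - a * b * c * d * q ^ (2 * n + 1)) * (1 - a * b * c * d * q ^ (2 * n + 2)))

/-- The coefficient `C_n` of the recurrence relation, for `n ≥ 1`. -/
def coeffC (q a b c d : ℂ) (n : ℕ) : ℂ :=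
  a * (1 - q ^ n) * (1 - b * c * q ^ (n - 1)) * (1 - b * d * q ^ (n - 1))
      * (1 - c * d * q ^ (n - 1))
    / ((1 - a * b * c * d * q ^ (2 * n - 2)) * (1 - a * b * c * d * q ^ (2 * n - 1)))

/-- The recurrence coefficient `γ_n = A_{n-1} C_n / 4`, for `n ≥ 1`. -/
def gammaCoeff (q a b c d : ℂ) (n : ℕ) : ℂ :=
  coeffA q a b c d (n - 1) * coeffC q a b c d n / 4

/-- The set `Λ = {n ≥ 1 : γ_n = 0}`. -/
def Lam (q a b c d : ℂ) : Set ℕ := {n | 1 ≤ n ∧ gammaCoeff q a b c d n = 0}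

/-- The finite (`q`-Racah) moment functional `L_0`. -/
def L0 (q a c d : ℂ) (N : ℕ) (p : ℂ[X]) : ℂ :=
  ∑ j ∈ Finset.range N,
    qPoch q (q ^ (1 - (N : ℤ))) j * qPoch q (a * c) j * qPoch q (a * d) j * qPoch q (a ^ 2) j
        / (qPoch q q j * qPoch q (a ^ 2 * q ^ N) j * qPoch q (a * c⁻¹ * q) j
            * qPoch q (a * d⁻¹ * q) j)
      * ((1 - a ^ 2 * q ^ (2 * j)) / ((c * d * q ^ (-(N : ℤ))) ^ j * (1 - a ^ 2)))
      * p.eval ((q ^ (-(j : ℤ)) + a ^ 2 * q ^ j) / (2 * a))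

/-- The divided difference of `x^n` on the lattice `x(z) = (z + z⁻¹)/2`. With `u = x(r z)` and
`v = x(r⁻¹ z)`, where `r² = q`, one has `u + v = (r + r⁻¹) x(z)` and
`u v = x(z)² + (r - r⁻¹)²/4`, so that `(u^n - v^n)/(u - v)` is a polynomial in `x(z)` obeying
the recursion below (see `awDiff_spec`). -/
def awDiffPow (r : ℂ) : ℕ → ℂ[X]
  | 0 => 0
  | 1 => 1
  | n + 2 => C (r + r⁻¹) * X * awDiffPow r (n + 1)
      - (X ^ 2 + C ((r - r⁻¹) ^ 2 / 4)) * awDiffPow r n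

/-- The Askey-Wilson `q`-difference operator `D_q` on polynomials (`r` is a square root of `q`):
`D_q p` is the polynomial with
`(D_q p)(x(z)) = (p(x(q^{1/2} z)) - p(x(q^{-1/2} z))) / (x(q^{1/2} z) - x(q^{-1/2} z))`,
where `x(z) = (z + z⁻¹)/2`. -/
def awDiff (r : ℂ) : ℂ[X] →ₗ[ℂ] ℂ[X] :=
  Polynomial.lsum fun n => LinearMap.toSpanSingleton ℂ ℂ[X] (awDiffPow r n)

/-- The lattice `x(z) = (z + z⁻¹)/2`. -/
def lat (z : ℂ) : ℂ := (z + z⁻¹) / 2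

theorem awDiffPow_spec (r z : ℂ) (hr : r ≠ 0) (hz : z ≠ 0) (n : ℕ) :
    (awDiffPow r n).eval (lat z) * (lat (r * z) - lat (r⁻¹ * z))
      = lat (r * z) ^ n - lat (r⁻¹ * z) ^ n := by
  induction n using Nat.twoStepInduction with
  | zero => simp [awDiffPow]
  | one => simp [awDiffPow]
  | more n h1 h2 =>
    have hs : (r + r⁻¹) * lat z = lat (r * z) + lat (r⁻¹ * z) := by
      unfold lat; field_simp; ring
    have hp : lat z ^ 2 + (r - r⁻¹) ^ 2 / 4 = lat (r * z) * lat (r⁻¹ * z) := by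
      unfold lat; field_simp; ring
    simp only [awDiffPow, eval_sub, eval_mul, eval_add, eval_C, eval_X, eval_pow]
    rw [hs, hp]
    linear_combination (lat (r * z) + lat (r⁻¹ * z)) * h2 - lat (r * z) * lat (r⁻¹ * z) * h1

/-- The defining property of the Askey-Wilson operator. -/
theorem awDiff_spec (r z : ℂ) (hr : r ≠ 0) (hz : z ≠ 0) (p : ℂ[X]) :
    (awDiff r p).eval (lat z) * (lat (r * z) - lat (r⁻¹ * z))
      = p.eval (lat (r * z)) - p.eval (lat (r⁻¹ * z)) := by
  induction p using Polynomial.induction_on' with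
  | add p s hp hs => rw [map_add, eval_add, add_mul, hp, hs, eval_add, eval_add]; ring
  | monomial n a =>
    have h : awDiff r (monomial n a) = a • awDiffPow r n := by
      simp [awDiff, Polynomial.lsum_apply, Polynomial.sum_monomial_index]
    rw [h, eval_smul, smul_eq_mul, mul_assoc, awDiffPow_spec r z hr hz n, eval_monomial,
      eval_monomial]
    ring

/-- `h(x,α) = ∏_{k ≥ 0} (1 - 2 α x q^k + α² q^{2k})`. -/
def hProd (q x α : ℂ) : ℂ := ∏' k : ℕ, (1 - 2 * α * x * q ^ k + α ^ 2 * q ^ (2 * k))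

/-- The Askey-Wilson weight `w(x; a, b, c, d; q)`, with `r = q^{1/2}`. -/
def weight (q r a b c d x : ℂ) : ℂ :=
  hProd q x 1 * hProd q x (-1) * hProd q x r * hProd q x (-r)
    / (hProd q x a * hProd q x b * hProd q x c * hProd q x d)

/-- A closed contour: a closed curve `γ : [0,1] → ℂ`, differentiable off a finite set and with
integrable derivative. All piecewise `C¹` closed curves are of this kind. -/
structure IsClosedContour (γ : ℝ → ℂ) : Prop where
  continuousOn : ContinuousOn γ (Set.Icc 0 1)
  closed : γ 0 = γ 1
  differentiable : ∃ S : Finset ℝ, ∀ t ∈ Set.Ioo (0 : ℝ) 1, t ∉ S → DifferentiableAt ℝ γ t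
  integrable : IntervalIntegrable (deriv γ) MeasureTheory.volume 0 1

/-- The contour integral `∫_γ f(z) dz`. -/
def contourIntegral (γ : ℝ → ℂ) (f : ℂ → ℂ) : ℂ := ∫ t in (0 : ℝ)..1, f (γ t) * deriv γ t

/-- The winding number of `γ` about `w` (for `w` not on `γ`). -/
def windingNumber (γ : ℝ → ℂ) (w : ℂ) : ℂ :=
  (2 * (Real.pi : ℂ) * Complex.I)⁻¹ * contourIntegral γ (fun z => (z - w)⁻¹)

/-- The convergent poles `a q^k, b q^k, c q^k, d q^k`. -/
def convergentPoles (q a b c d : ℂ) : Set ℂ :=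
  {z | ∃ α ∈ ({a, b, c, d} : Set ℂ), ∃ k : ℕ, z = α * q ^ k}

/-- The divergent poles `a⁻¹ q^{-k}, b⁻¹ q^{-k}, c⁻¹ q^{-k}, d⁻¹ q^{-k}`. -/
def divergentPoles (q a b c d : ℂ) : Set ℂ :=
  {z | ∃ α ∈ ({a, b, c, d} : Set ℂ), ∃ k : ℕ, z = α⁻¹ * (q ^ k)⁻¹}

/-- `γ` is a contour that separates the convergent poles from the divergent ones, encircling the
former exactly once. It runs in `ℂ \ {0}`; that it encircles `0` exactly once is automatic for
nonzero parameters, since the convergent poles accumulate there. -/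
structure SeparatesPoles (q a b c d : ℂ) (γ : ℝ → ℂ) : Prop where
  contour : IsClosedContour γ
  avoids : ∀ t ∈ Set.Icc (0 : ℝ) 1,
    γ t ≠ 0 ∧ γ t ∉ convergentPoles q a b c d ∧ γ t ∉ divergentPoles q a b c d
  winding_zero : windingNumber γ 0 = 1
  winding_convergent : ∀ w ∈ convergentPoles q a b c d, windingNumber γ w = 1
  winding_divergent : ∀ w ∈ divergentPoles q a b c d, windingNumber γ w = 0

/-- The Askey-Wilson functional
`p ↦ ∫_γ p((z + z⁻¹)/2) (1/z) w((z + z⁻¹)/2; a, b, c, d; q) dz`, with `r = q^{1/2}`. -/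
def awFunctional (q r a b c d : ℂ) (γ : ℝ → ℂ) (p : ℂ[X]) : ℂ :=
  contourIntegral γ fun z => p.eval (lat z) * (1 / z) * weight q r a b c d (lat z)

/-- The Sobolev-type form `⟨f,g⟩ = L_0(f g) + L_N(D_q^N f · D_q^N g)`, where `L_N` is the
Askey-Wilson functional with parameters `a q^{N/2}, b q^{N/2}, c q^{N/2}, d q^{N/2}`, and
`r = q^{1/2}`. -/
def sobolevForm (q r a b c d : ℂ) (N : ℕ) (γ : ℝ → ℂ) (f g : ℂ[X]) : ℂ :=
  L0 q a c d N (f * g)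
    + awFunctional q r (a * r ^ N) (b * r ^ N) (c * r ^ N) (d * r ^ N) γ
        ((awDiff r)^[N] f * (awDiff r)^[N] g)

/-- `p` is an orthogonal polynomial system with respect to the form `B`. -/
structure IsOPS (B : ℂ[X] → ℂ[X] → ℂ) (p : ℕ → ℂ[X]) : Prop where
  degree : ∀ n, (p n).degree = n
  orthogonal : ∀ n m, n ≠ m → B (p n) (p m) = 0
  norm_ne_zero : ∀ n, B (p n) (p n) ≠ 0

end AskeyWilson

end

/-! Write φ_k(a) for `awBasis q a k`. Two facts make the Gram matrix of the form block diagonal,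
with blocks n, m < N and n, m ≥ N. For n ≥ N the polynomial p_n vanishes on all nodes of L_0: as ab
q^{N-1} = 1, its coefficients at φ_k(a), k < N, are zero, and every φ_k(a) with k ≥ N vanishes on
the nodes (`RacahRegular.L0Linear_monicPoly_mul`). On the other hand D_q^N kills p_n for n < N, and
for n ≥ N it yields a nonzero multiple of the Askey–Wilson polynomial of degree n - N with all
parameters scaled by q^{N/2} (`awDiff_iterate_monicPoly`). Hence the first block only sees L_0 and
the second only L_N.

One algebraic argument serves both blocks. `IsAWFunctional` asks for a first-order recurrence of the
moments T(φ_k(a)). This gives product formulas for T(φ_k(a) φ_j(b)), and T(p_n φ_j(b)) becomes a sum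
∑ (q^{-n};q)_k / (q;q)_k q^k R(q^k). For j < n, R is a polynomial of degree below n and the sum
vanishes; for j = n, R has one simple pole and the sum is a product of factors that can be read off.

Both functionals satisfy the recurrence because `stepDefect` times the weight is an exact
difference. For L_0 the sum telescopes and both boundary terms are zero
(`RacahRegular.sum_racahWeight`). For L_N the integrand is f(z) - f(z/q) up to the factor 1/z, and
the contours γ and q^{-1}γ wind equally about every singularity, so Cauchy's theorem in homology
form, proved by Dixon's method, applies.

For the norms, Λ = {N} excludes zero factors, and T(1) ≠ 0 remains. For L_0 one tests on φ_{N-1}(a),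
which lives on the last node only. For L_N, a zero integral would stay zero when all parameters are
multiplied by q^n; in the limit the constant term of (z², z^{-2};q)_∞ would vanish, which its
quasi-periodicity forbids (`awFunctional_one_ne_zero`). Uniqueness then follows by induction on the
degree, the form being symmetric with nonzero norms. -/

noncomputable section

namespace AskeyWilson

open MeasureTheory Set Filter Topology Metric
open scoped Interval

/-! ### Contour integrals, winding numbers and Cauchy's theorem in homology form. -/

section Contour

variable {γ : ℝ → ℂ}

theorem IsClosedContour.isCompact_image (hγ : IsClosedContour γ) : IsCompact (γ '' Icc 0 1) :=
  isCompact_Icc.image_of_continuousOn hγ.continuousOn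

theorem IsClosedContour.intervalIntegrable_mul (hγ : IsClosedContour γ) {g : ℝ → ℂ}
    (hg : ContinuousOn g (Icc 0 1)) :
    IntervalIntegrable (fun t => g t * deriv γ t) volume 0 1 :=
  hγ.integrable.continuousOn_mul (by rwa [uIcc_of_le zero_le_one])

theorem IsClosedContour.intervalIntegrable_comp_mul (hγ : IsClosedContour γ) {f : ℂ → ℂ}
    (hf : ContinuousOn f (γ '' Icc 0 1)) :
    IntervalIntegrable (fun t => f (γ t) * deriv γ t) volume 0 1 :=
  hγ.intervalIntegrable_mul (hf.comp hγ.continuousOn (mapsTo_image _ _))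

theorem contourIntegral_congr {f g : ℂ → ℂ} (h : ∀ t ∈ Icc (0 : ℝ) 1, f (γ t) = g (γ t)) :
    contourIntegral γ f = contourIntegral γ g := by
  refine intervalIntegral.integral_congr fun t ht => ?_
  rw [uIcc_of_le zero_le_one] at ht
  simp only [h t ht]

theorem IsClosedContour.contourIntegral_add (hγ : IsClosedContour γ) {f g : ℂ → ℂ}
    (hf : ContinuousOn f (γ '' Icc 0 1)) (hg : ContinuousOn g (γ '' Icc 0 1)) :
    contourIntegral γ (fun z => f z + g z) = contourIntegral γ f + contourIntegral γ g := by
  unfold contourIntegral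
  simp only [add_mul]
  exact intervalIntegral.integral_add (hγ.intervalIntegrable_comp_mul hf)
    (hγ.intervalIntegrable_comp_mul hg)

theorem IsClosedContour.contourIntegral_sub (hγ : IsClosedContour γ) {f g : ℂ → ℂ}
    (hf : ContinuousOn f (γ '' Icc 0 1)) (hg : ContinuousOn g (γ '' Icc 0 1)) :
    contourIntegral γ (fun z => f z - g z) = contourIntegral γ f - contourIntegral γ g := by
  unfold contourIntegral
  simp only [sub_mul]
  exact intervalIntegral.integral_sub (hγ.intervalIntegrable_comp_mul hf)
    (hγ.intervalIntegrable_comp_mul hg)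

theorem contourIntegral_const_mul (c : ℂ) (f : ℂ → ℂ) :
    contourIntegral γ (fun z => c * f z) = c * contourIntegral γ f := by
  unfold contourIntegral
  simp only [mul_assoc, intervalIntegral.integral_const_mul]

/-- The integral of a derivative along a closed contour vanishes. -/
theorem IsClosedContour.contourIntegral_deriv (hγ : IsClosedContour γ) {f f' : ℂ → ℂ}
    (hf : ∀ t ∈ Icc (0 : ℝ) 1, HasDerivAt f (f' (γ t)) (γ t))
    (hf' : ContinuousOn f' (γ '' Icc 0 1)) : contourIntegral γ f' = 0 := by
  obtain ⟨S, hS⟩ := hγ.differentiable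
  have h := integral_eq_of_hasDerivAt_off_countable_of_le (fun t => f (γ t))
    (fun t => f' (γ t) * deriv γ t) zero_le_one (s := (S : Set ℝ)) S.countable_toSet
    (fun t ht => (hf t ht).continuousAt.comp_continuousWithinAt (hγ.continuousOn t ht))
    (fun t ht => (hf t (Ioo_subset_Icc_self ht.1)).comp t (hS t ht.1 ht.2).hasDerivAt)
    (hγ.intervalIntegrable_comp_mul hf')
  unfold contourIntegral
  rw [h, hγ.closed, sub_self]

theorem IsClosedContour.exists_norm_contourIntegral_le (hγ : IsClosedContour γ) :
    ∃ B : ℝ, 0 ≤ B ∧ ∀ (f : ℂ → ℂ) (C : ℝ), (∀ t ∈ Icc (0 : ℝ) 1, ‖f (γ t)‖ ≤ C) →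
      ‖contourIntegral γ f‖ ≤ C * B := by
  refine ⟨∫ t in (0 : ℝ)..1, ‖deriv γ t‖,
    intervalIntegral.integral_nonneg zero_le_one fun _ _ => norm_nonneg _, fun f C h => ?_⟩
  rw [← intervalIntegral.integral_const_mul]
  refine intervalIntegral.norm_integral_le_of_norm_le zero_le_one ?_
    (hγ.integrable.norm.const_mul C)
  refine Eventually.of_forall fun t ht => ?_
  rw [norm_mul]
  exact mul_le_mul_of_nonneg_right (h t (Ioc_subset_Icc_self ht)) (norm_nonneg _)

/-- Holomorphy of contour integrals in a parameter. -/
theorem IsClosedContour.differentiableOn_contourIntegral (hγ : IsClosedContour γ)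
    {G : ℂ → ℂ → ℂ} {S : Set ℂ}
    (hd : ∀ t ∈ Icc (0 : ℝ) 1, DifferentiableOn ℂ (fun w => G w (γ t)) S)
    (hc : ∀ w ∈ S, ContinuousOn (fun t => G w (γ t)) (Icc 0 1))
    (hb : ∀ w₀ ∈ S, ∃ R > 0, ∃ C : ℝ, ball w₀ R ⊆ S ∧
      ∀ w ∈ ball w₀ R, ∀ t ∈ Icc (0 : ℝ) 1, ‖G w (γ t)‖ ≤ C) :
    DifferentiableOn ℂ (fun w => contourIntegral γ (G w)) S := by
  intro w₀ hw₀
  obtain ⟨R, hR, C, hRS, hC⟩ := hb w₀ hw₀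
  have hsub : ∀ t ∈ Ι (0 : ℝ) 1, t ∈ Icc (0 : ℝ) 1 := fun t ht => by
    rw [uIoc_of_le zero_le_one] at ht
    exact Ioc_subset_Icc_self ht
  have hda : ∀ t ∈ Icc (0 : ℝ) 1, ∀ w ∈ ball w₀ R,
      DifferentiableAt ℂ (fun w => G w (γ t)) w := fun t ht w hw =>
    ((hd t ht).mono hRS).differentiableAt (isOpen_ball.mem_nhds hw)
  have hmeas : ∀ w ∈ ball w₀ R,
      AEStronglyMeasurable (fun t => G w (γ t) * deriv γ t) (volume.restrict (Ι 0 1)) :=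
    fun w hw => by
      simpa [uIoc_of_le zero_le_one] using
        (hγ.intervalIntegrable_mul (hc w (hRS hw))).aestronglyMeasurable
  have hball : ball w₀ (R / 2) ∈ 𝓝 w₀ := ball_mem_nhds _ (by positivity)
  have hsmall : ball w₀ (R / 2) ⊆ ball w₀ R := ball_subset_ball (by linarith)
  have key := intervalIntegral.hasDerivAt_integral_of_dominated_loc_of_deriv_le
    (μ := volume) (a := 0) (b := 1) (𝕜 := ℂ) (x₀ := w₀) (s := ball w₀ (R / 2))
    (F := fun w t => G w (γ t) * deriv γ t)
    (F' := fun w t => deriv (fun w => G w (γ t)) w * deriv γ t)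
    (bound := fun t => C / (R / 4) * ‖deriv γ t‖) hball
    (by filter_upwards [hball] with w hw using hmeas w (hsmall hw))
    (hγ.intervalIntegrable_mul (hc w₀ hw₀)) ?_ ?_ (hγ.integrable.norm.const_mul _) ?_
  · exact key.2.differentiableAt.differentiableWithinAt
  -- The derivative in the parameter is measurable in t as a pointwise limit of difference quotients
  -- along the steps (R/2)/(n+1), which stay inside the ball.
  · have hε : Tendsto (fun n : ℕ => ((R / 2 : ℝ) : ℂ) * (1 / ((n : ℂ) + 1))) atTop (𝓝[≠] 0) := by
      refine tendsto_nhdsWithin_iff.2 ⟨?_, Eventually.of_forall fun n => ?_⟩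
      · simpa using (tendsto_one_div_add_atTop_nhds_zero_nat (𝕜 := ℂ)).const_mul ((R / 2 : ℝ) : ℂ)
      · have h1 : ((n : ℂ) + 1) ≠ 0 := Nat.cast_add_one_ne_zero n
        have h2 : ((R / 2 : ℝ) : ℂ) ≠ 0 := by exact_mod_cast (by positivity : R / 2 ≠ 0)
        exact mul_ne_zero h2 (one_div_ne_zero h1)
    have hmem : ∀ n : ℕ, w₀ + ((R / 2 : ℝ) : ℂ) * (1 / ((n : ℂ) + 1)) ∈ ball w₀ R := by
      intro n
      rw [mem_ball, dist_eq_norm, add_sub_cancel_left, norm_mul, norm_div, norm_one,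
        Complex.norm_real, Real.norm_of_nonneg (by positivity)]
      have h1 : ‖((n : ℂ) + 1)‖ = (n : ℝ) + 1 := by
        rw [← Nat.cast_one, ← Nat.cast_add, Complex.norm_natCast]; push_cast; rfl
      rw [h1]
      have h2 : 1 / ((n : ℝ) + 1) ≤ 1 := by
        rw [div_le_one (by positivity)]; linarith [(Nat.cast_nonneg n : (0 : ℝ) ≤ n)]
      nlinarith
    refine aestronglyMeasurable_of_tendsto_ae (u := atTop)
      (f := fun (n : ℕ) t => ((((R / 2 : ℝ) : ℂ) * (1 / ((n : ℂ) + 1)))⁻¹) *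
        (G (w₀ + ((R / 2 : ℝ) : ℂ) * (1 / ((n : ℂ) + 1))) (γ t) * deriv γ t
          - G w₀ (γ t) * deriv γ t)) (fun n => ?_) ?_
    · exact ((hmeas _ (hmem n)).sub (hmeas _ (mem_ball_self hR))).const_mul _
    · refine (ae_restrict_iff' measurableSet_uIoc).2 (Eventually.of_forall fun t ht => ?_)
      have h1 := ((hda t (hsub t ht) w₀ (mem_ball_self hR)).hasDerivAt.tendsto_slope_zero).comp hε
      refine (h1.mul_const (deriv γ t)).congr fun n => ?_
      simp only [Function.comp, smul_eq_mul]
      ring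
  · refine Eventually.of_forall fun t ht w hw => ?_
    rw [norm_mul]
    refine mul_le_mul_of_nonneg_right ?_ (norm_nonneg _)
    have hcl : closedBall w (R / 4) ⊆ ball w₀ R := by
      intro v hv
      rw [mem_closedBall] at hv
      rw [mem_ball] at hw ⊢
      linarith [dist_triangle v w w₀]
    refine Complex.norm_deriv_le_of_forall_mem_sphere_norm_le (by positivity) ?_
      fun z hz => hC z (hcl (sphere_subset_closedBall hz)) t (hsub t ht)
    refine DifferentiableOn.diffContOnCl fun v hv => ?_
    exact (hda t (hsub t ht) v (hcl (closure_ball_subset_closedBall hv))).differentiableWithinAt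
  · refine Eventually.of_forall fun t ht w hw => ?_
    exact (hda t (hsub t ht) w (hsmall hw)).hasDerivAt.mul_const _

/-- The Cauchy transform along a contour is holomorphic off the contour. -/
theorem IsClosedContour.differentiableOn_cauchyTransform (hγ : IsClosedContour γ) {f : ℂ → ℂ}
    (hf : ContinuousOn f (γ '' Icc 0 1)) :
    DifferentiableOn ℂ (fun w => contourIntegral γ fun z => f z * (z - w)⁻¹)
      (γ '' Icc 0 1)ᶜ := by
  have hne : ∀ w ∈ (γ '' Icc (0 : ℝ) 1)ᶜ, ∀ t ∈ Icc (0 : ℝ) 1, γ t - w ≠ 0 :=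
    fun w hw t ht h => hw ⟨t, ht, sub_eq_zero.1 h⟩
  refine hγ.differentiableOn_contourIntegral (fun t ht w hw => ?_) (fun w hw => ?_)
    fun w₀ hw₀ => ?_
  · exact ((differentiableAt_const _).mul (((differentiableAt_const _).sub differentiableAt_id).inv
      (hne w hw t ht))).differentiableWithinAt
  · exact (hf.comp hγ.continuousOn (mapsTo_image _ _)).mul
      ((hγ.continuousOn.sub continuousOn_const).inv₀ (hne w hw))
  · obtain ⟨M, hM⟩ := hγ.isCompact_image.exists_bound_of_continuousOn hf
    obtain ⟨R, hR, hRS⟩ := Metric.isOpen_iff.1 hγ.isCompact_image.isClosed.isOpen_compl w₀ hw₀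
    refine ⟨R / 2, by positivity, M * (R / 2)⁻¹, (ball_subset_ball (by linarith)).trans hRS,
      fun w hw t ht => ?_⟩
    have hM0 := hM _ (mem_image_of_mem γ ht)
    rw [norm_mul, norm_inv]
    have h1 : R ≤ dist (γ t) w₀ := by
      by_contra! h
      exact hRS (mem_ball.2 h) (mem_image_of_mem γ ht)
    have h2 : R / 2 ≤ ‖γ t - w‖ := by
      rw [← dist_eq_norm]
      rw [mem_ball] at hw
      linarith [dist_triangle (γ t) w w₀]
    gcongr
    exact (norm_nonneg _).trans hM0

/-- The difference of the kernels at w and w₀ is the derivative of log((z - w)/(z - w₀)). The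
principal branch is legitimate: w is closer to w₀ than the contour is, so the quotient stays within
distance 1 of 1. -/
theorem IsClosedContour.eventually_windingNumber_eq (hγ : IsClosedContour γ) {w₀ : ℂ}
    (hw₀ : w₀ ∈ (γ '' Icc 0 1)ᶜ) : ∀ᶠ w in 𝓝 w₀, windingNumber γ w = windingNumber γ w₀ := by
  obtain ⟨R, hR, hRS⟩ := Metric.isOpen_iff.1 hγ.isCompact_image.isClosed.isOpen_compl w₀ hw₀
  filter_upwards [ball_mem_nhds w₀ hR] with w hw
  have hne : ∀ v ∈ ball w₀ R, ∀ z ∈ γ '' Icc (0 : ℝ) 1, z - v ≠ 0 := fun v hv z hz h =>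
    hRS hv (sub_eq_zero.1 h ▸ hz)
  have hcont : ∀ v ∈ ball w₀ R, ContinuousOn (fun z => (z - v)⁻¹) (γ '' Icc (0 : ℝ) 1) :=
    fun v hv => (continuousOn_id.sub continuousOn_const).inv₀ (hne v hv)
  have hw₀' := mem_ball_self (x := w₀) hR
  unfold windingNumber
  congr 1
  rw [← sub_eq_zero, ← hγ.contourIntegral_sub (hcont w hw) (hcont w₀ hw₀')]
  refine hγ.contourIntegral_deriv (f := fun z => Complex.log ((z - w) / (z - w₀))) (fun t ht => ?_)
    ((hcont w hw).sub (hcont w₀ hw₀'))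
  have h1 := hne w hw _ (mem_image_of_mem γ ht)
  have h2 := hne w₀ hw₀' _ (mem_image_of_mem γ ht)
  have hslit : (γ t - w) / (γ t - w₀) ∈ Complex.slitPlane := by
    have h3 : (γ t - w) / (γ t - w₀) = 1 + (w₀ - w) / (γ t - w₀) := by field_simp; ring
    rw [h3]
    refine Complex.mem_slitPlane_of_norm_lt_one ?_
    rw [norm_div, div_lt_one (norm_pos_iff.2 h2), ← dist_eq_norm, ← dist_eq_norm, dist_comm]
    refine lt_of_lt_of_le (mem_ball.1 hw) ?_
    by_contra! h
    exact hRS (mem_ball.2 h) (mem_image_of_mem γ ht)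
  convert! (((hasDerivAt_id (γ t)).sub_const w).div ((hasDerivAt_id (γ t)).sub_const w₀) h2).clog
    hslit using 1
  simp only [id, Pi.div_apply]
  field_simp

/-- Off the contour, the divided difference integrates to the Cauchy transform, corrected by the
winding number. -/
theorem IsClosedContour.contourIntegral_dslope (hγ : IsClosedContour γ) {f : ℂ → ℂ} {w : ℂ}
    (hf : ContinuousOn f (γ '' Icc 0 1)) (hw : w ∉ γ '' Icc 0 1) :
    contourIntegral γ (fun z => dslope f z w)
      = contourIntegral γ (fun z => f z * (z - w)⁻¹)
        - f w * (2 * (Real.pi : ℂ) * Complex.I * windingNumber γ w) := by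
  have hne : ∀ z ∈ γ '' Icc (0 : ℝ) 1, z - w ≠ 0 := fun z hz h => hw (sub_eq_zero.1 h ▸ hz)
  have hc : ContinuousOn (fun z => (z - w)⁻¹) (γ '' Icc (0 : ℝ) 1) :=
    (continuousOn_id.sub continuousOn_const).inv₀ hne
  have h1 : 2 * (Real.pi : ℂ) * Complex.I * windingNumber γ w
      = contourIntegral γ fun z => (z - w)⁻¹ := by
    unfold windingNumber
    rw [mul_inv_cancel_left₀ Complex.two_pi_I_ne_zero]
  have h3 := hγ.contourIntegral_sub (f := fun z => f z * (z - w)⁻¹)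
    (g := fun z => f w * (z - w)⁻¹) (hf.mul hc) (continuousOn_const.mul hc)
  rw [h1, ← contourIntegral_const_mul, ← h3]
  refine contourIntegral_congr fun t ht => ?_
  have h2 := hne _ (mem_image_of_mem γ ht)
  rw [dslope_of_ne _ (fun h => h2 (by rw [h, sub_self])), slope_comm, slope_def_field]
  field_simp

theorem dslope_comm (f : ℂ → ℂ) (z w : ℂ) : dslope f z w = dslope f w z := by
  rcases eq_or_ne z w with rfl | h
  · rfl
  · rw [dslope_of_ne _ h.symm, dslope_of_ne _ h, slope_comm]

/-- The point is a bound uniform near w₀, also when the contour passes close by. If γ t is at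
distance at least 3R/2 from w₀, the quotient is estimated directly; otherwise the maximum principle
moves the estimate to the circle of radius 2R, which is at distance at least R/2 from γ t. -/
theorem IsClosedContour.differentiableOn_contourIntegral_dslope (hγ : IsClosedContour γ)
    {f : ℂ → ℂ} {U : Set ℂ} (hU : IsOpen U) (hf : DifferentiableOn ℂ f U)
    (hγU : ∀ t ∈ Icc (0 : ℝ) 1, γ t ∈ U) :
    DifferentiableOn ℂ (fun w => contourIntegral γ fun z => dslope f z w) U := by
  have hd : ∀ z ∈ U, DifferentiableOn ℂ (dslope f z) U := fun z hz =>
    (Complex.differentiableOn_dslope (hU.mem_nhds hz)).2 hf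
  refine hγ.differentiableOn_contourIntegral (G := fun w z => dslope f z w)
    (fun t ht => hd _ (hγU t ht)) (fun w hw => ?_) fun w₀ hw₀ => ?_
  · simp only [dslope_comm f _ w]
    exact (hd w hw).continuousOn.comp hγ.continuousOn hγU
  · obtain ⟨R', hR', hRU⟩ := Metric.isOpen_iff.1 hU w₀ hw₀
    obtain ⟨R, hR, rfl⟩ : ∃ R > 0, R' = 3 * R := ⟨R' / 3, by positivity, by ring⟩
    have hRU2 : closedBall w₀ (2 * R) ⊆ U := (closedBall_subset_ball (by linarith)).trans hRU
    obtain ⟨M, hM⟩ := ((isCompact_closedBall w₀ (2 * R)).union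
      hγ.isCompact_image).exists_bound_of_continuousOn (f := f)
      (hf.continuousOn.mono (union_subset hRU2 (image_subset_iff.2 hγU)))
    have hfar : ∀ t ∈ Icc (0 : ℝ) 1, ∀ w ∈ closedBall w₀ (2 * R), R / 2 ≤ dist w (γ t) →
        ‖dslope f (γ t) w‖ ≤ (M + M) / (R / 2) := by
      intro t ht w hw hdist
      have hne : w ≠ γ t := by
        rintro rfl
        rw [dist_self] at hdist
        linarith
      have h1 := hM w (Or.inl hw)
      have h2 := hM (γ t) (Or.inr (mem_image_of_mem γ ht))
      rw [dslope_of_ne _ hne, slope_def_field, norm_div, ← dist_eq_norm w]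
      have h3 := (norm_sub_le (f w) (f (γ t))).trans (add_le_add h1 h2)
      have h4 := (norm_nonneg _).trans h3
      gcongr
    refine ⟨R, hR, (M + M) / (R / 2), (ball_subset_ball (by linarith)).trans hRU,
      fun w hw t ht => ?_⟩
    have hw2 : w ∈ ball w₀ (2 * R) := ball_subset_ball (by linarith) hw
    rcases le_or_gt (3 * R / 2) (dist w₀ (γ t)) with h | h
    · refine hfar t ht w (ball_subset_closedBall hw2) ?_
      rw [mem_ball, dist_comm] at hw
      linarith [dist_triangle w₀ w (γ t)]
    · refine Complex.norm_le_of_forall_mem_frontier_norm_le (U := ball w₀ (2 * R)) isBounded_ball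
        (((hd _ (hγU t ht)).mono (closure_ball_subset_closedBall.trans hRU2)).diffContOnCl)
        (fun z hz => ?_) (subset_closure hw2)
      rw [frontier_ball _ (by positivity)] at hz
      refine hfar t ht z (sphere_subset_closedBall hz) ?_
      rw [mem_sphere] at hz
      linarith [dist_triangle z (γ t) w₀, dist_comm w₀ (γ t)]

theorem IsClosedContour.tendsto_cauchyTransform (hγ : IsClosedContour γ) {f : ℂ → ℂ}
    (hf : ContinuousOn f (γ '' Icc 0 1)) :
    Tendsto (fun w => contourIntegral γ fun z => f z * (z - w)⁻¹) (cocompact ℂ) (𝓝 0) := by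
  obtain ⟨B, hB, hle⟩ := hγ.exists_norm_contourIntegral_le
  obtain ⟨M, hM⟩ := hγ.isCompact_image.exists_bound_of_continuousOn hf
  obtain ⟨K, hK⟩ := hγ.isCompact_image.exists_bound_of_continuousOn continuousOn_id
  have hM0 : 0 ≤ M := (norm_nonneg _).trans (hM _ (mem_image_of_mem γ (left_mem_Icc.2 zero_le_one)))
  have hlim : Tendsto (fun w : ℂ => M * (‖w‖ - K)⁻¹ * B) (cocompact ℂ) (𝓝 0) := by
    have h1 : Tendsto (fun w : ℂ => (‖w‖ - K)⁻¹) (cocompact ℂ) (𝓝 0) :=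
      (tendsto_atTop_add_const_right _ (-K) tendsto_norm_cocompact_atTop).inv_tendsto_atTop
    simpa using (h1.const_mul M).mul_const B
  refine squeeze_zero_norm' ?_ hlim
  filter_upwards [tendsto_norm_cocompact_atTop.eventually_gt_atTop K] with w hw
  refine hle _ _ fun t ht => ?_
  rw [norm_mul, norm_inv]
  have h1 := hM _ (mem_image_of_mem γ ht)
  have h2 : ‖w‖ - K ≤ ‖γ t - w‖ := by
    have := hK _ (mem_image_of_mem γ ht)
    rw [norm_sub_rev]
    exact (sub_le_sub_left this _).trans (norm_sub_norm_le _ _)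
  have h3 : 0 < ‖w‖ - K := sub_pos.2 hw
  gcongr

/-- For |w| larger than the contour, log(1 - z/w) is a primitive of the kernel. -/
theorem IsClosedContour.eventually_windingNumber_eq_zero (hγ : IsClosedContour γ) :
    ∀ᶠ w in cocompact ℂ, windingNumber γ w = 0 := by
  obtain ⟨K, hK⟩ := hγ.isCompact_image.exists_bound_of_continuousOn continuousOn_id
  filter_upwards [tendsto_norm_cocompact_atTop.eventually_gt_atTop K,
    tendsto_norm_cocompact_atTop.eventually_gt_atTop 0] with w hw hw0
  have hlt : ∀ t ∈ Icc (0 : ℝ) 1, ‖γ t‖ < ‖w‖ := fun t ht =>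
    (hK _ (mem_image_of_mem γ ht)).trans_lt hw
  have hne : ∀ t ∈ Icc (0 : ℝ) 1, γ t - w ≠ 0 := fun t ht h => by
    have := hlt t ht
    rw [sub_eq_zero.1 h] at this
    exact this.false
  have hw0' : w ≠ 0 := norm_pos_iff.1 hw0
  unfold windingNumber
  refine mul_eq_zero_of_right _ (hγ.contourIntegral_deriv
    (f := fun z => Complex.log (1 + -z / w)) (fun t ht => ?_) ?_)
  · have hslit : 1 + -γ t / w ∈ Complex.slitPlane := by
      refine Complex.mem_slitPlane_of_norm_lt_one ?_
      rw [norm_div, norm_neg, div_lt_one hw0]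
      exact hlt t ht
    convert! (((hasDerivAt_id (γ t)).neg.div_const w).const_add 1).clog hslit using 1
    have h1 := hne t ht
    have h2 : w - γ t ≠ 0 := fun h => h1 (by rw [sub_eq_zero.1 h, sub_self])
    simp only [id, Pi.neg_apply]
    have h3 : 1 + -γ t / w = (w - γ t) / w := by field_simp; ring
    rw [h3]
    field_simp
    ring
  · refine (continuousOn_id.sub continuousOn_const).inv₀ ?_
    rintro _ ⟨t, ht, rfl⟩
    exact hne t ht

/-- Cauchy's theorem, homology version: the integrals of a holomorphic function along two closed
contours with the same winding number about every point of the complement agree. -/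
theorem IsClosedContour.contourIntegral_eq {γ₁ γ₂ : ℝ → ℂ} (h₁ : IsClosedContour γ₁)
    (h₂ : IsClosedContour γ₂) {U : Set ℂ} (hU : IsOpen U) {f : ℂ → ℂ}
    (hf : DifferentiableOn ℂ f U) (h₁U : ∀ t ∈ Icc (0 : ℝ) 1, γ₁ t ∈ U)
    (h₂U : ∀ t ∈ Icc (0 : ℝ) 1, γ₂ t ∈ U)
    (hw : ∀ w ∉ U, windingNumber γ₁ w = windingNumber γ₂ w) :
    contourIntegral γ₁ f = contourIntegral γ₂ f := by
  classical
  set p : ℂ := γ₁ 0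
  have hp : p ∈ U := h₁U 0 (left_mem_Icc.2 zero_le_one)
  -- The factor z - p makes `dslope g z p` equal to f z, so the difference of the two integrals of f
  -- is the value at p of the function `D` below.
  set g : ℂ → ℂ := fun z => (z - p) * f z
  have hg : DifferentiableOn ℂ g U := (differentiableOn_id.sub_const p).mul hf
  have hi₁ : γ₁ '' Icc 0 1 ⊆ U := image_subset_iff.2 h₁U
  have hi₂ : γ₂ '' Icc 0 1 ⊆ U := image_subset_iff.2 h₂U
  have hg₁ := hg.continuousOn.mono hi₁
  have hg₂ := hg.continuousOn.mono hi₂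
  -- U and V cover the plane. On V the winding number corrections cancel, so `D` is there a
  -- difference of Cauchy transforms; thus `D` is entire and tends to 0 at infinity, and Liouville
  -- gives D p = 0.
  set V : Set ℂ := {w | w ∉ γ₁ '' Icc 0 1 ∧ w ∉ γ₂ '' Icc 0 1 ∧
    windingNumber γ₁ w = windingNumber γ₂ w}
  have hV : IsOpen V := by
    refine isOpen_iff_mem_nhds.2 fun w ⟨hw1, hw2, hw3⟩ => ?_
    filter_upwards [h₁.isCompact_image.isClosed.isOpen_compl.mem_nhds hw1,
      h₂.isCompact_image.isClosed.isOpen_compl.mem_nhds hw2, h₁.eventually_windingNumber_eq hw1,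
      h₂.eventually_windingNumber_eq hw2] with v hv1 hv2 hv3 hv4
    exact ⟨hv1, hv2, by rw [hv3, hv4, hw3]⟩
  set D : ℂ → ℂ := fun w => contourIntegral γ₁ (fun z => dslope g z w)
    - contourIntegral γ₂ (fun z => dslope g z w)
  set T : ℂ → ℂ := fun w => contourIntegral γ₁ (fun z => g z * (z - w)⁻¹)
    - contourIntegral γ₂ (fun z => g z * (z - w)⁻¹)
  have hDT : ∀ w ∈ V, D w = T w := by
    rintro w ⟨hw1, hw2, hw3⟩
    simp only [D, T, h₁.contourIntegral_dslope hg₁ hw1, h₂.contourIntegral_dslope hg₂ hw2, hw3]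
    ring
  have hD : DifferentiableOn ℂ D U :=
    (h₁.differentiableOn_contourIntegral_dslope hU hg h₁U).sub
      (h₂.differentiableOn_contourIntegral_dslope hU hg h₂U)
  have hT : DifferentiableOn ℂ T V :=
    ((h₁.differentiableOn_cauchyTransform hg₁).mono fun w hw => hw.1).sub
      ((h₂.differentiableOn_cauchyTransform hg₂).mono fun w hw => hw.2.1)
  have hUV : ∀ w, w ∉ U → w ∈ V := fun w h => ⟨fun h' => h (hi₁ h'), fun h' => h (hi₂ h'), hw w h⟩
  have hDdiff : Differentiable ℂ D := by
    intro w
    by_cases h : w ∈ U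
    · exact hD.differentiableAt (hU.mem_nhds h)
    · have hwV := hV.mem_nhds (hUV w h)
      exact (hT.differentiableAt hwV).congr_of_eventuallyEq (eventually_of_mem hwV hDT)
  have hTlim : Tendsto T (cocompact ℂ) (𝓝 0) := by
    simpa using (h₁.tendsto_cauchyTransform hg₁).sub (h₂.tendsto_cauchyTransform hg₂)
  have hD0 : D p = 0 := by
    refine hDdiff.apply_eq_of_tendsto_cocompact p (hTlim.congr' ?_)
    filter_upwards [h₁.eventually_windingNumber_eq_zero, h₂.eventually_windingNumber_eq_zero,
      h₁.isCompact_image.compl_mem_cocompact, h₂.isCompact_image.compl_mem_cocompact]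
      with w hw1 hw2 hw3 hw4
    exact (hDT w ⟨hw3, hw4, by rw [hw1, hw2]⟩).symm
  have hslope : ∀ z ∈ U, dslope g z p = f z := by
    intro z hz
    rw [dslope_comm]
    rcases eq_or_ne z p with h | hzp
    · rw [h, dslope_same]
      have h := ((hasDerivAt_id p).sub_const p).mul (hf.differentiableAt (hU.mem_nhds hp)).hasDerivAt
      have h' : HasDerivAt g (f p) p := by simpa using! h
      exact h'.deriv
    · rw [dslope_of_ne _ hzp, slope_def_field]
      have : z - p ≠ 0 := sub_ne_zero.2 hzp
      simp only [g, sub_self, zero_mul, sub_zero]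
      field_simp
  rw [← sub_eq_zero, ← hD0]
  simp only [D]
  rw [contourIntegral_congr (γ := γ₁) (f := fun z => dslope g z p) (g := f)
      fun t ht => hslope _ (h₁U t ht),
    contourIntegral_congr (γ := γ₂) (f := fun z => dslope g z p) (g := f)
      fun t ht => hslope _ (h₂U t ht)]

end Contour

end AskeyWilson

end

noncomputable section

namespace AskeyWilson

/-! ### Finite q-Pochhammer symbols. -/

section QPochhammer

theorem qPoch_zero (q x : ℂ) : qPoch q x 0 = 1 := by simp [qPoch]

theorem qPoch_succ (q x : ℂ) (n : ℕ) : qPoch q x (n + 1) = qPoch q x n * (1 - x * q ^ n) :=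
  Finset.prod_range_succ _ _

theorem qPoch_add (q x : ℂ) (m n : ℕ) :
    qPoch q x (m + n) = qPoch q x m * qPoch q (x * q ^ m) n := by
  unfold qPoch
  rw [Finset.prod_range_add]
  simp only [pow_add, mul_assoc]

theorem qPoch_succ' (q x : ℂ) (n : ℕ) : qPoch q x (n + 1) = (1 - x) * qPoch q (x * q) n := by
  rw [add_comm, qPoch_add, pow_one]
  simp [qPoch]

theorem qPoch_ne_zero {q x : ℂ} {n : ℕ} (h : ∀ k < n, x * q ^ k ≠ 1) : qPoch q x n ≠ 0 :=
  Finset.prod_ne_zero_iff.2 fun k hk => sub_ne_zero.2 (h k (Finset.mem_range.1 hk)).symm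

theorem qPoch_eq_zero {q x : ℂ} {n k : ℕ} (hk : k < n) (h : x * q ^ k = 1) : qPoch q x n = 0 :=
  Finset.prod_eq_zero (Finset.mem_range.2 hk) (by rw [h, sub_self])

theorem pow_ne_one_of_norm_lt_one {q : ℂ} (hq1 : ‖q‖ < 1) {n : ℕ} (hn : n ≠ 0) : q ^ n ≠ 1 := by
  intro h
  have h1 := pow_lt_one₀ (norm_nonneg q) hq1 hn
  rw [← norm_pow, h, norm_one] at h1
  exact h1.false

theorem qPoch_self_ne_zero {q : ℂ} (hq1 : ‖q‖ < 1) (n : ℕ) : qPoch q q n ≠ 0 :=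
  qPoch_ne_zero fun k _ h => pow_ne_one_of_norm_lt_one hq1 k.succ_ne_zero (by rw [pow_succ', h])

theorem zpow_neg_mul_pow {q : ℂ} (hq0 : q ≠ 0) (m : ℤ) (k : ℕ) : q ^ m * q ^ k = q ^ (m + k) := by
  rw [zpow_add₀ hq0, zpow_natCast]

/-- `∏_{k<n} (1 - x q^k y)` as a polynomial in `y`. -/
def qPochPoly (q x : ℂ) (n : ℕ) : ℂ[X] := ∏ k ∈ Finset.range n, (1 - C (x * q ^ k) * X)

theorem eval_qPochPoly (q x y : ℂ) (n : ℕ) : (qPochPoly q x n).eval y = qPoch q (x * y) n := by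
  unfold qPochPoly qPoch
  rw [eval_prod]
  refine Finset.prod_congr rfl fun k _ => ?_
  simp
  ring

theorem natDegree_qPochPoly_le (q x : ℂ) (n : ℕ) : (qPochPoly q x n).natDegree ≤ n := by
  refine (natDegree_prod_le _ _).trans ?_
  have h : ∀ k ∈ Finset.range n, (1 - C (x * q ^ k) * X : ℂ[X]).natDegree ≤ 1 := fun k _ => by
    compute_degree
  simpa using Finset.sum_le_sum h

end QPochhammer

/-! ### Testing a linear functional on a basis with one element in each degree. -/

section Functionals

theorem map_eq_zero_of_degree_lt {T : ℂ[X] →ₗ[ℂ] ℂ} {u : ℕ → ℂ[X]} (hu : ∀ j, (u j).degree = j)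
    {n : ℕ} (h : ∀ j < n, T (u j) = 0) {f : ℂ[X]} (hf : f.degree < n) : T f = 0 := by
  induction n generalizing f with
  | zero =>
    have : f = 0 := by simpa using hf
    rw [this, map_zero]
  | succ n ih =>
    have hun : (u n).coeff n ≠ 0 := by
      have := leadingCoeff_ne_zero.2 (show u n ≠ 0 from fun h0 => by simpa [h0] using hu n)
      rwa [leadingCoeff, natDegree_eq_of_degree_eq_some (hu n)] at this
    have hle : f.degree ≤ n := by
      rw [degree_le_iff_coeff_zero]
      intro m hm
      exact (degree_lt_iff_coeff_zero _ _).1 hf m (by exact_mod_cast hm)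
    have hg : (f - (f.coeff n / (u n).coeff n) • u n).degree < n := by
      rw [degree_lt_iff_coeff_zero]
      intro m hm
      rcases hm.eq_or_lt with rfl | hm
      · simp [hun]
      · have h1 : f.coeff m = 0 := coeff_eq_zero_of_degree_lt (hle.trans_lt (by exact_mod_cast hm))
        have h2 : (u n).coeff m = 0 :=
          coeff_eq_zero_of_degree_lt (by rw [hu n]; exact_mod_cast hm)
        simp [h1, h2]
    have := ih (fun j hj => h j (hj.trans n.lt_succ_self)) hg
    rw [map_sub, map_smul, h n n.lt_succ_self, smul_zero, sub_zero] at this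
    exact this

end Functionals

/-! ### Terminating q-binomial sums. -/

section QBinomial

variable {q : ℂ}

/-- The coefficients `(q^{-n};q)_k / (q;q)_k`. -/
def qBinCoeff (q : ℂ) (n k : ℕ) : ℂ := qPoch q (q ^ (-(n : ℤ))) k / qPoch q q k

theorem qBinCoeff_succ (hq0 : q ≠ 0) (hq1 : ‖q‖ < 1) (n k : ℕ) :
    qBinCoeff q n (k + 1) * (1 - q ^ (k + 1)) = qBinCoeff q n k * (1 - q ^ ((k : ℤ) - n)) := by
  have h1 := qPoch_self_ne_zero hq1 k
  have h2 : 1 - q ^ (k + 1) ≠ 0 := sub_ne_zero.2 (pow_ne_one_of_norm_lt_one hq1 k.succ_ne_zero).symm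
  unfold qBinCoeff
  rw [qPoch_succ, qPoch_succ, zpow_neg_mul_pow hq0, ← pow_succ', neg_add_eq_sub]
  field_simp

/-- The q-difference equation of S(y) = ∑ (q^{-n};q)_k/(q;q)_k y^k. It locates the zeros of S
without the product formula of the q-binomial theorem. -/
theorem sum_qBinCoeff_recurrence (hq0 : q ≠ 0) (hq1 : ‖q‖ < 1) (n : ℕ) (y : ℂ) :
    (1 - y) * ∑ k ∈ Finset.range (n + 1), qBinCoeff q n k * y ^ k
      = (1 - y * q ^ (-(n : ℤ))) * ∑ k ∈ Finset.range (n + 1), qBinCoeff q n k * (y * q) ^ k := by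
  have h : ∑ k ∈ Finset.range (n + 1), qBinCoeff q n k * (1 - q ^ k) * y ^ k
      = ∑ k ∈ Finset.range (n + 1), qBinCoeff q n k * (1 - q ^ ((k : ℤ) - n)) * y ^ (k + 1) := by
    rw [Finset.sum_range_succ', Finset.sum_range_succ _ n]
    simp only [pow_zero, sub_self, mul_zero, zero_mul, add_zero, zpow_zero]
    exact Finset.sum_congr rfl fun k _ => by rw [qBinCoeff_succ hq0 hq1]
  have h1 : ∀ k : ℕ, qBinCoeff q n k * (1 - q ^ ((k : ℤ) - n)) * y ^ (k + 1)
      = y * (qBinCoeff q n k * y ^ k) - y * q ^ (-(n : ℤ)) * (qBinCoeff q n k * (y * q) ^ k) := by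
    intro k
    rw [sub_eq_add_neg (k : ℤ), zpow_add₀ hq0, zpow_natCast, mul_pow]
    ring
  have h2 : ∀ k : ℕ, qBinCoeff q n k * (1 - q ^ k) * y ^ k
      = qBinCoeff q n k * y ^ k - qBinCoeff q n k * (y * q) ^ k := by
    intro k
    rw [mul_pow]
    ring
  simp only [h1, h2, Finset.sum_sub_distrib, ← Finset.mul_sum] at h
  linear_combination h

/-- The sum is S(q^{j+1}) for the S of `sum_qBinCoeff_recurrence`. At y = q^n the right side of the
equation vanishes, which gives the zero q^n; each zero q^{j+2} then forces the zero q^{j+1}. -/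
theorem sum_qBinCoeff_pow_eq_zero (hq0 : q ≠ 0) (hq1 : ‖q‖ < 1) (n j : ℕ) (hj : j < n) :
    ∑ k ∈ Finset.range (n + 1), qBinCoeff q n k * q ^ k * (q ^ k) ^ j = 0 := by
  obtain ⟨i, rfl⟩ := Nat.exists_eq_add_of_lt hj
  induction i generalizing j with
  | zero =>
    have h := sum_qBinCoeff_recurrence hq0 hq1 (j + 0 + 1) (q ^ (j + 1))
    rw [zpow_neg, zpow_natCast, add_zero, mul_inv_cancel₀ (pow_ne_zero _ hq0), sub_self, zero_mul]
      at h
    have h1 := (mul_eq_zero.1 h).resolve_left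
      (sub_ne_zero.2 (pow_ne_one_of_norm_lt_one hq1 j.succ_ne_zero).symm)
    rw [← h1]
    exact Finset.sum_congr rfl fun k _ => by ring
  | succ i ih =>
    have h := sum_qBinCoeff_recurrence hq0 hq1 (j + (i + 1) + 1) (q ^ (j + 1))
    have h0 := ih (j + 1) (by lia)
    rw [show j + 1 + i + 1 = j + (i + 1) + 1 by ring] at h0
    have h2 : ∑ k ∈ Finset.range (j + (i + 1) + 1 + 1),
        qBinCoeff q (j + (i + 1) + 1) k * (q ^ (j + 1) * q) ^ k = 0 := by
      rw [← h0]
      exact Finset.sum_congr rfl fun k _ => by ring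
    rw [h2, mul_zero] at h
    have h1 := (mul_eq_zero.1 h).resolve_left
      (sub_ne_zero.2 (pow_ne_one_of_norm_lt_one hq1 j.succ_ne_zero).symm)
    rw [← h1]
    exact Finset.sum_congr rfl fun k _ => by ring

theorem sum_qBinCoeff_eval_eq_zero (hq0 : q ≠ 0) (hq1 : ‖q‖ < 1) (n : ℕ) {R : ℂ[X]}
    (hR : R.degree < n) :
    ∑ k ∈ Finset.range (n + 1), qBinCoeff q n k * q ^ k * R.eval (q ^ k) = 0 := by
  have := map_eq_zero_of_degree_lt
    (T := ∑ k ∈ Finset.range (n + 1), (qBinCoeff q n k * q ^ k) • Polynomial.leval (q ^ k))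
    (u := fun j => X ^ j) (fun j => degree_X_pow j) (n := n) (fun j hj => ?_) hR
  · simpa [LinearMap.sum_apply] using this
  · simpa [LinearMap.sum_apply] using sum_qBinCoeff_pow_eq_zero hq0 hq1 n j hj

/-- Division by X - s⁻¹ leaves the remainder R(s⁻¹) and a quotient of degree below n, and the sum
annihilates the latter. -/
theorem sum_qBinCoeff_eval_div (hq0 : q ≠ 0) (hq1 : ‖q‖ < 1) (n : ℕ) {s : ℂ} (hs0 : s ≠ 0)
    (hs : ∀ k ≤ n, s * q ^ k ≠ 1) {R : ℂ[X]} (hR : R.natDegree ≤ n) :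
    ∑ k ∈ Finset.range (n + 1), qBinCoeff q n k * q ^ k * (R.eval (q ^ k) / (1 - s * q ^ k))
      = R.eval s⁻¹ * ∑ k ∈ Finset.range (n + 1), qBinCoeff q n k * q ^ k / (1 - s * q ^ k) := by
  rcases n.eq_zero_or_pos with rfl | hn
  · rw [eq_C_of_natDegree_le_zero hR]
    simp [div_eq_mul_inv, mul_comm, mul_assoc, mul_left_comm]
  have hdiv := X_sub_C_mul_divByMonic_eq_sub_modByMonic R s⁻¹
  rw [modByMonic_X_sub_C_eq_C_eval] at hdiv
  set Q := R /ₘ (X - C s⁻¹)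
  have hQ : Q.degree < n := by
    by_cases hQ0 : Q = 0
    · simp [hQ0]
    · rw [← natDegree_lt_iff_degree_lt hQ0, natDegree_divByMonic _ (monic_X_sub_C _),
        natDegree_X_sub_C]
      lia
  have h0 := sum_qBinCoeff_eval_eq_zero hq0 hq1 n hQ
  rw [Finset.mul_sum, ← sub_eq_zero, ← Finset.sum_sub_distrib]
  rw [show (0 : ℂ) = -s⁻¹ * 0 by ring, ← h0, Finset.mul_sum]
  refine Finset.sum_congr rfl fun k hk => ?_
  have h1 : 1 - s * q ^ k ≠ 0 := sub_ne_zero.2 (hs k (by simpa [Nat.lt_succ_iff] using hk)).symm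
  have h2 := congrArg (eval (q ^ k)) hdiv
  simp only [eval_mul, eval_sub, eval_X, eval_C] at h2
  have h3 : R.eval (q ^ k) = (q ^ k - s⁻¹) * Q.eval (q ^ k) + R.eval s⁻¹ := by
    linear_combination -h2
  have h4 : q ^ k - s⁻¹ = -s⁻¹ * (1 - s * q ^ k) := by field_simp; ring
  rw [h3, h4]
  generalize 1 - s * q ^ k = v at h1 ⊢
  field_simp
  ring

/-- Apply `sum_qBinCoeff_eval_div` to the polynomial with roots q, …, q^n: only the term k = 0
survives, and it is not zero. -/
theorem sum_qBinCoeff_div_ne_zero (hq0 : q ≠ 0) (hq1 : ‖q‖ < 1) (n : ℕ) {s : ℂ} (hs0 : s ≠ 0)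
    (hs : ∀ k ≤ n, s * q ^ k ≠ 1) :
    ∑ k ∈ Finset.range (n + 1), qBinCoeff q n k * q ^ k / (1 - s * q ^ k) ≠ 0 := by
  intro h0
  set V : ℂ[X] := ∏ i ∈ Finset.range n, (X - C (q ^ (i + 1))) with hV
  have hdeg : V.natDegree ≤ n := by
    rw [hV, natDegree_finsetProd_X_sub_C_eq_card]
    simp
  have h := sum_qBinCoeff_eval_div hq0 hq1 n hs0 hs hdeg
  rw [h0, mul_zero, Finset.sum_range_succ'] at h
  have hz : ∀ k ∈ Finset.range n, qBinCoeff q n (k + 1) * q ^ (k + 1) *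
      (V.eval (q ^ (k + 1)) / (1 - s * q ^ (k + 1))) = 0 := by
    intro k hk
    have : V.eval (q ^ (k + 1)) = 0 := by
      rw [hV, eval_prod]
      exact Finset.prod_eq_zero hk (by simp)
    rw [this, zero_div, mul_zero]
  rw [Finset.sum_eq_zero hz, zero_add] at h
  have h1 : V.eval (q ^ 0) ≠ 0 := by
    rw [hV, eval_prod]
    refine Finset.prod_ne_zero_iff.2 fun i _ => ?_
    simpa using sub_ne_zero.2 (pow_ne_one_of_norm_lt_one hq1 i.succ_ne_zero).symm
  have h2 : 1 - s * q ^ 0 ≠ 0 := sub_ne_zero.2 (hs 0 n.zero_le).symm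
  have h3 : qBinCoeff q n 0 = 1 := by simp [qBinCoeff, qPoch]
  rw [h3] at h
  simp_all

end QBinomial

end AskeyWilson

end

noncomputable section

namespace AskeyWilson

/-! ### The basis φ_k and the leading term of the Askey–Wilson polynomials. -/

section Basis

/-- The basis `∏_{i<k} (1 - 2 a q^i x + a² q^{2i})`. -/
def awBasis (q a : ℂ) (k : ℕ) : ℂ[X] :=
  ∏ i ∈ Finset.range k, (1 - C (2 * a * q ^ i) * X + C (a ^ 2 * q ^ (2 * i)))

variable {q : ℂ}

theorem awBasis_zero (q a : ℂ) : awBasis q a 0 = 1 := by simp [awBasis]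

theorem awBasis_succ (q a : ℂ) (k : ℕ) : awBasis q a (k + 1)
    = awBasis q a k * (1 - C (2 * a * q ^ k) * X + C (a ^ 2 * q ^ (2 * k))) :=
  Finset.prod_range_succ _ _

theorem eval_awBasis_lat (q a : ℂ) (k : ℕ) {z : ℂ} (hz : z ≠ 0) :
    (awBasis q a k).eval (lat z) = qPoch q (a * z) k * qPoch q (a * z⁻¹) k := by
  unfold awBasis qPoch lat
  rw [eval_prod, ← Finset.prod_mul_distrib]
  refine Finset.prod_congr rfl fun i _ => ?_
  simp only [eval_add, eval_sub, eval_mul, eval_C, eval_X, eval_one]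
  field_simp
  ring

theorem leadingCoeff_awBasis_factor {b : ℂ} (hb : b ≠ 0) (c : ℂ) :
    (1 - C (2 * b) * X + C c : ℂ[X]).leadingCoeff = -(2 * b) := by
  have h : (1 - C (2 * b) * X + C c : ℂ[X]) = C (-(2 * b)) * X + C (1 + c) := by
    simp only [C_neg, C_add, C_1]
    ring
  rw [h, leadingCoeff_linear (by simpa using hb)]

theorem leadingCoeff_awBasis (hq0 : q ≠ 0) {a : ℂ} (ha : a ≠ 0) (k : ℕ) :
    (awBasis q a k).leadingCoeff = ∏ i ∈ Finset.range k, (-(2 * (a * q ^ i))) := by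
  unfold awBasis
  rw [leadingCoeff_prod]
  refine Finset.prod_congr rfl fun i _ => ?_
  rw [mul_assoc, leadingCoeff_awBasis_factor (mul_ne_zero ha (pow_ne_zero _ hq0))]

theorem degree_awBasis (hq0 : q ≠ 0) {a : ℂ} (ha : a ≠ 0) (k : ℕ) :
    (awBasis q a k).degree = k := by
  unfold awBasis
  rw [degree_prod]
  have h : ∀ i ∈ Finset.range k,
      (1 - C (2 * a * q ^ i) * X + C (a ^ 2 * q ^ (2 * i)) : ℂ[X]).degree = 1 := by
    intro i _
    have h : (1 - C (2 * a * q ^ i) * X + C (a ^ 2 * q ^ (2 * i)) : ℂ[X])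
        = C (-(2 * a * q ^ i)) * X + C (1 + a ^ 2 * q ^ (2 * i)) := by
      simp only [C_neg, C_add, C_1]
      ring
    rw [h, degree_linear]
    exact neg_ne_zero.2 (mul_ne_zero (mul_ne_zero two_ne_zero ha) (pow_ne_zero _ hq0))
  rw [Finset.sum_congr rfl h]
  simp

/-- The coefficient of `awBasis q a k` in `monicPoly q a b c d n`, up to normalization. -/
def monicPolyCoeff (q a b c d : ℂ) (n k : ℕ) : ℂ :=
  qPoch q (q ^ (-(n : ℤ))) k * qPoch q (a * b * c * d * q ^ ((n : ℤ) - 1)) k / qPoch q q k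
    * q ^ k * qPoch q (a * b * q ^ k) (n - k) * qPoch q (a * c * q ^ k) (n - k)
    * qPoch q (a * d * q ^ k) (n - k)

theorem monicPoly_eq (q a b c d : ℂ) (n : ℕ) : monicPoly q a b c d n =
    C ((2 * a) ^ n * qPoch q (a * b * c * d * q ^ ((n : ℤ) - 1)) n)⁻¹ *
      ∑ k ∈ Finset.range (n + 1), C (monicPolyCoeff q a b c d n k) * awBasis q a k := rfl

theorem qPoch_neg_pow_self (hq0 : q ≠ 0) (n : ℕ) :
    qPoch q (q ^ (-(n : ℤ))) n * q ^ n * ∏ i ∈ Finset.range n, (-(q ^ i)) = qPoch q q n := by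
  have h1 : qPoch q (q ^ (-(n : ℤ))) n = ∏ i ∈ Finset.range n, (1 - (q ^ (i + 1))⁻¹) := by
    unfold qPoch
    rw [← Finset.prod_range_reflect]
    refine Finset.prod_congr rfl fun i hi => ?_
    have := Finset.mem_range.1 hi
    rw [zpow_neg_mul_pow hq0, ← zpow_natCast, ← zpow_neg]
    congr 2
    lia
  have h2 : q ^ n = ∏ _i ∈ Finset.range n, q := by simp
  rw [h1, h2, ← Finset.prod_mul_distrib, ← Finset.prod_mul_distrib]
  refine Finset.prod_congr rfl fun i _ => ?_
  field_simp
  ring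

theorem qPoch_abcd_ne_zero (hq0 : q ≠ 0) {e : ℂ} (he : ∀ k : ℕ, e * q ^ k ≠ 1) (n : ℕ) :
    qPoch q (e * q ^ ((n : ℤ) - 1)) n ≠ 0 := by
  refine qPoch_ne_zero fun k hk => ?_
  obtain ⟨m, rfl⟩ := Nat.exists_eq_succ_of_ne_zero (show n ≠ 0 by lia)
  rw [mul_assoc, zpow_neg_mul_pow hq0, show ((m.succ : ℕ) : ℤ) - 1 + k = ((m + k : ℕ) : ℤ) by
    push_cast; ring, zpow_natCast]
  exact he _

theorem degree_monicPoly_sum_le (hq0 : q ≠ 0) {a : ℂ} (ha : a ≠ 0) (u : ℕ → ℂ) (n : ℕ) :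
    (∑ k ∈ Finset.range n, C (u k) * awBasis q a k).degree < n := by
  refine mem_degreeLT.1 (Submodule.sum_mem _ fun k hk => mem_degreeLT.2 ?_)
  rw [← smul_eq_C_mul]
  refine (degree_smul_le _ _).trans_lt ?_
  rw [degree_awBasis hq0 ha]
  exact_mod_cast Finset.mem_range.1 hk

theorem monicPoly_degree_and_monic (hq0 : q ≠ 0) (hq1 : ‖q‖ < 1) {a b c d : ℂ} (ha : a ≠ 0)
    (he : ∀ k : ℕ, a * b * c * d * q ^ k ≠ 1) (n : ℕ) :
    (monicPoly q a b c d n).degree = n ∧ (monicPoly q a b c d n).Monic := by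
  have hs := qPoch_abcd_ne_zero hq0 he n
  have h2a : (2 * a) ^ n ≠ 0 := pow_ne_zero _ (mul_ne_zero two_ne_zero ha)
  have hcoeff : monicPolyCoeff q a b c d n n * ∏ i ∈ Finset.range n, (-(2 * (a * q ^ i)))
      = (2 * a) ^ n * qPoch q (a * b * c * d * q ^ ((n : ℤ) - 1)) n := by
    have h1 : ∏ i ∈ Finset.range n, (-(2 * (a * q ^ i)))
        = (2 * a) ^ n * ∏ i ∈ Finset.range n, (-(q ^ i)) := by
      rw [show (2 * a) ^ n = ∏ _i ∈ Finset.range n, (2 * a) by simp, ← Finset.prod_mul_distrib]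
      exact Finset.prod_congr rfl fun i _ => by ring
    have h3 := qPoch_neg_pow_self hq0 n
    have h4 := qPoch_self_ne_zero hq1 n
    unfold monicPolyCoeff
    rw [h1, Nat.sub_self]
    simp only [qPoch_zero, mul_one]
    field_simp
    linear_combination h3
  have hne : monicPolyCoeff q a b c d n n ≠ 0 := fun h => by
    rw [h, zero_mul] at hcoeff
    exact mul_ne_zero h2a hs hcoeff.symm
  have hlow := degree_monicPoly_sum_le hq0 ha (monicPolyCoeff q a b c d n) n
  have htop : (C (monicPolyCoeff q a b c d n n) * awBasis q a n).degree = n := by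
    rw [degree_C_mul hne, degree_awBasis hq0 ha]
  rw [← htop] at hlow
  have hinv := inv_ne_zero (mul_ne_zero h2a hs)
  rw [monicPoly_eq, Finset.sum_range_succ]
  refine ⟨?_, ?_⟩
  · rw [degree_C_mul hinv, degree_add_eq_right_of_degree_lt hlow, htop]
  · rw [Monic, leadingCoeff_mul, leadingCoeff_C, leadingCoeff_add_of_degree_lt hlow,
      leadingCoeff_mul, leadingCoeff_C, leadingCoeff_awBasis hq0 ha, hcoeff]
    exact inv_mul_cancel₀ (mul_ne_zero h2a hs)

end Basis

/-! ### The Askey–Wilson operator lowers the degree and shifts the parameters. -/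

section Difference

variable {q r : ℂ}

/-- Every x is of the form x(z). The excluded z, where the denominator of D_q vanishes, cost only
the points x = ±1. -/
theorem eq_of_eval_lat_eq {f g : ℂ[X]}
    (h : ∀ z : ℂ, z ≠ 0 → z ^ 2 ≠ 1 → f.eval (lat z) = g.eval (lat z)) : f = g := by
  refine Polynomial.eq_of_infinite_eval_eq f g ?_
  refine Set.Infinite.mono (s := ({1, -1} : Set ℂ)ᶜ) (fun x hx => ?_)
    (Set.toFinite _).infinite_compl
  obtain ⟨s, hs⟩ := IsAlgClosed.exists_eq_mul_self (x ^ 2 - 1)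
  have hmul : (x + s) * (x - s) = 1 := by linear_combination hs
  have hz : x + s ≠ 0 := left_ne_zero_of_mul_eq_one hmul
  have hlat : lat (x + s) = x := by
    rw [lat, ← eq_inv_of_mul_eq_one_right hmul]
    ring
  have := h (x + s) hz fun h1 => hx ?_
  · rwa [hlat] at this
  · rw [← hlat, lat]
    rcases eq_or_eq_neg_of_sq_eq_sq _ _ (h1.trans (one_pow 2).symm) with h2 | h2
    · simp [h2]
    · rw [h2]
      norm_num

/-- The values at x(rz) and x(z/r) share the factor (arz, ar/z;q)_k, which is φ_k(ar) at x(z). What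
is left is a difference of two products of two linear factors. -/
theorem awDiff_awBasis_succ (hr0 : r ≠ 0) (hr : r ^ 2 = q) (hq1 : ‖q‖ < 1) {a : ℂ} (k : ℕ) :
    awDiff r (awBasis q a (k + 1))
      = C (2 * a * (1 - q ^ (k + 1)) / (q - 1)) * awBasis q (a * r) k := by
  have hq : q - 1 ≠ 0 := sub_ne_zero.2 (by simpa using pow_ne_one_of_norm_lt_one hq1 one_ne_zero)
  refine eq_of_eval_lat_eq fun z hz hz2 => ?_
  have hspec := awDiff_spec r z hr0 hz (awBasis q a (k + 1))
  have hden : lat (r * z) - lat (r⁻¹ * z) = (q - 1) * (z ^ 2 - 1) / (2 * r * z) := by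
    unfold lat
    rw [← hr]
    field_simp
    ring
  have hden0 : lat (r * z) - lat (r⁻¹ * z) ≠ 0 := by
    rw [hden]
    exact div_ne_zero (mul_ne_zero hq (sub_ne_zero.2 hz2))
      (mul_ne_zero (mul_ne_zero two_ne_zero hr0) hz)
  refine mul_right_cancel₀ hden0 ?_
  rw [hspec, eval_awBasis_lat _ _ _ (mul_ne_zero hr0 hz),
    eval_awBasis_lat _ _ _ (mul_ne_zero (inv_ne_zero hr0) hz), eval_mul, eval_C,
    eval_awBasis_lat _ _ _ hz, hden]
  have e1 : qPoch q (a * (r * z)) (k + 1) = qPoch q (a * r * z) k * (1 - a * r * z * q ^ k) := by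
    rw [qPoch_succ, mul_assoc a r z]
  have e2 : qPoch q (a * (r * z)⁻¹) (k + 1) = (1 - a * (r * z)⁻¹) * qPoch q (a * r * z⁻¹) k := by
    rw [qPoch_succ', ← hr]
    congr 2
    field_simp
  have e3 : qPoch q (a * (r⁻¹ * z)) (k + 1) = (1 - a * (r⁻¹ * z)) * qPoch q (a * r * z) k := by
    rw [qPoch_succ', ← hr]
    congr 2
    field_simp
  have e4 : qPoch q (a * (r⁻¹ * z)⁻¹) (k + 1)
      = qPoch q (a * r * z⁻¹) k * (1 - a * r * z⁻¹ * q ^ k) := by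
    rw [qPoch_succ]
    have : a * (r⁻¹ * z)⁻¹ = a * r * z⁻¹ := by field_simp
    rw [this]
  rw [e1, e2, e3, e4]
  generalize qPoch q (a * r * z) k = A
  generalize qPoch q (a * r * z⁻¹) k = B
  rw [pow_succ q k]
  generalize q ^ k = Q
  field_simp
  rw [← hr]
  ring

theorem awDiff_C_mul (r u : ℂ) (f : ℂ[X]) : awDiff r (C u * f) = C u * awDiff r f := by
  rw [← smul_eq_C_mul, map_smul, smul_eq_C_mul]

theorem awDiff_one (r : ℂ) : awDiff r (1 : ℂ[X]) = 0 := by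
  rw [← monomial_zero_one, awDiff, lsum_apply, sum_monomial_index _ _ (by simp)]
  simp [awDiffPow]

theorem awDiff_monicPoly_zero (q r a b c d : ℂ) : awDiff r (monicPoly q a b c d 0) = 0 := by
  rw [monicPoly_eq, awDiff_C_mul, map_sum]
  simp [awDiff_C_mul, awBasis_zero, awDiff_one]

/-- D_q acts termwise on the expansion, and the scalar relating the old coefficient at k + 1 to the
new coefficient at k does not depend on k. -/
theorem awDiff_monicPoly_succ (hr0 : r ≠ 0) (hr : r ^ 2 = q) (hq1 : ‖q‖ < 1) {a b c d : ℂ}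
    (ha : a ≠ 0) (he : ∀ k : ℕ, a * b * c * d * q ^ k ≠ 1) (n : ℕ) :
    ∃ κ : ℂ, κ ≠ 0 ∧ awDiff r (monicPoly q a b c d (n + 1))
      = C κ * monicPoly q (a * r) (b * r) (c * r) (d * r) n := by
  have hq0 : q ≠ 0 := hr ▸ pow_ne_zero 2 hr0
  have hq : q - 1 ≠ 0 := sub_ne_zero.2 (by simpa using pow_ne_one_of_norm_lt_one hq1 one_ne_zero)
  have hqn : q ^ (n + 1) ≠ 1 := pow_ne_one_of_norm_lt_one hq1 n.succ_ne_zero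
  set s := a * b * c * d * q ^ n with hs
  have hs1 : 1 - s ≠ 0 := sub_ne_zero.2 (he n).symm
  have hsq : qPoch q (s * q) n ≠ 0 := qPoch_ne_zero fun k _ => by
    have := he (n + 1 + k)
    rwa [pow_add, pow_succ, ← mul_assoc, ← mul_assoc, ← hs] at this
  have hs' : a * b * c * d * q ^ (((n + 1 : ℕ) : ℤ) - 1) = s := by
    rw [hs]; simp
  have hs'' : a * r * (b * r) * (c * r) * (d * r) * q ^ ((n : ℤ) - 1) = s * q := by
    rw [zpow_sub_one₀ hq0, zpow_natCast, hs, ← hr]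
    field_simp
  set t := q ^ (-((n + 1 : ℕ) : ℤ)) with ht
  have ht1 : 1 - t ≠ 0 := by
    rw [ht, zpow_neg, zpow_natCast]
    exact sub_ne_zero.2 fun h => hqn (inv_eq_one.1 h.symm)
  have ht' : q ^ (-(n : ℤ)) = t * q := by
    rw [ht, ← zpow_add_one₀ hq0]; congr 1; push_cast; ring
  have hrr : ∀ u v : ℂ, ∀ k : ℕ, u * r * (v * r) * q ^ k = u * v * q ^ (k + 1) := fun u v k => by
    rw [pow_succ, ← hr]; ring
  have hterm : ∀ k ∈ Finset.range (n + 1),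
      awDiff r (C (monicPolyCoeff q a b c d (n + 1) (k + 1)) * awBasis q a (k + 1))
        = C (2 * a * q * (1 - t) * (1 - s) / (q - 1)) *
          (C (monicPolyCoeff q (a * r) (b * r) (c * r) (d * r) n k) * awBasis q (a * r) k) := by
    intro k hk
    rw [awDiff_C_mul, awDiff_awBasis_succ hr0 hr hq1, ← mul_assoc, ← mul_assoc, ← C_mul, ← C_mul]
    congr 2
    have h1 : 1 - q * q ^ k ≠ 0 := by
      rw [← pow_succ']
      exact sub_ne_zero.2 (pow_ne_one_of_norm_lt_one hq1 k.succ_ne_zero).symm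
    have h2 := qPoch_self_ne_zero hq1 k
    unfold monicPolyCoeff
    rw [hs', hs'', ht', ← ht, Nat.add_sub_add_right, hrr, hrr, hrr, qPoch_succ' q t,
      qPoch_succ' q s, qPoch_succ q q, pow_succ' q k]
    field_simp
  rw [monicPoly_eq, monicPoly_eq, awDiff_C_mul, map_sum, Finset.sum_range_succ',
    Finset.sum_congr rfl hterm, ← Finset.mul_sum]
  have h0 : awDiff r (C (monicPolyCoeff q a b c d (n + 1) 0) * awBasis q a 0) = 0 := by
    rw [awDiff_C_mul, awBasis_zero, awDiff_one, mul_zero]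
  rw [h0, add_zero, hs', hs'', qPoch_succ']
  refine ⟨((2 * a) ^ (n + 1) * ((1 - s) * qPoch q (s * q) n))⁻¹
    * (2 * a * q * (1 - t) * (1 - s) / (q - 1)) * ((2 * (a * r)) ^ n * qPoch q (s * q) n), ?_, ?_⟩
  · have h2 : (2 : ℂ) ≠ 0 := two_ne_zero
    refine mul_ne_zero (mul_ne_zero (inv_ne_zero ?_) (div_ne_zero ?_ hq)) ?_
    · exact mul_ne_zero (pow_ne_zero _ (mul_ne_zero h2 ha)) (mul_ne_zero hs1 hsq)
    · exact mul_ne_zero (mul_ne_zero (mul_ne_zero (mul_ne_zero h2 ha) hq0) ht1) hs1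
    · exact mul_ne_zero (pow_ne_zero _ (mul_ne_zero h2 (mul_ne_zero ha hr0))) hsq
  · have h1 : (2 * (a * r)) ^ n * qPoch q (s * q) n ≠ 0 :=
      mul_ne_zero (pow_ne_zero _ (mul_ne_zero two_ne_zero (mul_ne_zero ha hr0))) hsq
    generalize (2 * (a * r)) ^ n * qPoch q (s * q) n = v at h1 ⊢
    generalize (2 * a * q * (1 - t) * (1 - s) / (q - 1)) = w
    have h3 : (C v : ℂ[X]) * C v⁻¹ = 1 := by rw [← C_mul, mul_inv_cancel₀ h1, C_1]
    rw [C_mul, C_mul, mul_assoc (C _ * C w), ← mul_assoc (C v), h3, one_mul]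
    exact (mul_assoc _ _ _).symm

/-- Iterating `awDiff` on Askey-Wilson polynomials. -/
theorem awDiff_iterate_monicPoly (hr0 : r ≠ 0) (hr : r ^ 2 = q) (hq1 : ‖q‖ < 1) (N : ℕ) :
    ∀ {a b c d : ℂ}, a ≠ 0 → (∀ k : ℕ, a * b * c * d * q ^ k ≠ 1) → ∀ n : ℕ,
    (n < N → (awDiff r)^[N] (monicPoly q a b c d n) = 0) ∧
    (N ≤ n → ∃ κ : ℂ, κ ≠ 0 ∧ (awDiff r)^[N] (monicPoly q a b c d n)
      = C κ * monicPoly q (a * r ^ N) (b * r ^ N) (c * r ^ N) (d * r ^ N) (n - N)) := by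
  have hCmul : ∀ (M : ℕ) (u : ℂ) (f : ℂ[X]),
      (awDiff r)^[M] (C u * f) = C u * (awDiff r)^[M] f := by
    intro M u f
    induction M with
    | zero => rfl
    | succ M ih => rw [Function.iterate_succ_apply', Function.iterate_succ_apply', ih, awDiff_C_mul]
  have hzero : ∀ M : ℕ, (awDiff r)^[M] 0 = 0 := fun M =>
    Function.iterate_fixed (map_zero _) M
  induction N with
  | zero =>
    intro a b c d _ _ n
    exact ⟨fun h => absurd h n.not_lt_zero, fun _ => ⟨1, one_ne_zero, by simp⟩⟩
  | succ N ih =>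
    intro a b c d ha he n
    rw [Function.iterate_succ_apply]
    rcases n with _ | n
    · refine ⟨fun _ => ?_, fun h => absurd h (by lia)⟩
      rw [awDiff_monicPoly_zero, hzero]
    · obtain ⟨κ, hκ, h⟩ := awDiff_monicPoly_succ hr0 hr hq1 ha he n
      have he' : ∀ k : ℕ, a * r * (b * r) * (c * r) * (d * r) * q ^ k ≠ 1 := fun k => by
        have := he (k + 2)
        rw [pow_add, ← hr] at this
        rw [← hr]
        convert! this using 1
        ring
      obtain ⟨h1, h2⟩ := ih (mul_ne_zero ha hr0) he' n
      rw [h, hCmul]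
      refine ⟨fun hn => by rw [h1 (by lia), mul_zero], fun hn => ?_⟩
      obtain ⟨κ', hκ', h'⟩ := h2 (by lia)
      refine ⟨κ * κ', mul_ne_zero hκ hκ', ?_⟩
      rw [h', ← mul_assoc, ← C_mul, Nat.add_sub_add_right]
      congr 2 <;> ring

end Difference

end AskeyWilson

end

noncomputable section

namespace AskeyWilson

/-! ### Orthogonality from the moment recurrence alone. -/

section Orthogonality

variable {q a b c d : ℂ}

/-- A linear functional whose moments in the basis `awBasis q a` obey the one-step recurrence
characteristic of Askey-Wilson functionals. -/
def IsAWFunctional (q a b c d : ℂ) (T : ℂ[X] →ₗ[ℂ] ℂ) : Prop :=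
  ∀ k : ℕ, (1 - a * b * c * d * q ^ k) * T (awBasis q a (k + 1))
    = (1 - a * b * q ^ k) * (1 - a * c * q ^ k) * (1 - a * d * q ^ k) * T (awBasis q a k)

variable {T : ℂ[X] →ₗ[ℂ] ℂ}

theorem IsAWFunctional.map_awBasis (hT : IsAWFunctional q a b c d T) (k : ℕ) :
    qPoch q (a * b * c * d) k * T (awBasis q a k)
      = qPoch q (a * b) k * qPoch q (a * c) k * qPoch q (a * d) k * T 1 := by
  induction k with
  | zero => simp [qPoch_zero, awBasis_zero]
  | succ k ih =>
    have := hT k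
    simp only [qPoch_succ]
    linear_combination qPoch q (a * b * c * d) k * this
      + (1 - a * b * q ^ k) * (1 - a * c * q ^ k) * (1 - a * d * q ^ k) * ih

/-- The moments of an Askey-Wilson functional in the two bases `awBasis q a`, `awBasis q b`. -/
theorem IsAWFunctional.map_awBasis_mul_awBasis (hT : IsAWFunctional q a b c d T) (hq0 : q ≠ 0)
    (ha : a ≠ 0) (he : ∀ k : ℕ, a * b * c * d * q ^ k ≠ 1) (k j : ℕ) :
    qPoch q (a * b * c * d) (k + j) * T (awBasis q a k * awBasis q b j)
      = qPoch q (a * b) (k + j) * qPoch q (a * c) k * qPoch q (a * d) k * qPoch q (b * c) j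
        * qPoch q (b * d) j * T 1 := by
  induction j generalizing k with
  | zero => simpa [qPoch_zero, awBasis_zero] using hT.map_awBasis k
  | succ j ih =>
    have h1 := ih k
    have h2 := ih (k + 1)
    set α := a * q ^ k with hα
    set β := b * q ^ j with hβ
    have hα0 : α ≠ 0 := mul_ne_zero ha (pow_ne_zero _ hq0)
    -- The next factor 1 - 2βx + β² of φ_{j+1}(b) is β/α times the next factor 1 - 2αx + α² of
    -- φ_{k+1}(a) plus a constant. This trades a step in j for a step in k.
    have hfac : awBasis q a k * awBasis q b (j + 1)
        = (β / α) • (awBasis q a (k + 1) * awBasis q b j)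
          + ((1 - α * β) * (1 - β / α)) • (awBasis q a k * awBasis q b j) := by
      rw [awBasis_succ, awBasis_succ, smul_eq_C_mul, smul_eq_C_mul]
      have e1 : (2 * a * q ^ k : ℂ) = 2 * α := by rw [hα]; ring
      have e2 : (2 * b * q ^ j : ℂ) = 2 * β := by rw [hβ]; ring
      have e3 : (a ^ 2 * q ^ (2 * k) : ℂ) = α ^ 2 := by rw [hα]; ring
      have e4 : (b ^ 2 * q ^ (2 * j) : ℂ) = β ^ 2 := by rw [hβ]; ring
      rw [e1, e2, e3, e4]
      have e5 : (C (2 * β) : ℂ[X]) = C (β / α) * C (2 * α) := by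
        rw [← C_mul]; congr 1; field_simp
      have e6 : (C (β ^ 2) : ℂ[X]) = C (β / α) + C (β / α) * C (α ^ 2)
          + C ((1 - α * β) * (1 - β / α)) - 1 := by
        rw [← C_mul, ← C_1, ← C_add, ← C_add, ← C_sub]; congr 1; field_simp; ring
      rw [e5, e6]
      ring
    have hE : 1 - a * b * c * d * q ^ (k + j) ≠ 0 := sub_ne_zero.2 (he _).symm
    have hP : qPoch q (a * b * c * d) (k + j) ≠ 0 := qPoch_ne_zero fun i _ => he i
    rw [show k + 1 + j = k + j + 1 by ring, qPoch_succ, qPoch_succ, qPoch_succ, qPoch_succ] at h2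
    rw [hfac, map_add, map_smul, map_smul, smul_eq_mul, smul_eq_mul, ← add_assoc, qPoch_succ,
      qPoch_succ, qPoch_succ, qPoch_succ]
    have e1 : a * b * c * d * q ^ (k + j) = α * β * c * d := by rw [hα, hβ]; ring
    have e2 : a * b * q ^ (k + j) = α * β := by rw [hα, hβ]; ring
    have e3 : a * c * q ^ k = α * c := by rw [hα]; ring
    have e4 : a * d * q ^ k = α * d := by rw [hα]; ring
    have e5 : b * c * q ^ j = β * c := by rw [hβ]; ring
    have e6 : b * d * q ^ j = β * d := by rw [hβ]; ring
    rw [e1] at hE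
    rw [e1, e2, e3, e4] at h2
    rw [e1, e2, e5, e6]
    have key : (β / α) * ((1 - α * c) * (1 - α * d)) + (1 - β / α) * (1 - α * β * c * d)
        = (1 - β * c) * (1 - β * d) := by field_simp; ring
    linear_combination (β / α) * h2 + (1 - α * β) * (1 - β / α) * (1 - α * β * c * d) * h1
      + qPoch q (a * b) (k + j) * (1 - α * β) * qPoch q (a * c) k * qPoch q (a * d) k
        * qPoch q (b * c) j * qPoch q (b * d) j * T 1 * key

/-- The factors with ac and ad complete to (ac;q)_n and (ad;q)_n and leave the sum; from ab only (ab
q^k;q)_j still depends on k. -/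
theorem IsAWFunctional.map_monicPoly_mul_awBasis (hT : IsAWFunctional q a b c d T) (hq0 : q ≠ 0)
    (hq1 : ‖q‖ < 1) (ha : a ≠ 0) (he : ∀ k : ℕ, a * b * c * d * q ^ k ≠ 1) (n j : ℕ) :
    T (monicPoly q a b c d n * awBasis q b j)
      = ((2 * a) ^ n * qPoch q (a * b * c * d * q ^ ((n : ℤ) - 1)) n)⁻¹
        * (qPoch q (a * b) n * qPoch q (a * c) n * qPoch q (a * d) n * qPoch q (b * c) j
          * qPoch q (b * d) j * T 1)
        * ∑ k ∈ Finset.range (n + 1), qBinCoeff q n k * q ^ k *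
          (qPoch q (a * b * q ^ k) j * (qPoch q (a * b * c * d * q ^ ((n : ℤ) - 1)) k
            / qPoch q (a * b * c * d) (k + j))) := by
  rw [monicPoly_eq, mul_assoc, ← smul_eq_C_mul, map_smul, smul_eq_mul, Finset.sum_mul, map_sum]
  conv_rhs => rw [mul_assoc, Finset.mul_sum]
  congr 1
  refine Finset.sum_congr rfl fun k hk => ?_
  rw [mul_assoc, ← smul_eq_C_mul, map_smul, smul_eq_mul]
  have hP : qPoch q (a * b * c * d) (k + j) ≠ 0 := qPoch_ne_zero fun i _ => he i
  have hM := hT.map_awBasis_mul_awBasis hq0 ha he k j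
  rw [mul_comm, ← eq_div_iff hP] at hM
  rw [hM]
  obtain ⟨m, rfl⟩ := Nat.exists_eq_add_of_le (Nat.lt_succ_iff.1 (Finset.mem_range.1 hk))
  have h1 := qPoch_self_ne_zero hq1 k
  unfold monicPolyCoeff qBinCoeff
  rw [Nat.add_sub_cancel_left, qPoch_add q (a * b) k j, qPoch_add q (a * b) k m,
    qPoch_add q (a * c) k m, qPoch_add q (a * d) k m]
  generalize qPoch q (a * b * c * d) (k + j) = v at hP ⊢
  generalize qPoch q q k = w at h1 ⊢
  generalize qPoch q (q ^ (-((k + m : ℕ) : ℤ))) k = u₁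
  generalize qPoch q (a * b * c * d * q ^ (((k + m : ℕ) : ℤ) - 1)) k = u₂
  generalize T 1 = t
  ring

theorem IsAWFunctional.map_monicPoly_mul_awBasis_of_lt (hT : IsAWFunctional q a b c d T)
    (hq0 : q ≠ 0) (hq1 : ‖q‖ < 1) (ha : a ≠ 0) (he : ∀ k : ℕ, a * b * c * d * q ^ k ≠ 1)
    {n j : ℕ} (hj : j < n) : T (monicPoly q a b c d n * awBasis q b j) = 0 := by
  rw [hT.map_monicPoly_mul_awBasis hq0 hq1 ha he]
  refine mul_eq_zero_of_right _ ?_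
  obtain ⟨i, rfl⟩ := Nat.exists_eq_add_of_lt hj
  set e := a * b * c * d
  clear_value e
  have hP : ∀ m, qPoch q e m ≠ 0 := fun m => qPoch_ne_zero fun i _ => he i
  have hs : e * q ^ (((j + i + 1 : ℕ) : ℤ) - 1) = e * q ^ (j + i) := by simp [← zpow_natCast]
  rw [hs]
  -- With n = j + i + 1 and e = abcd, the quotient (e q^{n-1};q)_k / (e;q)_{k+j} equals (e
  -- q^{j+k};q)_i / (e;q)_{j+i}. So the summand is a polynomial in q^k of degree at most j + i < n.
  set R : ℂ[X] := C (qPoch q e (j + i))⁻¹ * (qPochPoly q (a * b) j * qPochPoly q (e * q ^ j) i)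
    with hR
  have hdeg : R.degree < ((j + i + 1 : ℕ) : WithBot ℕ) := by
    have h1 : R.natDegree ≤ j + i := (natDegree_C_mul_le _ _).trans
      (natDegree_mul_le.trans (add_le_add (natDegree_qPochPoly_le _ _ _)
        (natDegree_qPochPoly_le _ _ _)))
    exact (degree_le_of_natDegree_le h1).trans_lt (by exact_mod_cast Nat.lt_succ_self _)
  rw [← sum_qBinCoeff_eval_eq_zero hq0 hq1 (j + i + 1) hdeg]
  refine Finset.sum_congr rfl fun k _ => ?_
  congr 1
  rw [hR, eval_mul, eval_mul, eval_C, eval_qPochPoly, eval_qPochPoly]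
  have h1 := qPoch_add q e (j + i) k
  have h2 := qPoch_add q e (k + j) i
  rw [show j + i + k = k + j + i by ring, h2] at h1
  have h3 : qPoch q (e * q ^ (j + i)) k / qPoch q e (k + j)
      = (qPoch q e (j + i))⁻¹ * qPoch q (e * q ^ j * q ^ k) i := by
    have e1 : e * q ^ j * q ^ k = e * q ^ (k + j) := by rw [pow_add]; ring
    rw [e1, div_eq_iff (hP _), mul_assoc, eq_comm, inv_mul_eq_iff_eq_mul₀ (hP _), mul_comm]
    exact h1
  rw [h3]
  ring

theorem IsAWFunctional.map_monicPoly_mul_awBasis_self (hT : IsAWFunctional q a b c d T)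
    (hq0 : q ≠ 0) (hq1 : ‖q‖ < 1) (ha : a ≠ 0) (hb : b ≠ 0) (hc : c ≠ 0) (hd : d ≠ 0)
    (he : ∀ k : ℕ, a * b * c * d * q ^ k ≠ 1) (h1 : T 1 ≠ 0) {n : ℕ}
    (hab : ∀ k < n, a * b * q ^ k ≠ 1) (hac : ∀ k < n, a * c * q ^ k ≠ 1)
    (had : ∀ k < n, a * d * q ^ k ≠ 1) (hbc : ∀ k < n, b * c * q ^ k ≠ 1)
    (hbd : ∀ k < n, b * d * q ^ k ≠ 1) (hcd : ∀ k < n, c * d * q ^ k ≠ 1) :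
    T (monicPoly q a b c d n * awBasis q b n) ≠ 0 := by
  rcases n with _ | n
  · have : monicPoly q a b c d 0 = 1 := by
      simp [monicPoly_eq, monicPolyCoeff, qPoch_zero, awBasis_zero]
    rwa [this, awBasis_zero, mul_one]
  rw [hT.map_monicPoly_mul_awBasis hq0 hq1 ha he]
  have hpre := inv_ne_zero (mul_ne_zero (pow_ne_zero (n + 1) (mul_ne_zero two_ne_zero ha))
    (qPoch_abcd_ne_zero hq0 he (n + 1)))
  refine mul_ne_zero (mul_ne_zero hpre ?_) ?_
  · exact mul_ne_zero (mul_ne_zero (mul_ne_zero (mul_ne_zero (mul_ne_zero (qPoch_ne_zero hab)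
      (qPoch_ne_zero hac)) (qPoch_ne_zero had)) (qPoch_ne_zero hbc)) (qPoch_ne_zero hbd)) h1
  set e := a * b * c * d with he'
  have hP : ∀ m, qPoch q e m ≠ 0 := fun m => qPoch_ne_zero fun i _ => he i
  have hs : e * q ^ (((n + 1 : ℕ) : ℤ) - 1) = e * q ^ n := by simp
  rw [hs]
  set s := e * q ^ n with hs'
  have he0 : e ≠ 0 := mul_ne_zero (mul_ne_zero (mul_ne_zero ha hb) hc) hd
  have hs0 : s ≠ 0 := mul_ne_zero he0 (pow_ne_zero _ hq0)
  have hs1 : ∀ k : ℕ, s * q ^ k ≠ 1 := fun k => by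
    rw [hs', mul_assoc, ← pow_add]; exact he _
  -- For equal degrees the denominator is one factor too long, which leaves the simple pole 1/(1 - s
  -- q^k).
  have hsum : ∑ k ∈ Finset.range (n + 1 + 1), qBinCoeff q (n + 1) k * q ^ k *
      (qPoch q (a * b * q ^ k) (n + 1) * (qPoch q s k / qPoch q e (k + (n + 1))))
      = (qPoch q e n)⁻¹ * ∑ k ∈ Finset.range (n + 1 + 1), qBinCoeff q (n + 1) k * q ^ k *
        ((qPochPoly q (a * b) (n + 1)).eval (q ^ k) / (1 - s * q ^ k)) := by
    rw [Finset.mul_sum]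
    refine Finset.sum_congr rfl fun k _ => ?_
    have h2 : qPoch q e (k + (n + 1)) = qPoch q e n * (qPoch q s k * (1 - s * q ^ k)) := by
      rw [← qPoch_succ, ← qPoch_add]
      congr 1
      ring
    have h3 : qPoch q s k ≠ 0 := qPoch_ne_zero fun i _ => hs1 i
    have h4 : 1 - s * q ^ k ≠ 0 := sub_ne_zero.2 (hs1 k).symm
    have h5 := hP n
    rw [h2, eval_qPochPoly]
    generalize 1 - s * q ^ k = v at h4 ⊢
    field_simp
  rw [hsum, sum_qBinCoeff_eval_div hq0 hq1 (n + 1) hs0 (fun k _ => hs1 k)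
    (natDegree_qPochPoly_le _ _ _)]
  refine mul_ne_zero (inv_ne_zero (hP n)) (mul_ne_zero ?_
    (sum_qBinCoeff_div_ne_zero hq0 hq1 (n + 1) hs0 fun k _ => hs1 k))
  rw [eval_qPochPoly]
  -- Here ab/s = 1/(cd q^n), so a vanishing factor would mean cd q^i = 1 for some i ≤ n. This is how
  -- the condition on cd, invisible in the moments, enters the norm.
  refine qPoch_ne_zero fun k hk h => ?_
  obtain ⟨i, rfl⟩ := Nat.exists_eq_add_of_le (Nat.lt_succ_iff.1 hk)
  refine hcd i (by lia) ?_
  have h2 : a * b * q ^ k = s := by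
    have := congrArg (· * s) h
    simp only [one_mul] at this
    rw [← this]
    field_simp
  have h3 : a * b * q ^ k ≠ 0 := mul_ne_zero (mul_ne_zero ha hb) (pow_ne_zero _ hq0)
  refine mul_left_cancel₀ h3 ?_
  rw [mul_one]
  conv_rhs => rw [h2, hs', he']
  ring

/-- Orthogonality of the Askey-Wilson polynomials, for any Askey-Wilson functional. -/
theorem IsAWFunctional.map_monicPoly_mul_of_degree_lt (hT : IsAWFunctional q a b c d T)
    (hq0 : q ≠ 0) (hq1 : ‖q‖ < 1) (ha : a ≠ 0) (hb : b ≠ 0)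
    (he : ∀ k : ℕ, a * b * c * d * q ^ k ≠ 1) {n : ℕ} {f : ℂ[X]} (hf : f.degree < n) :
    T (monicPoly q a b c d n * f) = 0 :=
  map_eq_zero_of_degree_lt (T := T ∘ₗ LinearMap.mulLeft ℂ (monicPoly q a b c d n))
    (degree_awBasis hq0 hb)
    (fun _ hj => hT.map_monicPoly_mul_awBasis_of_lt hq0 hq1 ha he hj) hf

theorem IsAWFunctional.map_monicPoly_mul_self (hT : IsAWFunctional q a b c d T)
    (hq0 : q ≠ 0) (hq1 : ‖q‖ < 1) (ha : a ≠ 0) (hb : b ≠ 0) (hc : c ≠ 0) (hd : d ≠ 0)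
    (he : ∀ k : ℕ, a * b * c * d * q ^ k ≠ 1) (h1 : T 1 ≠ 0) {n : ℕ}
    (hab : ∀ k < n, a * b * q ^ k ≠ 1) (hac : ∀ k < n, a * c * q ^ k ≠ 1)
    (had : ∀ k < n, a * d * q ^ k ≠ 1) (hbc : ∀ k < n, b * c * q ^ k ≠ 1)
    (hbd : ∀ k < n, b * d * q ^ k ≠ 1) (hcd : ∀ k < n, c * d * q ^ k ≠ 1) :
    T (monicPoly q a b c d n * monicPoly q a b c d n) ≠ 0 := by
  have h2 := hT.map_monicPoly_mul_awBasis_self hq0 hq1 ha hb hc hd he h1 hab hac had hbc hbd hcd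
  obtain ⟨hdeg, hmonic⟩ := monicPoly_degree_and_monic hq0 hq1 ha he n
  set p := monicPoly q a b c d n
  have hφ := degree_awBasis hq0 hb n
  have hφ0 : awBasis q b n ≠ 0 := fun h => by simp [h] at hφ
  have hlc := leadingCoeff_ne_zero.2 hφ0
  have hlow : (awBasis q b n - C (awBasis q b n).leadingCoeff * p).degree < n := by
    have := degree_sub_lt_left (p := awBasis q b n) (q := C (awBasis q b n).leadingCoeff * p)
      (by rw [degree_C_mul hlc, hφ, hdeg]) hφ0 (by rw [leadingCoeff_mul, leadingCoeff_C,
        hmonic.leadingCoeff, mul_one])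
    rwa [hφ] at this
  have h3 := hT.map_monicPoly_mul_of_degree_lt hq0 hq1 ha hb he hlow
  intro h0
  rw [mul_sub, mul_left_comm, map_sub, ← smul_eq_C_mul, map_smul, h0, smul_zero, sub_zero] at h3
  exact h2 h3

end Orthogonality

end AskeyWilson

end

noncomputable section

namespace AskeyWilson

/-! ### The q-Racah functional L_0. -/

section Racah

variable {q a b c d : ℂ} {N : ℕ}

/-- The weights of the `q`-Racah functional. -/
def racahWeight (q a c d : ℂ) (N j : ℕ) : ℂ :=
  qPoch q (q ^ (1 - (N : ℤ))) j * qPoch q (a * c) j * qPoch q (a * d) j * qPoch q (a ^ 2) j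
      / (qPoch q q j * qPoch q (a ^ 2 * q ^ N) j * qPoch q (a * c⁻¹ * q) j
          * qPoch q (a * d⁻¹ * q) j)
    * ((1 - a ^ 2 * q ^ (2 * j)) / ((c * d * q ^ (-(N : ℤ))) ^ j * (1 - a ^ 2)))

/-- The `q`-Racah functional as a linear map. -/
def L0Linear (q a c d : ℂ) (N : ℕ) : ℂ[X] →ₗ[ℂ] ℂ :=
  ∑ j ∈ Finset.range N, racahWeight q a c d N j • Polynomial.leval (lat (a * q ^ j))

theorem L0Linear_apply (p : ℂ[X]) : L0Linear q a c d N p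
    = ∑ j ∈ Finset.range N, racahWeight q a c d N j * p.eval (lat (a * q ^ j)) := by
  simp [L0Linear, LinearMap.sum_apply]

theorem racah_node (hq0 : q ≠ 0) (ha : a ≠ 0) (j : ℕ) :
    (q ^ (-(j : ℤ)) + a ^ 2 * q ^ j) / (2 * a) = lat (a * q ^ j) := by
  unfold lat
  rw [zpow_neg, zpow_natCast]
  field_simp
  ring

theorem L0_eq_L0Linear (hq0 : q ≠ 0) (ha : a ≠ 0) (p : ℂ[X]) :
    L0 q a c d N p = L0Linear q a c d N p := by
  rw [L0Linear_apply]
  unfold L0 racahWeight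
  simp only [racah_node hq0 ha]

/-- The rational identity behind `RacahRegular.racahWeight_succ`, with the Pochhammer symbols and
their new factors as independent unknowns. -/
theorem racah_ratio_aux {q a b c d u A B G D E₀ E₁ E₂ E₃ E₄ E₅ E₆ E₇ E₈ E₉ E₁₀ Q₂ Q₃ Q₄ Q₅ : ℂ}
    (hq : q ≠ 0) (ha : a ≠ 0) (hb : b ≠ 0) (hc : c ≠ 0) (hd : d ≠ 0) (h0 : E₀ ≠ 0) (h1 : E₁ ≠ 0)
    (h2 : E₂ ≠ 0) (h3 : E₃ ≠ 0) (h4 : E₄ ≠ 0) (h5 : E₅ ≠ 0) (k2 : Q₂ ≠ 0) (k3 : Q₃ ≠ 0)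
    (k4 : Q₄ ≠ 0) (k5 : Q₅ ≠ 0) (hu : u ≠ 0) :
    E₁ * (-a * E₂ * (-b * E₃) * (-c * E₄) * (-d * E₅))
      * (A * E₈ * (B * E₉) * (G * E₁₀) * (D * E₇) / (Q₂ * E₂ * (Q₃ * E₃) * (Q₄ * E₄) * (Q₅ * E₅))
        * (E₆ / (u * (a * b * c * d / q) * E₀)))
    = q * E₆ * (E₇ * E₈ * E₉ * E₁₀) * (A * B * G * D / (Q₂ * Q₃ * Q₄ * Q₅) * (E₁ / (u * E₀))) := by
  field_simp

/-- The conditions on the parameters under which the `q`-Racah functional is well defined. -/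
structure RacahRegular (q a b c d : ℂ) (N : ℕ) : Prop where
  q_ne_zero : q ≠ 0
  norm_lt : ‖q‖ < 1
  pos : 1 ≤ N
  ab : a * b = q ^ (1 - (N : ℤ))
  c_ne_zero : c ≠ 0
  d_ne_zero : d ≠ 0
  sq : ∀ m : ℕ, m ≤ 2 * N - 2 → a ^ 2 * q ^ m ≠ 1
  hc : ∀ k : ℕ, k + 1 < N → a * q ^ (k + 1) ≠ c
  hd : ∀ k : ℕ, k + 1 < N → a * q ^ (k + 1) ≠ d

namespace RacahRegular

theorem ab_ne_zero (h : RacahRegular q a b c d N) : a * b ≠ 0 := by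
  rw [h.ab]
  exact zpow_ne_zero _ h.q_ne_zero

theorem a_ne_zero (h : RacahRegular q a b c d N) : a ≠ 0 := left_ne_zero_of_mul h.ab_ne_zero

theorem b_ne_zero (h : RacahRegular q a b c d N) : b ≠ 0 := right_ne_zero_of_mul h.ab_ne_zero

theorem ab_mul_pow (h : RacahRegular q a b c d N) : a * b * q ^ (N - 1) = 1 := by
  have := h.pos
  rw [h.ab, zpow_neg_mul_pow h.q_ne_zero, show (1 - (N : ℤ)) + (N - 1 : ℕ) = 0 by lia, zpow_zero]

theorem ab_mul_pow' (h : RacahRegular q a b c d N) : a * b * q ^ N = q := by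
  rw [h.ab, zpow_neg_mul_pow h.q_ne_zero, sub_add_cancel, zpow_one]

/-- A discrete Pearson equation at the node z = a q^m: it exchanges the products ∏(qz - α) and ∏(1 -
αz) over the four parameters, the two products that make up `stepDefect_mul`. -/
theorem racahWeight_succ (h : RacahRegular q a b c d N) {m : ℕ} (hm : m + 1 < N) :
    (1 - (a * q ^ m) ^ 2) * ((q * (a * q ^ m) - a) * (q * (a * q ^ m) - b)
      * (q * (a * q ^ m) - c) * (q * (a * q ^ m) - d)) * racahWeight q a c d N (m + 1)
    = q * (1 - q ^ 2 * (a * q ^ m) ^ 2) * ((1 - a * (a * q ^ m)) * (1 - b * (a * q ^ m))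
      * (1 - c * (a * q ^ m)) * (1 - d * (a * q ^ m))) * racahWeight q a c d N m := by
  have hq0 := h.q_ne_zero
  have ha := h.a_ne_zero
  have hb := h.b_ne_zero
  have hc := h.c_ne_zero
  have hd := h.d_ne_zero
  -- The weights do not mention b; the relation ab q^N = q brings it back and makes the equation
  -- symmetric in the parameters.
  have hqN : a ^ 2 * q ^ N = a * q / b := by
    rw [eq_div_iff hb]
    linear_combination a * h.ab_mul_pow'
  have hzN : c * d * q ^ (-(N : ℤ)) = a * b * c * d / q := by
    rw [zpow_neg, zpow_natCast]
    field_simp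
    linear_combination -h.ab_mul_pow'
  have h0 : 1 - a ^ 2 ≠ 0 := sub_ne_zero.2 (by simpa using (h.sq 0 (by lia)).symm)
  have h1 : 1 - a ^ 2 * q ^ (2 * m) ≠ 0 := sub_ne_zero.2 (h.sq _ (by lia)).symm
  have h2 : ∀ k ≤ m, q * q ^ k ≠ 1 := fun k _ => by
    rw [← pow_succ']
    exact pow_ne_one_of_norm_lt_one h.norm_lt k.succ_ne_zero
  have h3 : ∀ k ≤ m, a * q / b * q ^ k ≠ 1 := fun k _ => by
    rw [← hqN, mul_assoc, ← pow_add]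
    exact h.sq _ (by lia)
  have h4 : ∀ k ≤ m, a * c⁻¹ * q * q ^ k ≠ 1 := fun k _ h0 => by
    refine h.hc k (by lia) ?_
    field_simp at h0
    rw [pow_succ]
    linear_combination h0
  have h5 : ∀ k ≤ m, a * d⁻¹ * q * q ^ k ≠ 1 := fun k _ h0 => by
    refine h.hd k (by lia) ?_
    field_simp at h0
    rw [pow_succ]
    linear_combination h0
  have hP : ∀ x : ℂ, (∀ k ≤ m, x * q ^ k ≠ 1) → qPoch q x m ≠ 0 ∧ 1 - x * q ^ m ≠ 0 :=
    fun x hx => ⟨qPoch_ne_zero fun k hk => hx k hk.le, sub_ne_zero.2 (hx m le_rfl).symm⟩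
  obtain ⟨p2, e2⟩ := hP _ h2
  obtain ⟨p3, e3⟩ := hP _ h3
  obtain ⟨p4, e4⟩ := hP _ h4
  obtain ⟨p5, e5⟩ := hP _ h5
  unfold racahWeight
  rw [hqN, hzN, ← h.ab]
  simp only [qPoch_succ]
  have f1 : 1 - (a * q ^ m) ^ 2 = 1 - a ^ 2 * q ^ (2 * m) := by ring
  have f2 : 1 - q ^ 2 * (a * q ^ m) ^ 2 = 1 - a ^ 2 * q ^ (2 * (m + 1)) := by ring
  have f3 : q * (a * q ^ m) - a = -a * (1 - q * q ^ m) := by ring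
  have f4 : q * (a * q ^ m) - b = -b * (1 - a * q / b * q ^ m) := by field_simp; ring
  have f5 : q * (a * q ^ m) - c = -c * (1 - a * c⁻¹ * q * q ^ m) := by field_simp; ring
  have f6 : q * (a * q ^ m) - d = -d * (1 - a * d⁻¹ * q * q ^ m) := by field_simp; ring
  have f7 : 1 - a * (a * q ^ m) = 1 - a ^ 2 * q ^ m := by ring
  have f8 : 1 - b * (a * q ^ m) = 1 - a * b * q ^ m := by ring
  have f9 : 1 - c * (a * q ^ m) = 1 - a * c * q ^ m := by ring
  have f10 : 1 - d * (a * q ^ m) = 1 - a * d * q ^ m := by ring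
  rw [f1, f2, f3, f4, f5, f6, f7, f8, f9, f10, pow_succ (a * b * c * d / q)]
  exact racah_ratio_aux hq0 ha hb hc hd h0 h1 e2 e3 e4 e5 p2 p3 p4 p5 (by positivity)

/-- Combined with the Pearson equation of the weights, this says that multiplication by φ_k(a)
replaces the parameter a by a q^k in that equation. -/
theorem awBasis_eval_succ (h : RacahRegular q a b c d N) (k m : ℕ) :
    (awBasis q a k).eval (lat (a * q ^ (m + 1))) * (1 - a * (a * q ^ m))
        * (q * (a * q ^ m) - a * q ^ k)
      = (awBasis q a k).eval (lat (a * q ^ m)) * (1 - a * q ^ k * (a * q ^ m))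
        * (q * (a * q ^ m) - a) := by
  have hq0 := h.q_ne_zero
  have ha := h.a_ne_zero
  rw [eval_awBasis_lat _ _ _ (mul_ne_zero ha (pow_ne_zero _ hq0)),
    eval_awBasis_lat _ _ _ (mul_ne_zero ha (pow_ne_zero _ hq0))]
  have h1 : qPoch q (a * (a * q ^ (m + 1))) k * (1 - a * (a * q ^ m))
      = qPoch q (a * (a * q ^ m)) k * (1 - a * q ^ k * (a * q ^ m)) := by
    have e1 := qPoch_succ q (a * (a * q ^ m)) k
    rw [qPoch_succ'] at e1
    rw [show a * (a * q ^ (m + 1)) = a * (a * q ^ m) * q by ring]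
    linear_combination e1
  have h2 : qPoch q (a * (a * q ^ (m + 1))⁻¹) k * (q * (a * q ^ m) - a * q ^ k)
      = qPoch q (a * (a * q ^ m)⁻¹) k * (q * (a * q ^ m) - a) := by
    have e1 := qPoch_succ q (a * (a * q ^ (m + 1))⁻¹) k
    rw [qPoch_succ', show a * (a * q ^ (m + 1))⁻¹ * q = a * (a * q ^ m)⁻¹ by
      rw [pow_succ]; field_simp] at e1
    have e2 : a * (a * q ^ (m + 1))⁻¹ = a * (q * (a * q ^ m))⁻¹ := by
      rw [pow_succ]; congr 2; ring
    have hz : q * (a * q ^ m) ≠ 0 := mul_ne_zero hq0 (mul_ne_zero ha (pow_ne_zero _ hq0))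
    have e3 : q * (a * q ^ m) - a * q ^ k
        = q * (a * q ^ m) * (1 - a * (a * q ^ (m + 1))⁻¹ * q ^ k) := by
      rw [e2]; field_simp
    have e4 : q * (a * q ^ m) - a = q * (a * q ^ m) * (1 - a * (a * q ^ (m + 1))⁻¹) := by
      rw [e2]; field_simp
    rw [e3, e4]
    linear_combination -q * (a * q ^ m) * e1
  linear_combination qPoch q (a * (a * q ^ (m + 1))⁻¹) k * (q * (a * q ^ m) - a * q ^ k) * h1
    + qPoch q (a * (a * q ^ m)) k * (1 - a * q ^ k * (a * q ^ m)) * h2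

end RacahRegular

/-- The one-step defect of the moments, as a function of `z`. -/
def stepDefect (a b c d z : ℂ) : ℂ :=
  (1 - a * b * c * d) * (z + z⁻¹) - (a + b + c + d)
    + (a * b * c + a * b * d + a * c * d + b * c * d)

/-- The splitting of the defect into a difference of two products, each matching one side of a
Pearson equation. Telescoping in the discrete and in the continuous case both rest on it. -/
theorem stepDefect_mul (a b c d : ℂ) {z : ℂ} (hz : z ≠ 0) :
    stepDefect a b c d z * (z * (1 - z ^ 2))
      = (1 - a * z) * (1 - b * z) * (1 - c * z) * (1 - d * z)
        - (z - a) * (z - b) * (z - c) * (z - d) := by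
  unfold stepDefect
  field_simp
  ring

/-- Reduces the moment recurrence to the vanishing of T on φ_k(a) times the defect with a replaced
by a q^k. -/
theorem eval_awBasis_step (q b c d : ℂ) (k : ℕ) (z : ℂ) :
    (1 - a * b * c * d * q ^ k) * (awBasis q a (k + 1)).eval (lat z)
        - (1 - a * b * q ^ k) * (1 - a * c * q ^ k) * (1 - a * d * q ^ k)
          * (awBasis q a k).eval (lat z)
      = -(a * q ^ k) * ((awBasis q a k).eval (lat z) * stepDefect (a * q ^ k) b c d z) := by
  have hL : lat z = (z + z⁻¹) / 2 := rfl
  rw [awBasis_succ, eval_mul]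
  simp only [eval_add, eval_sub, eval_mul, eval_C, eval_X, eval_one]
  generalize (awBasis q a k).eval (lat z) = A
  rw [hL, stepDefect]
  ring

/-- The telescoped partial sum: only the boundary term at the last node m is left. -/
theorem RacahRegular.sum_racahWeight (h : RacahRegular q a b c d N) (k m : ℕ) (hm : m < N) :
    (∑ j ∈ Finset.range (m + 1), racahWeight q a c d N j *
        ((awBasis q a k).eval (lat (a * q ^ j)) * stepDefect (a * q ^ k) b c d (a * q ^ j)))
      * (a * q ^ m * (1 - (a * q ^ m) ^ 2))
    = (1 - a * q ^ k * (a * q ^ m)) * (1 - b * (a * q ^ m)) * (1 - c * (a * q ^ m))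
      * (1 - d * (a * q ^ m)) * (racahWeight q a c d N m
        * (awBasis q a k).eval (lat (a * q ^ m))) := by
  have hq0 := h.q_ne_zero
  have ha := h.a_ne_zero
  induction m with
  | zero =>
    have h1 := stepDefect_mul (a * q ^ k) b c d (z := a * q ^ 0) (by simpa using ha)
    -- The lower boundary term is zero: for k = 0 by its factor a - a q^k, and for k > 0 because
    -- φ_k(a) vanishes at the first node.
    have h2 : (a * q ^ 0 - a * q ^ k) * (awBasis q a k).eval (lat (a * q ^ 0)) = 0 := by
      rcases k with _ | k
      · simp
      · rw [eval_awBasis_lat _ _ _ (by simpa using ha), qPoch_succ' q (a * (a * q ^ 0)⁻¹)]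
        simp [ha]
    rw [Finset.sum_range_one]
    linear_combination racahWeight q a c d N 0 * (awBasis q a k).eval (lat (a * q ^ 0)) * h1
      - racahWeight q a c d N 0 * (a * q ^ 0 - b) * (a * q ^ 0 - c) * (a * q ^ 0 - d) * h2
  | succ m ih =>
    have hm' : m < N := by lia
    have hS := ih hm'
    have hz : a * q ^ m ≠ 0 := mul_ne_zero ha (pow_ne_zero _ hq0)
    have hW := h.racahWeight_succ hm
    have hφ := h.awBasis_eval_succ k m
    have h1 : 1 - a * (a * q ^ m) ≠ 0 := by
      rw [← mul_assoc, ← pow_two]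
      exact sub_ne_zero.2 (h.sq _ (by lia)).symm
    have h2 : q * (a * q ^ m) - a ≠ 0 := by
      rw [show q * (a * q ^ m) - a = a * (q ^ (m + 1) - 1) by ring]
      exact mul_ne_zero ha (sub_ne_zero.2 (pow_ne_one_of_norm_lt_one h.norm_lt m.succ_ne_zero))
    have h3 : 1 - (a * q ^ m) ^ 2 ≠ 0 := by
      rw [mul_pow, ← pow_mul, mul_comm m]
      exact sub_ne_zero.2 (h.sq _ (by lia)).symm
    have hz' : a * q ^ (m + 1) = q * (a * q ^ m) := by ring
    have hE := stepDefect_mul (a * q ^ k) b c d (z := q * (a * q ^ m)) (mul_ne_zero hq0 hz)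
    rw [Finset.sum_range_succ, hz']
    rw [hz'] at hφ
    generalize (awBasis q a k).eval (lat (q * (a * q ^ m))) = A' at hφ ⊢
    generalize ∑ j ∈ Finset.range (m + 1), racahWeight q a c d N j *
        ((awBasis q a k).eval (lat (a * q ^ j)) * stepDefect (a * q ^ k) b c d (a * q ^ j)) = S
        at hS ⊢
    generalize (awBasis q a k).eval (lat (a * q ^ m)) = A at hφ hS
    generalize stepDefect (a * q ^ k) b c d (q * (a * q ^ m)) = E at hE ⊢
    generalize racahWeight q a c d N (m + 1) = w' at hW ⊢
    generalize racahWeight q a c d N m = w at hW hS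
    generalize a * q ^ m = z at *
    generalize a * q ^ k = α at *
    -- The Pearson equation rewrites the boundary term of node m as the negative product in the
    -- defect at node m + 1, so adding that node leaves only the positive product.
    have key : S * (q * z * (1 - (q * z) ^ 2))
        = (q * z - α) * (q * z - b) * (q * z - c) * (q * z - d) * (w' * A') := by
      refine mul_right_cancel₀ (mul_ne_zero (mul_ne_zero h1 h2) h3) ?_
      linear_combination q * (1 - (q * z) ^ 2) * (1 - a * z) * (q * z - a) * hS
        - (q * z - α) * A' * (1 - a * z) * hW
        - q * (1 - q ^ 2 * z ^ 2) * (1 - a * z) * (1 - b * z) * (1 - c * z) * (1 - d * z) * w * hφ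
    linear_combination key + w' * A' * hE

/-- The boundary term at the last node a q^{N-1} contains 1 - ab q^{N-1} = 0. -/
theorem RacahRegular.isAWFunctional (h : RacahRegular q a b c d N) :
    IsAWFunctional q a b c d (L0Linear q a c d N) := by
  have hq0 := h.q_ne_zero
  have ha := h.a_ne_zero
  intro k
  have hN := h.pos
  have hz : a * q ^ (N - 1) ≠ 0 := mul_ne_zero ha (pow_ne_zero _ hq0)
  have h1 := h.sum_racahWeight k (N - 1) (by lia)
  have h2 : 1 - b * (a * q ^ (N - 1)) = 0 := by
    linear_combination -h.ab_mul_pow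
  have h3 : 1 - (a * q ^ (N - 1)) ^ 2 ≠ 0 := by
    rw [mul_pow, ← pow_mul, mul_comm (N - 1)]
    exact sub_ne_zero.2 (h.sq _ (by lia)).symm
  rw [h2, mul_zero, zero_mul, zero_mul, zero_mul, Nat.sub_add_cancel hN] at h1
  have h4 := (mul_eq_zero.1 h1).resolve_right (mul_ne_zero hz h3)
  rw [← sub_eq_zero, L0Linear_apply, L0Linear_apply, Finset.mul_sum, Finset.mul_sum,
    ← Finset.sum_sub_distrib, ← mul_zero (-(a * q ^ k)), ← h4, Finset.mul_sum]
  refine Finset.sum_congr rfl fun j _ => ?_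
  have h5 := eval_awBasis_step (a := a) q b c d k (a * q ^ j)
  linear_combination racahWeight q a c d N j * h5

/-- If T(1) were zero, so would be T(φ_{N-1}(a)). But φ_{N-1}(a) vanishes on all nodes except the
last, where neither its value nor the weight is zero. -/
theorem RacahRegular.L0Linear_one_ne_zero (h : RacahRegular q a b c d N)
    (hac : ∀ k : ℕ, k + 1 < N → a * c * q ^ k ≠ 1) (had : ∀ k : ℕ, k + 1 < N → a * d * q ^ k ≠ 1)
    (he : ∀ k : ℕ, a * b * c * d * q ^ k ≠ 1) : L0Linear q a c d N 1 ≠ 0 := by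
  have hq0 := h.q_ne_zero
  have ha := h.a_ne_zero
  obtain ⟨M, rfl⟩ : ∃ M, N = M + 1 := ⟨N - 1, by have := h.pos; lia⟩
  intro h0
  have h1 := h.isAWFunctional.map_awBasis M
  rw [h0, mul_zero] at h1
  have h2 := (mul_eq_zero.1 h1).resolve_left (qPoch_ne_zero fun k _ => he k)
  rw [L0Linear_apply, Finset.sum_range_succ, Finset.sum_eq_zero, zero_add] at h2
  swap
  · intro j hj
    have hj' := Finset.mem_range.1 hj
    refine mul_eq_zero_of_right _ ?_
    rw [eval_awBasis_lat _ _ _ (mul_ne_zero ha (pow_ne_zero _ hq0))]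
    refine mul_eq_zero_of_right _ (qPoch_eq_zero hj' ?_)
    field_simp
  revert h2
  have hqpow : ∀ k < M, q ^ (-(M : ℤ)) * q ^ k ≠ 1 := fun k hk h0 => by
    rw [zpow_neg, zpow_natCast, inv_mul_eq_one₀ (pow_ne_zero _ hq0)] at h0
    refine pow_ne_one_of_norm_lt_one h.norm_lt (n := M - k) (by lia) ?_
    have : q ^ M = q ^ (M - k) * q ^ k := by rw [← pow_add]; congr 1; lia
    rw [this] at h0
    exact mul_right_cancel₀ (pow_ne_zero k hq0) (h0.trans (one_mul _).symm)
  refine mul_ne_zero ?_ ?_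
  · unfold racahWeight
    refine mul_ne_zero (div_ne_zero ?_ ?_) (div_ne_zero ?_ ?_)
    · refine mul_ne_zero (mul_ne_zero (mul_ne_zero ?_ ?_) ?_) ?_
      · refine qPoch_ne_zero fun k hk => ?_
        have := hqpow k hk
        rwa [show 1 - ((M + 1 : ℕ) : ℤ) = -(M : ℤ) by push_cast; ring]
      · exact qPoch_ne_zero fun k hk => hac k (by lia)
      · exact qPoch_ne_zero fun k hk => had k (by lia)
      · exact qPoch_ne_zero fun k hk => h.sq k (by lia)
    · refine mul_ne_zero (mul_ne_zero (mul_ne_zero (qPoch_self_ne_zero h.norm_lt M) ?_) ?_) ?_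
      · refine qPoch_ne_zero fun k hk => ?_
        rw [mul_assoc, ← pow_add]
        exact h.sq _ (by lia)
      · refine qPoch_ne_zero fun k hk h0 => h.hc k (by lia) ?_
        have := h.c_ne_zero
        field_simp at h0
        rw [pow_succ]
        linear_combination h0
      · refine qPoch_ne_zero fun k hk h0 => h.hd k (by lia) ?_
        have := h.d_ne_zero
        field_simp at h0
        rw [pow_succ]
        linear_combination h0
    · exact sub_ne_zero.2 (h.sq _ (by lia)).symm
    · exact mul_ne_zero (pow_ne_zero _ (mul_ne_zero (mul_ne_zero h.c_ne_zero h.d_ne_zero)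
        (zpow_ne_zero _ hq0))) (sub_ne_zero.2 (by simpa using (h.sq 0 (by lia)).symm))
  · rw [eval_awBasis_lat _ _ _ (mul_ne_zero ha (pow_ne_zero _ hq0))]
    refine mul_ne_zero (qPoch_ne_zero fun k hk => ?_) (qPoch_ne_zero fun k hk => ?_)
    · rw [← mul_assoc, ← pow_two, mul_assoc, ← pow_add]
      exact h.sq _ (by lia)
    · have := hqpow k hk
      rwa [show a * (a * q ^ M)⁻¹ = q ^ (-(M : ℤ)) by
        rw [zpow_neg, zpow_natCast]; field_simp]

/-- The Askey-Wilson polynomials of degree at least `N` vanish on the `q`-Racah nodes. -/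
theorem RacahRegular.L0Linear_monicPoly_mul (h : RacahRegular q a b c d N) {n : ℕ} (hn : N ≤ n)
    (f : ℂ[X]) : L0Linear q a c d N (monicPoly q a b c d n * f) = 0 := by
  have hq0 := h.q_ne_zero
  have ha := h.a_ne_zero
  rw [L0Linear_apply]
  refine Finset.sum_eq_zero fun j hj => mul_eq_zero_of_right _ ?_
  have hj' := Finset.mem_range.1 hj
  rw [eval_mul, monicPoly_eq, eval_mul, eval_finsetSum, Finset.sum_eq_zero, mul_zero, zero_mul]
  intro k hk
  rw [eval_mul, eval_C]
  -- For k < N the coefficient contains the factor 1 - ab q^{N-1}; for k ≥ N the basis element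
  -- contains 1 - q^{-j} q^j at the node j.
  rcases lt_or_ge k N with hkN | hkN
  · refine mul_eq_zero_of_left ?_ _
    unfold monicPolyCoeff
    have : qPoch q (a * b * q ^ k) (n - k) = 0 := by
      refine qPoch_eq_zero (k := N - 1 - k) (by lia) ?_
      rw [mul_assoc, ← pow_add, Nat.add_sub_cancel' (by lia), h.ab_mul_pow]
    rw [this]
    ring
  · refine mul_eq_zero_of_right _ ?_
    rw [eval_awBasis_lat _ _ _ (mul_ne_zero ha (pow_ne_zero _ hq0))]
    refine mul_eq_zero_of_right _ (qPoch_eq_zero (k := j) (by lia) ?_)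
    field_simp

end Racah

end AskeyWilson

end

noncomputable section

namespace AskeyWilson

open Set Filter Topology

/-! ### Infinite products and the q-Pearson equation of the weight. -/

section QInfinite

variable {q r : ℂ}

/-- The infinite `q`-Pochhammer symbol `(x;q)_∞`. -/
def qInf (q x : ℂ) : ℂ := ∏' k : ℕ, (1 - x * q ^ k)

theorem summable_norm_qInf (hq1 : ‖q‖ < 1) (x : ℂ) : Summable fun k : ℕ => ‖-(x * q ^ k)‖ := by
  simpa [norm_mul] using (summable_geometric_of_lt_one (norm_nonneg q) hq1).mul_left ‖x‖

theorem multipliable_qInf (hq1 : ‖q‖ < 1) (x : ℂ) : Multipliable fun k : ℕ => 1 - x * q ^ k := by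
  simpa [sub_eq_add_neg] using multipliable_one_add_of_summable (summable_norm_qInf hq1 x)

theorem qInf_zero_right (q : ℂ) : qInf q 0 = 1 := by simp [qInf]

theorem qInf_eq_mul (hq1 : ‖q‖ < 1) (x : ℂ) : qInf q x = (1 - x) * qInf q (q * x) := by
  unfold qInf
  have h : ∀ k : ℕ, 1 - q * x * q ^ k = 1 - x * q ^ (k + 1) := fun k => by ring
  simp only [h]
  have hm := multipliable_qInf hq1 (q * x)
  simp only [h] at hm
  rw [tprod_eq_zero_mul' (f := fun k : ℕ => 1 - x * q ^ k) hm, pow_zero, mul_one]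

theorem qInf_ne_zero (hq1 : ‖q‖ < 1) {x : ℂ} (h : ∀ k : ℕ, x * q ^ k ≠ 1) : qInf q x ≠ 0 := by
  have := tprod_one_add_ne_zero_of_summable (f := fun k : ℕ => -(x * q ^ k))
    (fun k => by rw [← sub_eq_add_neg]; exact sub_ne_zero.2 (h k).symm) (summable_norm_qInf hq1 x)
  simp only [← sub_eq_add_neg] at this
  exact this

theorem qInf_eq_zero_iff (hq1 : ‖q‖ < 1) {x : ℂ} : qInf q x = 0 ↔ ∃ k : ℕ, x * q ^ k = 1 := by
  refine ⟨fun h => ?_, fun ⟨k, hk⟩ => ?_⟩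
  · by_contra! h'
    exact qInf_ne_zero hq1 h' h
  · exact tprod_of_exists_eq_zero ⟨k, by rw [hk, sub_self]⟩

theorem differentiable_qInf (hq1 : ‖q‖ < 1) : Differentiable ℂ (qInf q) := by
  have h : HasProdLocallyUniformlyOn (fun (k : ℕ) (x : ℂ) => 1 - x * q ^ k) (qInf q) univ := by
    simp_rw [sub_eq_add_neg]
    unfold qInf
    simp_rw [sub_eq_add_neg]
    apply hasProdLocallyUniformlyOn_of_forall_compact isOpen_univ
    intro K _ hcK
    obtain ⟨M, hM⟩ := hcK.exists_bound_of_continuousOn continuousOn_id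
    refine ((summable_geometric_of_lt_one (norm_nonneg q) hq1).mul_left
      M).hasProdUniformlyOn_nat_one_add hcK (.of_forall fun n x hx => ?_) fun _ => by fun_prop
    rw [norm_neg, norm_mul, norm_pow]
    exact mul_le_mul_of_nonneg_right (hM x hx) (by positivity)
  exact differentiableOn_univ.1 (h.differentiableOn (.of_forall fun _ => by
    simpa [Finset.prod_fn] using DifferentiableOn.finsetProd (fun _ _ => by fun_prop)) isOpen_univ)

theorem hProd_lat (hq1 : ‖q‖ < 1) (α : ℂ) {z : ℂ} (hz : z ≠ 0) :
    hProd q (lat z) α = qInf q (α * z) * qInf q (α * z⁻¹) := by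
  unfold qInf hProd
  rw [← (multipliable_qInf hq1 _).tprod_mul (multipliable_qInf hq1 _)]
  refine tprod_congr fun k => ?_
  unfold lat
  field_simp
  ring

/-- Even and odd exponents in (z²;q)_∞ are paired separately, each factor being a difference of
squares. -/
theorem qInf_sq (hr : r ^ 2 = q) (hq1 : ‖q‖ < 1) (z : ℂ) :
    qInf q (1 * z) * qInf q (-1 * z) * qInf q (r * z) * qInf q (-r * z) = qInf q (z ^ 2) := by
  have h1 : qInf q (1 * z) * qInf q (-1 * z) = ∏' k : ℕ, (1 - z ^ 2 * q ^ (2 * k)) := by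
    unfold qInf
    rw [← (multipliable_qInf hq1 _).tprod_mul (multipliable_qInf hq1 _)]
    exact tprod_congr fun k => by ring
  have h2 : qInf q (r * z) * qInf q (-r * z) = ∏' k : ℕ, (1 - z ^ 2 * q ^ (2 * k + 1)) := by
    unfold qInf
    rw [← (multipliable_qInf hq1 _).tprod_mul (multipliable_qInf hq1 _)]
    exact tprod_congr fun k => by rw [pow_succ q (2 * k), ← hr]; ring
  have hm : ∀ x : ℂ, Multipliable fun k : ℕ => 1 - x * q ^ (2 * k) := fun x => by
    have := multipliable_qInf (q := q ^ 2) (by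
      rw [norm_pow]; exact pow_lt_one₀ (norm_nonneg _) hq1 two_ne_zero) x
    simpa only [← pow_mul] using this
  rw [h1, mul_assoc, h2]
  unfold qInf
  refine tprod_even_mul_odd (f := fun k : ℕ => 1 - z ^ 2 * q ^ k) (hm _) ?_
  have := hm (z ^ 2 * q)
  refine this.congr fun k => by ring

/-- The product `(ax, bx, cx, dx; q)_∞`. -/
def qInf₄ (q a b c d x : ℂ) : ℂ :=
  qInf q (a * x) * qInf q (b * x) * qInf q (c * x) * qInf q (d * x)

variable {a b c d : ℂ}

theorem differentiable_qInf₄ (hq1 : ‖q‖ < 1) (a b c d : ℂ) :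
    Differentiable ℂ (qInf₄ q a b c d) := by
  have h := differentiable_qInf hq1
  have h' : ∀ u : ℂ, Differentiable ℂ fun x => qInf q (u * x) := fun u =>
    h.comp (differentiable_id.const_mul u)
  exact (((h' a).mul (h' b)).mul (h' c)).mul (h' d)

theorem qInf₄_eq_mul (hq1 : ‖q‖ < 1) (a b c d x : ℂ) : qInf₄ q a b c d x
    = (1 - a * x) * (1 - b * x) * (1 - c * x) * (1 - d * x) * qInf₄ q a b c d (q * x) := by
  unfold qInf₄
  rw [qInf_eq_mul hq1 (a * x), qInf_eq_mul hq1 (b * x), qInf_eq_mul hq1 (c * x),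
    qInf_eq_mul hq1 (d * x)]
  simp only [mul_left_comm q]
  ring

theorem qInf₄_eq_zero_iff (hq1 : ‖q‖ < 1) {x : ℂ} : qInf₄ q a b c d x = 0 ↔
    ∃ α ∈ ({a, b, c, d} : Set ℂ), ∃ k : ℕ, α * x * q ^ k = 1 := by
  unfold qInf₄
  simp only [mul_eq_zero, qInf_eq_zero_iff hq1, mem_insert_iff, mem_singleton_iff,
    exists_eq_or_imp, exists_eq_left, or_assoc]

theorem qInf₄_inv_eq_zero_iff (hq1 : ‖q‖ < 1) {z : ℂ} (hz : z ≠ 0) :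
    qInf₄ q a b c d z⁻¹ = 0 ↔ z ∈ convergentPoles q a b c d := by
  rw [qInf₄_eq_zero_iff hq1]
  unfold convergentPoles
  refine exists_congr fun α => and_congr_right fun _ => exists_congr fun k => ?_
  rw [show α * z⁻¹ * q ^ k = (α * q ^ k) * z⁻¹ by ring, mul_inv_eq_one₀ hz, eq_comm]

/-- The converse fails for a parameter 0, where 0⁻¹ = 0 puts the origin among the divergent poles.
-/
theorem mem_divergentPoles_of_qInf₄_eq_zero (hq1 : ‖q‖ < 1) {z : ℂ}
    (h : qInf₄ q a b c d z = 0) : z ∈ divergentPoles q a b c d := by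
  obtain ⟨α, hα, k, hk⟩ := (qInf₄_eq_zero_iff hq1).1 h
  refine ⟨α, hα, k, ?_⟩
  rw [← mul_inv]
  refine eq_inv_of_mul_eq_one_left ?_
  rw [← hk]
  ring

/-- The Askey-Wilson weight as a function of `z`. -/
theorem weight_lat (hr : r ^ 2 = q) (hq1 : ‖q‖ < 1) (a b c d : ℂ) {z : ℂ} (hz : z ≠ 0) :
    weight q r a b c d (lat z) = qInf q (z ^ 2) * qInf q (z⁻¹ ^ 2)
      / (qInf₄ q a b c d z * qInf₄ q a b c d z⁻¹) := by
  unfold weight qInf₄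
  rw [← qInf_sq hr hq1 z, ← qInf_sq hr hq1 z⁻¹]
  simp only [hProd_lat hq1 _ hz]
  congr 1 <;> ring

/-- The function whose `q`-difference is the one-step defect times the weight. -/
def stepPrimitive (q a b c d z : ℂ) : ℂ :=
  z⁻¹ * (qInf q (q * z ^ 2) * qInf q (z⁻¹ ^ 2))
    / (qInf₄ q a b c d (q * z) * qInf₄ q a b c d z⁻¹)

/-- The continuous counterpart of the telescoping: `stepDefect_mul` splits the left side into two
terms, and the functional equation of the infinite products identifies them as values of one
function at z and z/q. -/
theorem stepDefect_mul_weight (hr : r ^ 2 = q) (hq0 : q ≠ 0) (hq1 : ‖q‖ < 1) {z : ℂ} (hz : z ≠ 0)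
    (h1 : qInf₄ q a b c d z ≠ 0) (h2 : qInf₄ q a b c d z⁻¹ ≠ 0) :
    stepDefect a b c d z * weight q r a b c d (lat z)
      = stepPrimitive q a b c d z - stepPrimitive q a b c d (z / q) := by
  have hE := stepDefect_mul a b c d hz
  rw [weight_lat hr hq1 a b c d hz]
  unfold stepPrimitive
  have e1 : (z / q)⁻¹ = q * z⁻¹ := by field_simp
  have e2 : q * (z / q) = z := by field_simp
  -- The numerator is quasi-periodic: under z ↦ z/q it changes only by an elementary factor.
  have e3 : qInf q (q * (z / q) ^ 2) * qInf q ((q * z⁻¹) ^ 2)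
      = -(z ^ 2 / q) * (1 - z ^ 2) * (qInf q (q * z ^ 2) * qInf q (q * z⁻¹ ^ 2)) := by
    rw [qInf_eq_mul hq1 (q * (z / q) ^ 2), qInf_eq_mul hq1 (q * z⁻¹ ^ 2),
      show q * (q * (z / q) ^ 2) = z ^ 2 by field_simp, qInf_eq_mul hq1 (z ^ 2),
      show q * (q * z⁻¹ ^ 2) = (q * z⁻¹) ^ 2 by ring]
    field_simp
    ring
  rw [e1, e2, e3, qInf_eq_mul hq1 (z ^ 2), qInf_eq_mul hq1 (z⁻¹ ^ 2)]
  have f1 := qInf₄_eq_mul hq1 a b c d z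
  have f2 := qInf₄_eq_mul hq1 a b c d z⁻¹
  have f3 : (1 - a * z⁻¹) * (1 - b * z⁻¹) * (1 - c * z⁻¹) * (1 - d * z⁻¹)
      = (z - a) * (z - b) * (z - c) * (z - d) / z ^ 4 := by field_simp
  rw [f3] at f2
  rw [f1] at h1
  rw [f2] at h2
  rw [f1, f2]
  generalize qInf₄ q a b c d (q * z) = P1 at *
  generalize qInf₄ q a b c d (q * z⁻¹) = P2 at *
  generalize qInf q (q * z ^ 2) = Q1
  generalize qInf q (q * z⁻¹ ^ 2) = Q2
  generalize (1 - a * z) * (1 - b * z) * (1 - c * z) * (1 - d * z) = A at *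
  generalize (z - a) * (z - b) * (z - c) * (z - d) = B at *
  generalize stepDefect a b c d z = E at *
  have hA : A ≠ 0 := left_ne_zero_of_mul h1
  have hP1 : P1 ≠ 0 := right_ne_zero_of_mul h1
  have hP2 : P2 ≠ 0 := right_ne_zero_of_mul h2
  have hB : B ≠ 0 := by
    rintro rfl
    simp at h2
  field_simp
  linear_combination (z ^ 2 - 1) * Q1 * Q2 * hE

end QInfinite

end AskeyWilson

end

noncomputable section

namespace AskeyWilson

open MeasureTheory Set Filter Topology

/-! ### Scaled contours. -/

section Scaling

variable {γ : ℝ → ℂ}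

theorem IsClosedContour.const_mul (hγ : IsClosedContour γ) (u : ℂ) :
    IsClosedContour fun t => u * γ t := by
  refine ⟨continuousOn_const.mul hγ.continuousOn, by rw [hγ.closed], ?_, ?_⟩
  · obtain ⟨S, hS⟩ := hγ.differentiable
    exact ⟨S, fun t ht htS => (hS t ht htS).const_mul u⟩
  · have : deriv (fun t => u * γ t) = fun t => u * deriv γ t :=
      funext fun t => deriv_const_mul_field u
    rw [this]
    exact hγ.integrable.const_mul u

theorem contourIntegral_comp_const_mul (γ : ℝ → ℂ) (u : ℂ) (f : ℂ → ℂ) :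
    contourIntegral (fun t => u * γ t) f = contourIntegral γ fun z => u * f (u * z) := by
  unfold contourIntegral
  refine intervalIntegral.integral_congr fun t _ => ?_
  simp only [deriv_const_mul_field]
  ring

theorem windingNumber_const_mul (γ : ℝ → ℂ) {u : ℂ} (hu : u ≠ 0) (w : ℂ) :
    windingNumber (fun t => u * γ t) w = windingNumber γ (u⁻¹ * w) := by
  unfold windingNumber
  rw [contourIntegral_comp_const_mul]
  congr 2
  funext z
  rw [show u * z - w = u * (z - u⁻¹ * w) by field_simp, mul_inv, mul_inv_cancel_left₀ hu]

end Scaling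

/-! ### The unit circle and Laurent coefficients. -/

section Circle

/-- The unit circle as a closed contour. -/
def unitContour (t : ℝ) : ℂ := Complex.exp (2 * Real.pi * Complex.I * t)

theorem hasDerivAt_unitContour (t : ℝ) :
    HasDerivAt unitContour (2 * Real.pi * Complex.I * unitContour t) t := by
  unfold unitContour
  have := (((hasDerivAt_id (t : ℂ)).const_mul (2 * Real.pi * Complex.I)).cexp).comp_ofReal
  simpa [mul_comm] using this

theorem unitContour_ne_zero (t : ℝ) : unitContour t ≠ 0 := Complex.exp_ne_zero _

theorem continuous_unitContour : Continuous unitContour :=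
  continuous_iff_continuousAt.2 fun t => (hasDerivAt_unitContour t).continuousAt

theorem isClosedContour_unitContour : IsClosedContour unitContour := by
  refine ⟨continuous_unitContour.continuousOn, ?_,
    ⟨∅, fun t _ _ => (hasDerivAt_unitContour t).differentiableAt⟩, ?_⟩
  · simp [unitContour]
  · have : deriv unitContour = fun t => 2 * Real.pi * Complex.I * unitContour t :=
      funext fun t => (hasDerivAt_unitContour t).deriv
    rw [this]
    exact (continuous_const.mul continuous_unitContour).intervalIntegrable _ _

theorem windingNumber_unitContour : windingNumber unitContour 0 = 1 := by
  unfold windingNumber contourIntegral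
  have : ∀ t : ℝ, (unitContour t - 0)⁻¹ * deriv unitContour t = 2 * Real.pi * Complex.I := by
    intro t
    rw [(hasDerivAt_unitContour t).deriv, sub_zero]
    field_simp [unitContour_ne_zero t]
  simp only [this, intervalIntegral.integral_const]
  rw [sub_zero, one_smul]
  exact inv_mul_cancel₀ Complex.two_pi_I_ne_zero

/-- Closed contours in the punctured plane with the same winding number about the origin yield
the same integrals of functions holomorphic in the punctured plane. -/
theorem contourIntegral_eq_of_punctured {γ₁ γ₂ : ℝ → ℂ} (h₁ : IsClosedContour γ₁)
    (h₂ : IsClosedContour γ₂) (h₁0 : ∀ t ∈ Icc (0 : ℝ) 1, γ₁ t ≠ 0)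
    (h₂0 : ∀ t ∈ Icc (0 : ℝ) 1, γ₂ t ≠ 0) (hw : windingNumber γ₁ 0 = windingNumber γ₂ 0)
    {f : ℂ → ℂ} (hf : ∀ z ≠ 0, DifferentiableAt ℂ f z) :
    contourIntegral γ₁ f = contourIntegral γ₂ f := by
  refine h₁.contourIntegral_eq h₂ (U := {0}ᶜ) isOpen_compl_singleton
    (fun z hz => (hf z hz).differentiableWithinAt) h₁0 h₂0 fun w hw' => ?_
  have : w = 0 := by simpa using hw'
  rw [this, hw]

/-- The scaled circle still winds once about 0, the only possible singularity. -/
theorem contourIntegral_unitContour_scale {u : ℂ} (hu : u ≠ 0) {f : ℂ → ℂ}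
    (hf : ∀ z ≠ 0, DifferentiableAt ℂ f z) :
    contourIntegral unitContour (fun z => u * f (u * z)) = contourIntegral unitContour f := by
  rw [← contourIntegral_comp_const_mul]
  refine contourIntegral_eq_of_punctured (isClosedContour_unitContour.const_mul u)
    isClosedContour_unitContour (fun t _ => mul_ne_zero hu (unitContour_ne_zero t))
    (fun t _ => unitContour_ne_zero t) ?_ hf
  rw [windingNumber_const_mul _ hu, mul_zero]

/-- A continuous function on the unit circle whose Laurent coefficients vanish is zero. -/
theorem eq_zero_of_contourIntegral_zpow_eq_zero {f : ℂ → ℂ} (hf : ∀ z ≠ 0, ContinuousAt f z)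
    (h : ∀ m : ℤ, contourIntegral unitContour (fun z => f z * z ^ (m - 1)) = 0) (t : ℝ) :
    f (unitContour t) = 0 := by
  have : Fact ((0 : ℝ) < 1) := ⟨one_pos⟩
  have hval : ∀ x : ℝ, ((AddCircle.toCircle (x : AddCircle (1 : ℝ)) : Circle) : ℂ)
      = unitContour x := fun x => by
    have := fourier_coe_apply (T := 1) (n := 1) (x := x)
    rw [fourier_one] at this
    rw [this]
    unfold unitContour
    norm_num
  let g : C(AddCircle (1 : ℝ), ℂ) :=
    ⟨fun x => f (AddCircle.toCircle x : ℂ), by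
      refine continuous_iff_continuousAt.2 fun x => ?_
      have h1 : ContinuousAt (fun x : AddCircle (1 : ℝ) => ((AddCircle.toCircle x : Circle) : ℂ)) x :=
        (continuous_subtype_val.comp AddCircle.continuous_toCircle).continuousAt
      exact ContinuousAt.comp (f := fun x : AddCircle (1 : ℝ) => ((AddCircle.toCircle x : Circle) : ℂ))
        (hf _ (Circle.coe_ne_zero _)) h1⟩
  have hcoef : ∀ n, fourierCoeff g n = 0 := by
    intro n
    rw [fourierCoeff_eq_intervalIntegral _ n 0]
    refine smul_eq_zero_of_right _ ?_
    have h1 := h (-n)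
    unfold contourIntegral at h1
    have h2 : ∀ x : ℝ, fourier (-n) (x : AddCircle (1 : ℝ)) • g x
        = (2 * Real.pi * Complex.I)⁻¹ *
          (f (unitContour x) * unitContour x ^ (-n - 1) * deriv unitContour x) := by
      intro x
      have h3 : g x = f (unitContour x) := by
        simp only [g, ContinuousMap.coe_mk, hval]
      have h4 : fourier (-n) (x : AddCircle (1 : ℝ)) = unitContour x ^ (-n) := by
        rw [fourier_coe_apply, unitContour, ← Complex.exp_int_mul]
        congr 1
        push_cast
        ring
      rw [h3, h4, (hasDerivAt_unitContour x).deriv, smul_eq_mul,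
        zpow_sub_one₀ (unitContour_ne_zero x)]
      have h5 := unitContour_ne_zero x
      have h6 := Complex.two_pi_I_ne_zero
      generalize unitContour x ^ (-n) = y
      field_simp
    simp only [h2, zero_add, intervalIntegral.integral_const_mul, h1, mul_zero]
  -- Vanishing coefficients are trivially summable, so the Fourier series represents the continuous
  -- function pointwise.
  have hs := has_pointwise_sum_fourier_series_of_summable (f := g)
    (by rw [show fourierCoeff g = 0 from funext hcoef]; exact summable_zero) (t : AddCircle (1 : ℝ))
  simp only [hcoef, zero_smul] at hs
  have h0 : g (t : AddCircle (1 : ℝ)) = 0 := hs.unique hasSum_zero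
  rw [← hval]
  exact h0

end Circle

/-! ### The constant term of (z², z^{-2};q)_∞. -/

section ConstantTerm

variable {q r : ℂ}

/-- The constant term of `(z², z⁻²; q)_∞` does not vanish. -/
theorem contourIntegral_unitContour_qInf_ne_zero (hr : r ^ 2 = q) (hq0 : q ≠ 0) (hq1 : ‖q‖ < 1) :
    contourIntegral unitContour (fun z => z⁻¹ * (qInf q (z ^ 2) * qInf q (z⁻¹ ^ 2))) ≠ 0 := by
  intro h0
  have hr0 : r ≠ 0 := fun h => hq0 (by rw [← hr, h]; ring)
  have hdq := differentiable_qInf hq1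
  -- Removing the factor 1 - z² from (z², z^{-2};q)_∞ leaves a theta function in z², with F(rz) =
  -- -F(z)/(q z²).
  set F : ℂ → ℂ := fun z => qInf q (q * z ^ 2) * qInf q (z⁻¹ ^ 2) with hF
  have hFd : ∀ z ≠ 0, DifferentiableAt ℂ F z := by
    intro z hz
    have h1 : DifferentiableAt ℂ (fun z : ℂ => q * z ^ 2) z := by fun_prop
    have h2 : DifferentiableAt ℂ (fun z : ℂ => z⁻¹ ^ 2) z := (differentiableAt_inv hz).pow 2
    exact ((hdq _).comp z h1).mul ((hdq _).comp z h2)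
  have hFm : ∀ m : ℤ, ∀ z ≠ 0, DifferentiableAt ℂ (fun z => F z * z ^ (m - 1)) z := fun m z hz =>
    (hFd z hz).mul (differentiableAt_zpow.2 (Or.inl hz))
  set e : ℤ → ℂ := fun m => contourIntegral unitContour fun z => F z * z ^ (m - 1) with he
  -- Quasi-periodicity links the moments e m and e (m - 2); evenness of F removes the odd ones. So
  -- all of them are determined by e 0.
  have hstep : ∀ m, e m = -(q⁻¹ * r ^ m) * e (m - 2) := by
    intro m
    simp only [he]
    rw [← contourIntegral_unitContour_scale hr0 (hFm m), ← contourIntegral_const_mul]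
    refine contourIntegral_congr fun t _ => ?_
    have hz := unitContour_ne_zero t
    generalize unitContour t = z at hz
    have hFr : F (r * z) = -(q⁻¹ * (z ^ 2)⁻¹) * F z := by
      simp only [hF]
      rw [show q * (r * z) ^ 2 = q * (q * z ^ 2) by rw [mul_pow, hr],
        show (r * z)⁻¹ ^ 2 = q⁻¹ * z⁻¹ ^ 2 by rw [mul_inv, mul_pow, inv_pow r, hr],
        qInf_eq_mul hq1 (q * z ^ 2), qInf_eq_mul hq1 (q⁻¹ * z⁻¹ ^ 2), mul_inv_cancel_left₀ hq0]
      field_simp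
      ring
    rw [hFr, mul_zpow, zpow_sub_one₀ hr0, show m - 2 - 1 = m - 1 - 2 by ring, zpow_sub₀ hz (m - 1)]
    generalize z ^ (m - 1) = y
    generalize r ^ m = x
    rw [show (z ^ (2 : ℤ)) = z ^ 2 from rfl]
    field_simp
  have hodd : ∀ m, e m = (-1) ^ m * e m := by
    intro m
    conv_lhs => rw [he]
    simp only
    rw [← contourIntegral_unitContour_scale (neg_ne_zero.2 one_ne_zero) (hFm m)]
    simp only [he]
    rw [← contourIntegral_const_mul]
    refine contourIntegral_congr fun t _ => ?_
    have hFr : ∀ z, F (-1 * z) = F z := fun z => by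
      simp only [hF, neg_mul, one_mul, inv_neg, neg_sq]
    rw [hFr, mul_zpow, zpow_sub_one₀ (neg_ne_zero.2 one_ne_zero) m]
    ring
  -- Restoring the factor 1 - z² gives e 0 - e 2, which is 2 e 0 since e 2 = -e 0.
  have hI : contourIntegral unitContour (fun z => z⁻¹ * (qInf q (z ^ 2) * qInf q (z⁻¹ ^ 2)))
      = e 0 - e 2 := by
    simp only [he]
    rw [← isClosedContour_unitContour.contourIntegral_sub]
    · refine contourIntegral_congr fun t _ => ?_
      have hz := unitContour_ne_zero t
      generalize unitContour t = z at hz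
      rw [qInf_eq_mul hq1 (z ^ 2), zero_sub, zpow_neg_one, show (2 : ℤ) - 1 = 1 by ring, zpow_one]
      simp only [hF]
      field_simp
    all_goals
      rintro _ ⟨t, _, rfl⟩
      exact (hFm _ _ (unitContour_ne_zero t)).continuousAt.continuousWithinAt
  have h2 : e 2 = -e 0 := by
    rw [hstep 2, show (r ^ (2 : ℤ)) = r ^ 2 from rfl, hr, inv_mul_cancel₀ hq0]
    ring_nf
  have he0 : e 0 = 0 := by
    rw [hI, h2] at h0
    linear_combination h0 / 2
  have hall : ∀ m, e m = 0 := by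
    intro m
    rcases Int.even_or_odd' m with ⟨n, rfl | rfl⟩
    · induction n using Int.induction_on with
      | zero => simpa using he0
      | succ n ih =>
        rw [hstep, show 2 * ((n : ℤ) + 1) - 2 = 2 * n by ring, ih, mul_zero]
      | pred n ih =>
        have := hstep (2 * (-(n : ℤ)))
        rw [ih, show 2 * (-(n : ℤ)) - 2 = 2 * (-n - 1) by ring] at this
        exact (mul_eq_zero.1 this.symm).resolve_left (neg_ne_zero.2
          (mul_ne_zero (inv_ne_zero hq0) (zpow_ne_zero _ hr0)))
    · have := hodd (2 * n + 1)
      rw [Odd.neg_one_zpow ⟨n, rfl⟩] at this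
      linear_combination this / 2
  have hz := eq_zero_of_contourIntegral_zpow_eq_zero (fun z hz => (hFd z hz).continuousAt) hall
    (1 / 4)
  -- The contradiction is read off at z = i, where z² = -1: a zero of F there would force a power of
  -- q to be -1.
  have hI4 : unitContour (1 / 4) = Complex.I := by
    refine Eq.trans ?_ Complex.exp_pi_div_two_mul_I
    unfold unitContour
    congr 1
    push_cast
    ring
  rw [hI4] at hz
  simp only [hF, inv_pow, Complex.I_sq] at hz
  rcases mul_eq_zero.1 hz with h | h
  all_goals
    obtain ⟨k, hk⟩ := (qInf_eq_zero_iff hq1).1 h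
  · have h1 : q ^ (2 * (k + 1)) = 1 := by
      rw [pow_mul', pow_succ]
      linear_combination (q * -1 * q ^ k + 1) * hk
    exact pow_ne_one_of_norm_lt_one hq1 (by lia) h1
  · have h1 : q ^ (2 * k) = 1 := by
      rw [pow_mul']
      have : q ^ k = -1 := by linear_combination -hk
      rw [this]
      norm_num
    rcases k.eq_zero_or_pos with rfl | hk0
    · norm_num at hk
    · exact pow_ne_one_of_norm_lt_one hq1 (by lia) h1

end ConstantTerm

end AskeyWilson

end

noncomputable section

namespace AskeyWilson

open MeasureTheory Set Filter Topology

/-! ### The Askey–Wilson functional. -/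

section Functional

variable {q r a b c d : ℂ} {γ : ℝ → ℂ}

theorem SeparatesPoles.qInf₄_ne_zero (hγ : SeparatesPoles q a b c d γ) (hq1 : ‖q‖ < 1) {t : ℝ}
    (ht : t ∈ Icc (0 : ℝ) 1) : qInf₄ q a b c d (γ t) ≠ 0 := fun h =>
  (hγ.avoids t ht).2.2 (mem_divergentPoles_of_qInf₄_eq_zero hq1 h)

theorem SeparatesPoles.qInf₄_inv_ne_zero (hγ : SeparatesPoles q a b c d γ) (hq1 : ‖q‖ < 1) {t : ℝ}
    (ht : t ∈ Icc (0 : ℝ) 1) : qInf₄ q a b c d (γ t)⁻¹ ≠ 0 := fun h =>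
  (hγ.avoids t ht).2.1 ((qInf₄_inv_eq_zero_iff hq1 (hγ.avoids t ht).1).1 h)

/-- The same contour separates the poles after rotating the parameters. -/
theorem SeparatesPoles.rotate (hγ : SeparatesPoles q a b c d γ) : SeparatesPoles q b c d a γ := by
  have h : ({b, c, d, a} : Set ℂ) = {a, b, c, d} := by
    ext x
    simp only [mem_insert_iff, mem_singleton_iff]
    tauto
  have h1 : convergentPoles q b c d a = convergentPoles q a b c d := by
    unfold convergentPoles
    rw [h]
  have h2 : divergentPoles q b c d a = divergentPoles q a b c d := by
    unfold divergentPoles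
    rw [h]
  obtain ⟨g1, g2, g3, g4, g5⟩ := hγ
  exact ⟨g1, by rwa [h1, h2], g3, by rwa [h1], by rwa [h2]⟩

/-- The same contour separates the poles after multiplying a parameter by a power of `q`. -/
theorem SeparatesPoles.mul_pow (hγ : SeparatesPoles q a b c d γ) (k : ℕ) :
    SeparatesPoles q (a * q ^ k) b c d γ := by
  have h1 : convergentPoles q (a * q ^ k) b c d ⊆ convergentPoles q a b c d := by
    rintro z ⟨α, hα, j, rfl⟩
    rcases hα with rfl | hα
    · exact ⟨a, Or.inl rfl, k + j, by ring⟩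
    · exact ⟨α, Or.inr hα, j, rfl⟩
  have h2 : divergentPoles q (a * q ^ k) b c d ⊆ divergentPoles q a b c d := by
    rintro z ⟨α, hα, j, rfl⟩
    rcases hα with rfl | hα
    · exact ⟨a, Or.inl rfl, k + j, by rw [pow_add, mul_inv, mul_inv]; ring⟩
    · exact ⟨α, Or.inr hα, j, rfl⟩
  obtain ⟨g1, g2, g3, g4, g5⟩ := hγ
  exact ⟨g1, fun t ht => ⟨(g2 t ht).1, fun h => (g2 t ht).2.1 (h1 h), fun h => (g2 t ht).2.2 (h2 h)⟩,
    g3, fun w hw => g4 w (h1 hw), fun w hw => g5 w (h2 hw)⟩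

theorem continuousOn_weight_lat (hr : r ^ 2 = q) (hq1 : ‖q‖ < 1)
    (hγ : SeparatesPoles q a b c d γ) :
    ContinuousOn (fun z => weight q r a b c d (lat z)) (γ '' Icc 0 1) := by
  have hinv : ContinuousOn (fun z : ℂ => z⁻¹) (γ '' Icc 0 1) := continuousOn_inv₀.mono (by
    rintro _ ⟨t, ht, rfl⟩
    exact (hγ.avoids t ht).1)
  have hc := (differentiable_qInf hq1).continuous
  have hc4 := (differentiable_qInf₄ hq1 a b c d).continuous
  have h : ContinuousOn (fun z => qInf q (z ^ 2) * qInf q (z⁻¹ ^ 2)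
      / (qInf₄ q a b c d z * qInf₄ q a b c d z⁻¹)) (γ '' Icc 0 1) := by
    refine ContinuousOn.div ?_ ?_ ?_
    · exact (hc.comp (continuous_pow 2)).continuousOn.mul (hc.comp_continuousOn (hinv.pow 2))
    · exact hc4.continuousOn.mul (hc4.comp_continuousOn hinv)
    · rintro _ ⟨t, ht, rfl⟩
      exact mul_ne_zero (hγ.qInf₄_ne_zero hq1 ht) (hγ.qInf₄_inv_ne_zero hq1 ht)
  refine h.congr ?_
  rintro _ ⟨t, ht, rfl⟩
  exact weight_lat hr hq1 a b c d (hγ.avoids t ht).1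

theorem SeparatesPoles.continuousOn_inv (hγ : SeparatesPoles q a b c d γ) :
    ContinuousOn (fun z : ℂ => z⁻¹) (γ '' Icc 0 1) :=
  continuousOn_inv₀.mono (by
    rintro _ ⟨t, ht, rfl⟩
    exact (hγ.avoids t ht).1)

theorem continuousOn_awIntegrand (hr : r ^ 2 = q) (hq1 : ‖q‖ < 1)
    (hγ : SeparatesPoles q a b c d γ) (p : ℂ[X]) :
    ContinuousOn (fun z => p.eval (lat z) * (1 / z) * weight q r a b c d (lat z))
      (γ '' Icc 0 1) := by
  have hinv := hγ.continuousOn_inv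
  have hlat : ContinuousOn lat (γ '' Icc 0 1) := (continuousOn_id.add hinv).div_const 2
  simp only [one_div]
  exact ((p.continuous.comp_continuousOn hlat).mul hinv).mul (continuousOn_weight_lat hr hq1 hγ)

/-- The Askey-Wilson functional as a linear map. -/
def awLinear (hr : r ^ 2 = q) (hq1 : ‖q‖ < 1) (hγ : SeparatesPoles q a b c d γ) :
    ℂ[X] →ₗ[ℂ] ℂ where
  toFun p := awFunctional q r a b c d γ p
  map_add' p s := by
    unfold awFunctional
    rw [← hγ.contour.contourIntegral_add (continuousOn_awIntegrand hr hq1 hγ p)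
      (continuousOn_awIntegrand hr hq1 hγ s)]
    congr 1
    funext z
    rw [eval_add]
    ring
  map_smul' u p := by
    unfold awFunctional
    rw [RingHom.id_apply, smul_eq_mul, ← contourIntegral_const_mul]
    congr 1
    funext z
    rw [eval_smul, smul_eq_mul]
    ring

theorem qInf_eq_qPoch_mul (hq1 : ‖q‖ < 1) (x : ℂ) (k : ℕ) :
    qInf q x = qPoch q x k * qInf q (q ^ k * x) := by
  induction k with
  | zero => simp [qPoch_zero]
  | succ k ih =>
    rw [ih, qPoch_succ, qInf_eq_mul hq1 (q ^ k * x), ← mul_assoc q, ← pow_succ']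
    ring

/-- φ_k(a) cancels the first k factors of the two products with parameter a in the denominator.
Hence every step of the moment recurrence is its first step for shifted parameters. -/
theorem awBasis_mul_weight (hr : r ^ 2 = q) (hq1 : ‖q‖ < 1) (k : ℕ) {z : ℂ} (hz : z ≠ 0)
    (h1 : qInf₄ q a b c d z ≠ 0) (h2 : qInf₄ q a b c d z⁻¹ ≠ 0) :
    (awBasis q a k).eval (lat z) * weight q r a b c d (lat z)
      = weight q r (a * q ^ k) b c d (lat z) := by
  rw [weight_lat hr hq1 _ _ _ _ hz, weight_lat hr hq1 _ _ _ _ hz, eval_awBasis_lat _ _ _ hz]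
  have h : ∀ x, qInf₄ q a b c d x = qPoch q (a * x) k * qInf₄ q (a * q ^ k) b c d x := fun x => by
    unfold qInf₄
    rw [qInf_eq_qPoch_mul hq1 (a * x) k, show q ^ k * (a * x) = a * q ^ k * x by ring]
    ring
  rw [h] at h1 h2
  rw [h, h]
  have k1 := left_ne_zero_of_mul h1
  have k2 := left_ne_zero_of_mul h2
  have k3 := right_ne_zero_of_mul h1
  have k4 := right_ne_zero_of_mul h2
  generalize qPoch q (a * z) k = A at *
  generalize qPoch q (a * z⁻¹) k = B at *
  generalize qInf₄ q (a * q ^ k) b c d z = E at *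
  generalize qInf₄ q (a * q ^ k) b c d z⁻¹ = F at *
  generalize qInf q (z ^ 2) * qInf q (z⁻¹ ^ 2) = G
  field_simp

/-- The integral of the one-step defect against the weight vanishes. -/
theorem contourIntegral_stepDefect_mul_weight (hr : r ^ 2 = q) (hq0 : q ≠ 0) (hq1 : ‖q‖ < 1)
    (hγ : SeparatesPoles q a b c d γ) :
    contourIntegral γ (fun z => z⁻¹ * (stepDefect a b c d z * weight q r a b c d (lat z))) = 0 := by
  have hdq := differentiable_qInf hq1
  have hd4 := differentiable_qInf₄ hq1 a b c d
  set D : ℂ → ℂ := fun z => qInf₄ q a b c d (q * z) * qInf₄ q a b c d z⁻¹ with hD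
  set U : Set ℂ := {0}ᶜ ∩ D ⁻¹' {0}ᶜ with hU
  have hDd : ∀ z ≠ 0, DifferentiableAt ℂ D z := fun z hz =>
    ((hd4 _).comp z (differentiableAt_id.const_mul q)).mul ((hd4 _).comp z (differentiableAt_inv hz))
  have hUo : IsOpen U := ContinuousOn.isOpen_inter_preimage
    (fun z hz => (hDd z hz).continuousAt.continuousWithinAt) isOpen_compl_singleton
    isOpen_compl_singleton
  set f : ℂ → ℂ := fun z => z⁻¹ * stepPrimitive q a b c d z with hf
  have hfd : DifferentiableOn ℂ f U := by
    rintro z ⟨hz, hDz⟩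
    have hz : z ≠ 0 := hz
    have h1 : DifferentiableAt ℂ (fun z : ℂ => qInf q (q * z ^ 2)) z :=
      (hdq _).comp z (f := fun z : ℂ => q * z ^ 2) (by fun_prop)
    have h2 : DifferentiableAt ℂ (fun z : ℂ => qInf q (z⁻¹ ^ 2)) z :=
      (hdq _).comp z ((differentiableAt_inv hz).pow 2)
    exact ((differentiableAt_inv hz).mul (((differentiableAt_inv hz).mul (h1.mul h2)).div (hDd z hz)
      hDz)).differentiableWithinAt
  have hP1 : ∀ t ∈ Icc (0 : ℝ) 1, γ t ∈ U := fun t ht => by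
    refine ⟨(hγ.avoids t ht).1, mul_ne_zero ?_ (hγ.qInf₄_inv_ne_zero hq1 ht)⟩
    have := hγ.qInf₄_ne_zero hq1 ht
    rw [qInf₄_eq_mul hq1] at this
    exact right_ne_zero_of_mul this
  have hP2 : ∀ t ∈ Icc (0 : ℝ) 1, q⁻¹ * γ t ∈ U := fun t ht => by
    refine ⟨mul_ne_zero (inv_ne_zero hq0) (hγ.avoids t ht).1, mul_ne_zero ?_ ?_⟩
    · rw [mul_inv_cancel_left₀ hq0]
      exact hγ.qInf₄_ne_zero hq1 ht
    · have := hγ.qInf₄_inv_ne_zero hq1 ht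
      rw [qInf₄_eq_mul hq1] at this
      rw [mul_inv, inv_inv]
      exact right_ne_zero_of_mul this
  -- The winding number of q^{-1}γ about w is that of γ about qw. At a singularity w ≠ 0, the points
  -- w and qw are both divergent poles or both convergent poles, so the two contours agree there.
  have key : contourIntegral γ f = contourIntegral (fun t => q⁻¹ * γ t) f := by
    refine hγ.contour.contourIntegral_eq (hγ.contour.const_mul q⁻¹) hUo hfd hP1 hP2 fun w hw => ?_
    rw [windingNumber_const_mul _ (inv_ne_zero hq0), inv_inv]
    rcases eq_or_ne w 0 with rfl | hw0
    · rw [mul_zero]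
    have hDw : D w = 0 := by
      by_contra h
      exact hw ⟨hw0, h⟩
    rcases mul_eq_zero.1 hDw with h | h
    · have h' : qInf₄ q a b c d w = 0 := by rw [qInf₄_eq_mul hq1, h, mul_zero]
      rw [hγ.winding_divergent _ (mem_divergentPoles_of_qInf₄_eq_zero hq1 h),
        hγ.winding_divergent _ (mem_divergentPoles_of_qInf₄_eq_zero hq1 h')]
    · have h' : q * w ∈ convergentPoles q a b c d := by
        obtain ⟨α, hα, k, rfl⟩ := (qInf₄_inv_eq_zero_iff hq1 hw0).1 h
        exact ⟨α, hα, k + 1, by ring⟩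
      rw [hγ.winding_convergent _ ((qInf₄_inv_eq_zero_iff hq1 hw0).1 h),
        hγ.winding_convergent _ h']
  rw [contourIntegral_comp_const_mul] at key
  have hc1 : ContinuousOn f (γ '' Icc 0 1) := hfd.continuousOn.mono (image_subset_iff.2 hP1)
  have hc2 : ContinuousOn (fun z => q⁻¹ * f (q⁻¹ * z)) (γ '' Icc 0 1) := by
    refine continuousOn_const.mul (hfd.continuousOn.comp (by fun_prop) ?_)
    rintro _ ⟨t, ht, rfl⟩
    exact hP2 t ht
  rw [← sub_eq_zero, ← hγ.contour.contourIntegral_sub hc1 hc2] at key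
  rw [← key]
  refine contourIntegral_congr fun t ht => ?_
  have hz := (hγ.avoids t ht).1
  rw [stepDefect_mul_weight hr hq0 hq1 hz (hγ.qInf₄_ne_zero hq1 ht) (hγ.qInf₄_inv_ne_zero hq1 ht)]
  simp only [hf]
  rw [div_eq_inv_mul]
  field_simp

theorem awLinear_isAWFunctional (hr : r ^ 2 = q) (hq0 : q ≠ 0) (hq1 : ‖q‖ < 1)
    (hγ : SeparatesPoles q a b c d γ) : IsAWFunctional q a b c d (awLinear hr hq1 hγ) := by
  intro k
  have hlin : ∀ (u v : ℂ) (f g : ℂ[X]), u * awLinear hr hq1 hγ f - v * awLinear hr hq1 hγ g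
      = awLinear hr hq1 hγ (u • f - v • g) := fun u v f g => by
    rw [map_sub, map_smul, map_smul, smul_eq_mul, smul_eq_mul]
  rw [← sub_eq_zero, hlin]
  have h := contourIntegral_stepDefect_mul_weight hr hq0 hq1 (hγ.mul_pow k)
  change awFunctional q r a b c d γ _ = 0
  unfold awFunctional
  rw [← mul_zero (-(a * q ^ k)), ← h, ← contourIntegral_const_mul]
  refine contourIntegral_congr fun t ht => ?_
  have hz := (hγ.avoids t ht).1
  have h1 := awBasis_mul_weight hr hq1 k hz (hγ.qInf₄_ne_zero hq1 ht)
    (hγ.qInf₄_inv_ne_zero hq1 ht)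
  have h2 := eval_awBasis_step (a := a) q b c d k (γ t)
  rw [eval_sub, eval_smul, eval_smul, smul_eq_mul, smul_eq_mul, h2, ← h1]
  ring

theorem awFunctional_rotate : awFunctional q r b c d a γ = awFunctional q r a b c d γ := by
  funext p
  unfold awFunctional weight
  congr 1
  funext z
  congr 2
  ring

/-- The step k = 0 of the recurrence turns the vanishing of T(1) into that of T(φ_1(a)), which is
the total mass for the parameter aq. The result is stated with rotated parameters so that it can be
iterated over all four. -/
theorem awFunctional_one_shift (hr : r ^ 2 = q) (hq0 : q ≠ 0) (hq1 : ‖q‖ < 1)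
    (hγ : SeparatesPoles q a b c d γ) (he : a * b * c * d ≠ 1)
    (h0 : awFunctional q r a b c d γ 1 = 0) : awFunctional q r b c d (a * q) γ 1 = 0 := by
  have h1 := awLinear_isAWFunctional hr hq0 hq1 hγ 0
  have h2 : awLinear hr hq1 hγ 1 = 0 := h0
  rw [awBasis_zero, h2, mul_zero, pow_zero, mul_one] at h1
  have h3 := (mul_eq_zero.1 h1).resolve_left (sub_ne_zero.2 he.symm)
  rw [awFunctional_rotate, ← h3]
  change _ = awFunctional q r a b c d γ _
  unfold awFunctional
  refine contourIntegral_congr fun t ht => ?_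
  have hz := (hγ.avoids t ht).1
  have h4 := awBasis_mul_weight hr hq1 1 hz (hγ.qInf₄_ne_zero hq1 ht)
    (hγ.qInf₄_inv_ne_zero hq1 ht)
  rw [pow_one] at h4
  rw [← h4, eval_one]
  ring

theorem awFunctional_one_shift_all (hr : r ^ 2 = q) (hq0 : q ≠ 0) (hq1 : ‖q‖ < 1)
    (hγ : SeparatesPoles q a b c d γ) (he : ∀ k : ℕ, a * b * c * d * q ^ k ≠ 1)
    (h0 : awFunctional q r a b c d γ 1 = 0) (n : ℕ) :
    SeparatesPoles q (a * q ^ n) (b * q ^ n) (c * q ^ n) (d * q ^ n) γ ∧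
    awFunctional q r (a * q ^ n) (b * q ^ n) (c * q ^ n) (d * q ^ n) γ 1 = 0 := by
  induction n with
  | zero => simpa using ⟨hγ, h0⟩
  | succ n ih =>
    have step : ∀ {a b c d : ℂ}, SeparatesPoles q a b c d γ ∧ awFunctional q r a b c d γ 1 = 0 →
        a * b * c * d ≠ 1 →
        SeparatesPoles q b c d (a * q) γ ∧ awFunctional q r b c d (a * q) γ 1 = 0 :=
      fun {a b c d} h h' => ⟨by simpa using (h.1.mul_pow 1).rotate,
        awFunctional_one_shift hr hq0 hq1 h.1 h' h.2⟩
    simp only [pow_succ, ← mul_assoc]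
    -- Four steps multiply each parameter once by q and restore the order; the products met on the
    -- way are abcd q^{4n}, …, abcd q^{4n+3}.
    refine step (step (step (step ih ?_) ?_) ?_) ?_
    · convert! he (4 * n) using 1; ring
    · convert! he (4 * n + 1) using 1; ring
    · convert! he (4 * n + 2) using 1; ring
    · convert! he (4 * n + 3) using 1; ring

/-- Non-vanishing of the Askey-Wilson integral. -/
theorem awFunctional_one_ne_zero (hr : r ^ 2 = q) (hq0 : q ≠ 0) (hq1 : ‖q‖ < 1)
    (hγ : SeparatesPoles q a b c d γ) (he : ∀ k : ℕ, a * b * c * d * q ^ k ≠ 1) :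
    awFunctional q r a b c d γ 1 ≠ 0 := by
  intro h0
  have hall := awFunctional_one_shift_all hr hq0 hq1 hγ he h0
  have hdq := differentiable_qInf hq1
  set g : ℂ → ℂ := fun z => z⁻¹ * (qInf q (z ^ 2) * qInf q (z⁻¹ ^ 2)) with hg
  have hgd : ∀ z ≠ 0, DifferentiableAt ℂ g z := by
    intro z hz
    exact (differentiableAt_inv hz).mul (((hdq _).comp z (differentiableAt_id.pow 2)).mul
      ((hdq _).comp z ((differentiableAt_inv hz).pow 2)))
  have hne : contourIntegral γ g ≠ 0 := by
    rw [contourIntegral_eq_of_punctured hγ.contour isClosedContour_unitContour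
      (fun t ht => (hγ.avoids t ht).1) (fun t _ => unitContour_ne_zero t)
      (by rw [hγ.winding_zero, windingNumber_unitContour]) hgd]
    exact contourIntegral_unitContour_qInf_ne_zero hr hq0 hq1
  -- As n → ∞ the denominators with parameters multiplied by q^n tend to 1, so integrals that are
  -- all zero converge to the integral of `g`.
  refine hne (tendsto_nhds_unique ?_ (tendsto_const_nhds (x := (0 : ℂ)) (f := (atTop : Filter ℕ))))
  obtain ⟨R, hR⟩ := hγ.contour.isCompact_image.exists_bound_of_continuousOn continuousOn_id
  obtain ⟨R', hR'⟩ := hγ.contour.isCompact_image.exists_bound_of_continuousOn hγ.continuousOn_inv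
  have hqn : Tendsto (fun n : ℕ => q ^ n) atTop (𝓝 0) := tendsto_pow_atTop_nhds_zero_of_norm_lt_one hq1
  have hP0 : qInf₄ q a b c d 0 = 1 := by simp [qInf₄, qInf_zero_right]
  have hP : ∀ n : ℕ, ∀ x, qInf₄ q (a * q ^ n) (b * q ^ n) (c * q ^ n) (d * q ^ n) x
      = qInf₄ q a b c d (q ^ n * x) := fun n x => by
    unfold qInf₄
    simp only [mul_assoc]
  have hcont : ContinuousAt (fun x => (qInf₄ q a b c d x)⁻¹) 0 :=
    (differentiable_qInf₄ hq1 a b c d).continuous.continuousAt.inv₀ (by rw [hP0]; exact one_ne_zero)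
  have hlim : ∀ x, Tendsto (fun n : ℕ => (qInf₄ q a b c d (q ^ n * x))⁻¹) atTop (𝓝 1) := by
    intro x
    have h1 : Tendsto (fun n : ℕ => q ^ n * x) atTop (𝓝 0) := by simpa using hqn.mul_const x
    have h2 := hcont.tendsto.comp h1
    rw [hP0, inv_one] at h2
    exact h2
  -- For large n each of the two reciprocal denominators is at most 2 on the whole contour; this
  -- gives the dominating constant 4.
  obtain ⟨δ, hδ, hbound⟩ : ∃ δ > 0, ∀ x : ℂ, ‖x‖ < δ → ‖(qInf₄ q a b c d x)⁻¹‖ ≤ 2 := by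
    have h1 : ∀ᶠ x in 𝓝 (0 : ℂ), ‖(qInf₄ q a b c d x)⁻¹‖ < 2 :=
      hcont.norm.eventually_lt_const (by simp [hP0])
    obtain ⟨δ, hδ, h⟩ := Metric.eventually_nhds_iff.1 h1
    exact ⟨δ, hδ, fun x hx => (h (by simpa using hx)).le⟩
  have hsmall : ∀ᶠ n : ℕ in atTop, ‖q ^ n‖ * (|R| + |R'|) < δ := by
    have h1 : Tendsto (fun n : ℕ => ‖q ^ n‖ * (|R| + |R'|)) atTop (𝓝 0) := by
      simpa using hqn.norm.mul_const (|R| + |R'|)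
    exact h1.eventually_lt_const hδ
  have hval : ∀ n : ℕ, ∀ t ∈ Icc (0 : ℝ) 1,
      (1 : ℂ[X]).eval (lat (γ t)) * (1 / γ t)
        * weight q r (a * q ^ n) (b * q ^ n) (c * q ^ n) (d * q ^ n) (lat (γ t))
      = g (γ t) * ((qInf₄ q a b c d (q ^ n * γ t))⁻¹ * (qInf₄ q a b c d (q ^ n * (γ t)⁻¹))⁻¹) := by
    intro n t ht
    rw [weight_lat hr hq1 _ _ _ _ (hγ.avoids t ht).1, hP, hP, eval_one, hg]
    simp only [div_eq_mul_inv, mul_inv]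
    ring
  have hsub : ∀ t ∈ Set.uIoc (0 : ℝ) 1, t ∈ Icc (0 : ℝ) 1 := fun t ht => by
    rw [uIoc_of_le zero_le_one] at ht
    exact Ioc_subset_Icc_self ht
  have hgc : ContinuousOn g (γ '' Icc 0 1) := by
    rintro _ ⟨t, ht, rfl⟩
    exact (hgd _ (hγ.avoids t ht).1).continuousAt.continuousWithinAt
  have hconv : Tendsto (fun n : ℕ => awFunctional q r (a * q ^ n) (b * q ^ n) (c * q ^ n)
      (d * q ^ n) γ 1) atTop (𝓝 (contourIntegral γ g)) := by
    unfold awFunctional contourIntegral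
    refine intervalIntegral.tendsto_integral_filter_of_dominated_convergence
      (fun t => ‖g (γ t) * deriv γ t‖ * 4) ?_ ?_ ?_ ?_
    · refine Eventually.of_forall fun n => ?_
      have := hγ.contour.intervalIntegrable_comp_mul
        (continuousOn_awIntegrand hr hq1 (hall n).1 1)
      exact (intervalIntegrable_iff.1 this).aestronglyMeasurable
    · filter_upwards [hsmall] with n hn
      refine Eventually.of_forall fun t ht => ?_
      have ht' := hsub t ht
      have h1 : ‖γ t‖ ≤ |R| + |R'| :=
        ((hR _ (mem_image_of_mem γ ht')).trans (le_abs_self R)).trans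
          (le_add_of_nonneg_right (abs_nonneg _))
      have h2 : ‖(γ t)⁻¹‖ ≤ |R| + |R'| :=
        ((hR' _ (mem_image_of_mem γ ht')).trans (le_abs_self R')).trans
          (le_add_of_nonneg_left (abs_nonneg _))
      have h3 := hbound (q ^ n * γ t) (by
        rw [norm_mul]; exact (mul_le_mul_of_nonneg_left h1 (norm_nonneg _)).trans_lt hn)
      have h4 := hbound (q ^ n * (γ t)⁻¹) (by
        rw [norm_mul]; exact (mul_le_mul_of_nonneg_left h2 (norm_nonneg _)).trans_lt hn)
      rw [hval n t ht', mul_right_comm, norm_mul (g (γ t) * deriv γ t), norm_mul (_)⁻¹]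
      refine mul_le_mul_of_nonneg_left ?_ (norm_nonneg _)
      calc _ ≤ (2 : ℝ) * 2 := mul_le_mul h3 h4 (norm_nonneg _) zero_le_two
        _ = 4 := by norm_num
    · exact (hγ.contour.intervalIntegrable_comp_mul hgc).norm.mul_const 4
    · refine Eventually.of_forall fun t ht => ?_
      have ht' := hsub t ht
      have h1 := (((hlim (γ t)).mul (hlim (γ t)⁻¹)).const_mul (g (γ t))).mul_const (deriv γ t)
      rw [mul_one, mul_one] at h1
      exact h1.congr fun n => (congrArg (· * deriv γ t) (hval n t ht')).symm
  simpa only [(hall _).2] using hconv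

end Functional

end AskeyWilson

end

noncomputable section

namespace AskeyWilson

/-! ### Uniqueness of orthogonal systems. -/

section Uniqueness

variable {p : ℕ → ℂ[X]} {B : ℂ[X] → ℂ[X] →ₗ[ℂ] ℂ}

theorem degree_sub_C_mul_lt {f g : ℂ[X]} {n : ℕ} (hf : f.degree ≤ n) (hg : g.degree = n)
    (hm : g.Monic) : (f - C (f.coeff n) * g).degree < n := by
  have hle : (f - C (f.coeff n) * g).degree ≤ n :=
    (degree_sub_le _ _).trans (max_le hf (by
      rw [← smul_eq_C_mul]
      exact (degree_smul_le _ _).trans hg.le))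
  refine lt_of_le_of_ne hle fun h => ?_
  have h1 := coeff_ne_zero_of_eq_degree h
  have h2 : g.coeff n = 1 := by
    rw [← natDegree_eq_of_degree_eq_some hg]
    exact hm
  rw [coeff_sub, coeff_C_mul, h2, mul_one, sub_self] at h1
  exact h1 rfl

/-- Nondegeneracy on polynomials of bounded degree: pairing with the top p_n isolates the leading
coefficient, since its norm is nonzero. -/
theorem eq_zero_of_orthogonal (hdeg : ∀ n, (p n).degree = n) (hm : ∀ n, (p n).Monic)
    (horth : ∀ n m, n ≠ m → B (p n) (p m) = 0) (hne : ∀ n, B (p n) (p n) ≠ 0) (n : ℕ) :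
    ∀ f : ℂ[X], f.degree < n → (∀ m < n, B (p m) f = 0) → f = 0 := by
  induction n with
  | zero =>
    intro f hf _
    rwa [Nat.cast_zero, ← not_le, zero_le_degree_iff, not_not] at hf
  | succ n ih =>
    intro f hf hB
    have hf' : f.degree ≤ n := by
      rw [degree_le_iff_coeff_zero]
      intro m hm
      exact (degree_lt_iff_coeff_zero f (n + 1)).1 hf m (by exact_mod_cast hm)
    have hlin : ∀ m, B (p m) (C (f.coeff n) * p n) = f.coeff n * B (p m) (p n) := fun m => by
      rw [← smul_eq_C_mul, map_smul, smul_eq_mul]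
    have h := ih (f - C (f.coeff n) * p n) (degree_sub_C_mul_lt hf' (hdeg n) (hm n))
      fun m hmn => by rw [map_sub, hB m (by lia), hlin, horth m n hmn.ne, mul_zero, sub_zero]
    rw [sub_eq_zero] at h
    have h1 := hB n (by lia)
    rw [h, hlin] at h1
    rw [h, (mul_eq_zero.1 h1).resolve_right (hne n), C_0, zero_mul]

/-- An orthogonal polynomial system for a symmetric form is unique up to constants. -/
theorem exists_eq_C_mul_of_orthogonal (hsymm : ∀ f g, B f g = B g f)
    (hdeg : ∀ n, (p n).degree = n) (hm : ∀ n, (p n).Monic)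
    (horth : ∀ n m, n ≠ m → B (p n) (p m) = 0) (hne : ∀ n, B (p n) (p n) ≠ 0)
    {P : ℕ → ℂ[X]} (hP : ∀ n, (P n).degree = n) (hPorth : ∀ n m, n ≠ m → B (P n) (P m) = 0)
    (n : ℕ) : ∃ κ : ℂ, κ ≠ 0 ∧ P n = C κ * p n := by
  induction n using Nat.strong_induction_on with
  | _ n ih =>
    refine ⟨(P n).coeff n, coeff_ne_zero_of_eq_degree (hP n), ?_⟩
    rw [← sub_eq_zero]
    refine eq_zero_of_orthogonal hdeg hm horth hne n _
      (degree_sub_C_mul_lt (hP n).le (hdeg n) (hm n)) fun m hmn => ?_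
    obtain ⟨κ, hκ, h⟩ := ih m hmn
    have h1 := hPorth n m hmn.ne'
    rw [h, ← smul_eq_C_mul, map_smul, smul_eq_mul, hsymm] at h1
    rw [map_sub, (mul_eq_zero.1 h1).resolve_left hκ, ← smul_eq_C_mul, map_smul,
      horth m n hmn.ne, smul_zero, sub_zero]

end Uniqueness

theorem mul_pow_ne_one_of_gammaCoeff_ne_zero {q a b c d : ℂ} {m : ℕ}
    (h : gammaCoeff q a b c d (m + 1) ≠ 0) :
    (a * b * q ^ m ≠ 1 ∧ a * c * q ^ m ≠ 1 ∧ a * d * q ^ m ≠ 1) ∧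
      b * c * q ^ m ≠ 1 ∧ b * d * q ^ m ≠ 1 ∧ c * d * q ^ m ≠ 1 := by
  have hA : coeffA q a b c d m ≠ 0 := fun h' => h (by simp [gammaCoeff, h'])
  have hC : coeffC q a b c d (m + 1) ≠ 0 := fun h' => h (by simp [gammaCoeff, h'])
  refine ⟨?_, ?_⟩
  · rcases m with _ | m
    · refine ⟨fun h' => hA ?_, fun h' => hA ?_, fun h' => hA ?_⟩ <;>
        rw [pow_zero, mul_one] at h' <;> simp [coeffA, h']
    · refine ⟨fun h' => hA ?_, fun h' => hA ?_, fun h' => hA ?_⟩ <;> simp [coeffA, h']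
  · refine ⟨fun h' => hC ?_, fun h' => hC ?_, fun h' => hC ?_⟩ <;> simp [coeffC, h']

/-- The Sobolev-type form as a linear functional of its second argument. -/
def sobolevLinear {q r a b c d : ℂ} {N : ℕ} {γ : ℝ → ℂ} (hr : r ^ 2 = q) (hq1 : ‖q‖ < 1)
    (hγ : SeparatesPoles q (a * r ^ N) (b * r ^ N) (c * r ^ N) (d * r ^ N) γ) (f : ℂ[X]) :
    ℂ[X] →ₗ[ℂ] ℂ :=
  L0Linear q a c d N ∘ₗ LinearMap.mulLeft ℂ f
    + awLinear hr hq1 hγ ∘ₗ LinearMap.mulLeft ℂ ((awDiff r)^[N] f) ∘ₗ awDiff r ^ N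

/-! ### The two blocks of the Sobolev form. -/

section Form

variable {q r a b c d : ℂ} {N : ℕ} {γ : ℝ → ℂ}

theorem abcd_mul_pow_ne_one (hr : r ^ 2 = q) (he : ∀ k : ℕ, a * b * c * d * q ^ k ≠ 1) (N k : ℕ) :
    a * r ^ N * (b * r ^ N) * (c * r ^ N) * (d * r ^ N) * q ^ k ≠ 1 := by
  convert! he (2 * N + k) using 1
  rw [← hr]
  ring

theorem sobolevLinear_apply (hr : r ^ 2 = q) (hq1 : ‖q‖ < 1)
    (hγ : SeparatesPoles q (a * r ^ N) (b * r ^ N) (c * r ^ N) (d * r ^ N) γ) (f g : ℂ[X]) :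
    sobolevLinear hr hq1 hγ f g = L0Linear q a c d N (f * g)
      + awLinear hr hq1 hγ ((awDiff r)^[N] f * (awDiff r)^[N] g) := by
  simp [sobolevLinear, Module.End.pow_apply]

theorem sobolevForm_eq (hr : r ^ 2 = q) (hq0 : q ≠ 0) (hq1 : ‖q‖ < 1) (ha : a ≠ 0)
    (hγ : SeparatesPoles q (a * r ^ N) (b * r ^ N) (c * r ^ N) (d * r ^ N) γ) (f g : ℂ[X]) :
    sobolevForm q r a b c d N γ f g = sobolevLinear hr hq1 hγ f g := by
  rw [sobolevLinear_apply, ← L0_eq_L0Linear hq0 ha]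
  rfl

theorem sobolevLinear_symm (hr : r ^ 2 = q) (hq1 : ‖q‖ < 1)
    (hγ : SeparatesPoles q (a * r ^ N) (b * r ^ N) (c * r ^ N) (d * r ^ N) γ) (f g : ℂ[X]) :
    sobolevLinear hr hq1 hγ f g = sobolevLinear hr hq1 hγ g f := by
  rw [sobolevLinear_apply, sobolevLinear_apply, mul_comm f, mul_comm ((awDiff r)^[N] f)]

/-- None of the denominators in the weights needs a hypothesis of its own: ab q^{N-1} = 1 turns each
condition into one on a², on b², or on a factor of some γ_m with m < N. -/
theorem racahRegular_of_gammaCoeff_ne_zero (hq0 : q ≠ 0) (hq1 : ‖q‖ < 1) (hN : 1 ≤ N)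
    (hab : a * b = q ^ (1 - (N : ℤ))) (hc : c ≠ 0) (hd : d ≠ 0)
    (ha2 : ∀ k : ℕ, k < N → a ^ 2 ≠ q ^ (-(k : ℤ)))
    (hb2 : ∀ k : ℕ, k < N → b ^ 2 ≠ q ^ (-(k : ℤ)))
    (hγne : ∀ m : ℕ, m + 1 ≠ N → gammaCoeff q a b c d (m + 1) ≠ 0) :
    RacahRegular q a b c d N := by
  obtain ⟨M, rfl⟩ : ∃ M, N = M + 1 := ⟨N - 1, by lia⟩
  have hab' : a * b * q ^ M = 1 := by
    rw [hab, show (1 : ℤ) - ((M + 1 : ℕ) : ℤ) = -(M : ℤ) by push_cast; ring]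
    rw [zpow_neg, zpow_natCast, inv_mul_cancel₀ (pow_ne_zero M hq0)]
  have hpow : ∀ {x : ℂ} {k : ℕ}, x * q ^ k = 1 → x = q ^ (-(k : ℤ)) := fun {x k} h => by
    rw [zpow_neg, zpow_natCast]
    exact eq_inv_of_mul_eq_one_left h
  -- If a q^{k+1} = x, then b x q^{M-k-1} = ab q^M = 1.
  have hend : ∀ x : ℂ, (∀ m : ℕ, m < M → b * x * q ^ m ≠ 1) →
      ∀ k : ℕ, k + 1 < M + 1 → a * q ^ (k + 1) ≠ x := by
    rintro x hx k hk rfl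
    obtain ⟨i, rfl⟩ := Nat.exists_eq_add_of_lt (show k < M by lia)
    refine hx i (by lia) ?_
    rw [← hab']
    ring
  refine ⟨hq0, hq1, hN, hab, hc, hd, fun m hm h => ?_,
    hend c fun m hm => (mul_pow_ne_one_of_gammaCoeff_ne_zero (hγne m (by lia))).2.1,
    hend d fun m hm => (mul_pow_ne_one_of_gammaCoeff_ne_zero (hγne m (by lia))).2.2.1⟩
  rcases lt_or_ge m (M + 1) with hmM | hmM
  · exact ha2 m hmM (hpow h)
  -- For m ≥ N the condition passes to b², since (ab q^M)² = 1 with M = N - 1.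
  · obtain ⟨i, hi⟩ : ∃ i, m + i = 2 * M := ⟨2 * M - m, by lia⟩
    refine hb2 i (by lia) (hpow ?_)
    calc b ^ 2 * q ^ i = (a ^ 2 * q ^ m) * (b ^ 2 * q ^ i) := by rw [h, one_mul]
      _ = a ^ 2 * b ^ 2 * q ^ (m + i) := by ring
      _ = (a * b * q ^ M) ^ 2 := by rw [hi]; ring
      _ = 1 := by rw [hab', one_pow]

theorem sobolevLinear_monicPoly_of_lt (hr0 : r ≠ 0) (hr : r ^ 2 = q) (hq1 : ‖q‖ < 1) (ha : a ≠ 0)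
    (he : ∀ k : ℕ, a * b * c * d * q ^ k ≠ 1)
    (hγ : SeparatesPoles q (a * r ^ N) (b * r ^ N) (c * r ^ N) (d * r ^ N) γ) {n : ℕ} (hn : n < N)
    (f : ℂ[X]) : sobolevLinear hr hq1 hγ (monicPoly q a b c d n) f
      = L0Linear q a c d N (monicPoly q a b c d n * f) := by
  rw [sobolevLinear_apply, (awDiff_iterate_monicPoly hr0 hr hq1 N ha he n).1 hn, zero_mul, map_zero,
    add_zero]

theorem sobolevLinear_monicPoly_of_le (hr : r ^ 2 = q) (hq1 : ‖q‖ < 1)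
    (hR : RacahRegular q a b c d N)
    (hγ : SeparatesPoles q (a * r ^ N) (b * r ^ N) (c * r ^ N) (d * r ^ N) γ) {n : ℕ} (hn : N ≤ n)
    (f : ℂ[X]) : sobolevLinear hr hq1 hγ (monicPoly q a b c d n) f
      = awLinear hr hq1 hγ ((awDiff r)^[N] (monicPoly q a b c d n) * (awDiff r)^[N] f) := by
  rw [sobolevLinear_apply, hR.L0Linear_monicPoly_mul hn, zero_add]

/-- When the two degrees lie on different sides of N, the larger one kills L_0 and the smaller one
kills L_N; otherwise a single functional is left and its orthogonality applies. -/
theorem sobolevLinear_monicPoly_of_gt (hr0 : r ≠ 0) (hr : r ^ 2 = q) (hq1 : ‖q‖ < 1)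
    (hR : RacahRegular q a b c d N) (he : ∀ k : ℕ, a * b * c * d * q ^ k ≠ 1)
    (hγ : SeparatesPoles q (a * r ^ N) (b * r ^ N) (c * r ^ N) (d * r ^ N) γ) {n m : ℕ}
    (hmn : m < n) :
    sobolevLinear hr hq1 hγ (monicPoly q a b c d n) (monicPoly q a b c d m) = 0 := by
  have hq0 := hR.q_ne_zero
  have ha := hR.a_ne_zero
  have hb := hR.b_ne_zero
  rcases lt_or_ge n N with hn | hn
  · rw [sobolevLinear_monicPoly_of_lt hr0 hr hq1 ha he hγ hn]
    refine hR.isAWFunctional.map_monicPoly_mul_of_degree_lt hq0 hq1 ha hb he ?_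
    rw [(monicPoly_degree_and_monic hq0 hq1 ha he m).1]
    exact_mod_cast hmn
  rw [sobolevLinear_monicPoly_of_le hr hq1 hR hγ hn]
  rcases lt_or_ge m N with hm | hm
  · rw [(awDiff_iterate_monicPoly hr0 hr hq1 N ha he m).1 hm, mul_zero, map_zero]
  obtain ⟨κ, -, h1⟩ := (awDiff_iterate_monicPoly hr0 hr hq1 N ha he n).2 hn
  obtain ⟨κ', -, h2⟩ := (awDiff_iterate_monicPoly hr0 hr hq1 N ha he m).2 hm
  have he' := abcd_mul_pow_ne_one hr he N
  have har : a * r ^ N ≠ 0 := mul_ne_zero ha (pow_ne_zero _ hr0)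
  rw [h1, h2, mul_mul_mul_comm, ← C_mul, ← smul_eq_C_mul,
    map_smul, (awLinear_isAWFunctional hr hq0 hq1 hγ).map_monicPoly_mul_of_degree_lt hq0 hq1 har
      (mul_ne_zero hb (pow_ne_zero _ hr0)) he', smul_zero]
  rw [(monicPoly_degree_and_monic hq0 hq1 har he' _).1]
  exact_mod_cast (show m - N < n - N by lia)

theorem sobolevLinear_monicPoly_self_ne_zero (hr0 : r ≠ 0) (hr : r ^ 2 = q) (hq1 : ‖q‖ < 1)
    (hR : RacahRegular q a b c d N) (he : ∀ k : ℕ, a * b * c * d * q ^ k ≠ 1)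
    (hγ : SeparatesPoles q (a * r ^ N) (b * r ^ N) (c * r ^ N) (d * r ^ N) γ)
    (hγne : ∀ m : ℕ, m + 1 ≠ N → gammaCoeff q a b c d (m + 1) ≠ 0) (n : ℕ) :
    sobolevLinear hr hq1 hγ (monicPoly q a b c d n) (monicPoly q a b c d n) ≠ 0 := by
  have hq0 := hR.q_ne_zero
  have ha := hR.a_ne_zero
  have hb := hR.b_ne_zero
  have hrN := pow_ne_zero N hr0
  have hfac := fun m hm => mul_pow_ne_one_of_gammaCoeff_ne_zero (hγne m hm)
  rcases lt_or_ge n N with hn | hn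
  · rw [sobolevLinear_monicPoly_of_lt hr0 hr hq1 ha he hγ hn]
    have hfac' := fun k (hk : k < n) => hfac k (by lia)
    exact hR.isAWFunctional.map_monicPoly_mul_self hq0 hq1 ha hb hR.c_ne_zero hR.d_ne_zero he
      (hR.L0Linear_one_ne_zero (fun k hk => (hfac k (by lia)).1.2.1)
        (fun k hk => (hfac k (by lia)).1.2.2) he)
      (fun k hk => (hfac' k hk).1.1) (fun k hk => (hfac' k hk).1.2.1)
      (fun k hk => (hfac' k hk).1.2.2) (fun k hk => (hfac' k hk).2.1)
      (fun k hk => (hfac' k hk).2.2.1) (fun k hk => (hfac' k hk).2.2.2)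
  · rw [sobolevLinear_monicPoly_of_le hr hq1 hR hγ hn]
    obtain ⟨κ, hκ, h1⟩ := (awDiff_iterate_monicPoly hr0 hr hq1 N ha he n).2 hn
    have he' := abcd_mul_pow_ne_one hr he N
    have hpair : ∀ {x y : ℂ} (k : ℕ), x * y * q ^ (N + k) ≠ 1 →
        x * r ^ N * (y * r ^ N) * q ^ k ≠ 1 := fun {x y} k h => by
      convert! h using 1
      rw [← hr]
      ring
    have hfac' := fun k => hfac (N + k) (by lia)
    -- The factor responsible for γ_N = 0 is harmless after the shift: ab q^{N+k} = q^{k+1}. The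
    -- other factors belong to γ_{N+k+1}, whose index exceeds N.
    have hab : ∀ k, a * b * q ^ (N + k) ≠ 1 := fun k => by
      rw [hR.ab, ← zpow_natCast, ← zpow_add₀ hq0,
        show 1 - (N : ℤ) + ((N + k : ℕ) : ℤ) = ((k + 1 : ℕ) : ℤ) by push_cast; ring, zpow_natCast]
      exact pow_ne_one_of_norm_lt_one hq1 k.succ_ne_zero
    rw [h1, mul_mul_mul_comm, ← C_mul, ← smul_eq_C_mul, map_smul]
    refine smul_ne_zero (mul_ne_zero hκ hκ) ?_
    exact (awLinear_isAWFunctional hr hq0 hq1 hγ).map_monicPoly_mul_self hq0 hq1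
      (mul_ne_zero ha hrN) (mul_ne_zero hb hrN) (mul_ne_zero hR.c_ne_zero hrN)
      (mul_ne_zero hR.d_ne_zero hrN) he' (awFunctional_one_ne_zero hr hq0 hq1 hγ he')
      (fun k _ => hpair k (hab k)) (fun k _ => hpair k (hfac' k).1.2.1)
      (fun k _ => hpair k (hfac' k).1.2.2) (fun k _ => hpair k (hfac' k).2.1)
      (fun k _ => hpair k (hfac' k).2.2.1) (fun k _ => hpair k (hfac' k).2.2.2)

end Form

end AskeyWilson

end

theorem mainTheorem3 (q r a b c d : ℂ) (N : ℕ)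
    (hq0 : q ≠ 0) (hq1 : ‖q‖ < 1) (hr : r ^ 2 = q)
    (hab : a * b = q ^ (1 - (N : ℤ))) (hc : c ≠ 0) (hd : d ≠ 0)
    (habcd : a * b * c * d ∉ AskeyWilson.Omega q)
    (ha2 : ∀ k : ℕ, k < N → a ^ 2 ≠ q ^ (-(k : ℤ)))
    (hb2 : ∀ k : ℕ, k < N → b ^ 2 ≠ q ^ (-(k : ℤ)))
    (hLam : AskeyWilson.Lam q a b c d = {N})
    (γ : ℝ → ℂ)
    (hγ : AskeyWilson.SeparatesPoles q (a * r ^ N) (b * r ^ N) (c * r ^ N) (d * r ^ N) γ) :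
    AskeyWilson.IsOPS (AskeyWilson.sobolevForm q r a b c d N γ)
        (AskeyWilson.monicPoly q a b c d) ∧
      (∀ n, (AskeyWilson.monicPoly q a b c d n).Monic) ∧
      ∀ P : ℕ → Polynomial ℂ, (∀ n, (P n).degree = n) →
        (∀ n m, n ≠ m → AskeyWilson.sobolevForm q r a b c d N γ (P n) (P m) = 0) →
        ∀ n, ∃ κ : ℂ, κ ≠ 0 ∧ P n = Polynomial.C κ * AskeyWilson.monicPoly q a b c d n := by
  -- Membership of N in Λ is also the source of 1 ≤ N.
  have hN : N ∈ AskeyWilson.Lam q a b c d := by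
    rw [hLam]
    exact Set.mem_singleton N
  have hγne : ∀ m : ℕ, m + 1 ≠ N → AskeyWilson.gammaCoeff q a b c d (m + 1) ≠ 0 := by
    intro m hm h
    refine hm ?_
    have : m + 1 ∈ AskeyWilson.Lam q a b c d := ⟨Nat.succ_pos m, h⟩
    rwa [hLam] at this
  have hR := AskeyWilson.racahRegular_of_gammaCoeff_ne_zero hq0 hq1 hN.1 hab hc hd ha2 hb2 hγne
  have ha := hR.a_ne_zero
  have hr0 : r ≠ 0 := by
    rintro rfl
    exact hq0 (by rw [← hr, zero_pow two_ne_zero])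
  have he : ∀ k : ℕ, a * b * c * d * q ^ k ≠ 1 := fun k h =>
    habcd ⟨k, eq_inv_of_mul_eq_one_left h⟩
  have hdm := AskeyWilson.monicPoly_degree_and_monic hq0 hq1 ha he
  have horth : ∀ n m, n ≠ m → AskeyWilson.sobolevLinear hr hq1 hγ
      (AskeyWilson.monicPoly q a b c d n) (AskeyWilson.monicPoly q a b c d m) = 0 := by
    intro n m hnm
    rcases lt_or_gt_of_ne hnm with h | h
    · rw [AskeyWilson.sobolevLinear_symm]
      exact AskeyWilson.sobolevLinear_monicPoly_of_gt hr0 hr hq1 hR he hγ h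
    · exact AskeyWilson.sobolevLinear_monicPoly_of_gt hr0 hr hq1 hR he hγ h
  have hne := AskeyWilson.sobolevLinear_monicPoly_self_ne_zero hr0 hr hq1 hR he hγ hγne
  have hform := AskeyWilson.sobolevForm_eq hr hq0 hq1 ha hγ
  refine ⟨⟨fun n => (hdm n).1, fun n m hnm => ?_, fun n => ?_⟩, fun n => (hdm n).2,
    fun P hP hPorth => ?_⟩
  · rw [hform]
    exact horth n m hnm
  · rw [hform]
    exact hne n
  · exact AskeyWilson.exists_eq_C_mul_of_orthogonal
      (AskeyWilson.sobolevLinear_symm hr hq1 hγ) (fun n => (hdm n).1) (fun n => (hdm n).2) horth hne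
      hP fun n m hnm => by rw [← hform]; exact hPorth n m hnm
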